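/- Let $\Delta=\{0,1\}^{\mathbb N}$ be the Cantor space, let $C(\Delta)$ be the Banach space of continuous real-valued functions on $\Delta$ with the supremum norm, and let $\mathrm{SB}$ be the set of all closed linear subspaces of $C(\Delta)$, endowed with the Effros-Borel structure, i.e. the $\sigma$-algebra generated by the sets $\{Y\in\mathrm{SB} : Y\cap U\neq\emptyset\}$, where $U$ ranges over the open subsets of $C(\Delta)$. This makes $\mathrm{SB}$ a standard Borel space. An infinite dimensional Banach space $X$ is called hereditarily indecomposable if no closed subspace of $X$ is the direct sum of two infinite dimensional closed subspaces. Let $\mathrm{HI}$ be the set of all hereditarily indecomposable $X\in\mathrm{SB}$, and let $$\mathrm{C}_{\mathrm{HI}}=\{Y\in\mathrm{SB} : \text{there is } Z\in\mathrm{HI} \text{ that is linearly homeomorphic to a subspace of } Y\}.$$ Then $\mathrm{C}_{\mathrm{HI}}$ is $\Sigma^1_1$-hard: for every standard Borel space $S$ and every analytic subset $B\subseteq S$ there is a Borel measurable map $f:S\to\mathrm{SB}$ with $f^{-1}(\mathrm{C}_{\mathrm{HI}})=B$. -/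

import Mathlib

open MeasureTheory TopologicalSpace Set

universe u v

/-! ## Analytic sets and hardness in standard Borel spaces -/

/-- A subset `B` of a standard Borel space `Y` is analytic (that is, `Σ¹₁`) if it is an analytic set
for some Polish topology on `Y` whose Borel `σ`-algebra is the given one (the choice of the
topology is irrelevant). -/
def IsSigma11 {Y : Type v} [MeasurableSpace Y] (B : Set Y) : Prop :=
  ∃ τ : TopologicalSpace Y, @PolishSpace Y τ ∧ @BorelSpace Y τ _ ∧ @AnalyticSet Y τ B

/-- `f : Y → X` is a Borel reduction of `B ⊆ Y` to `A ⊆ X`. -/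
def IsBorelReduction {Y : Type v} {X : Type u} [MeasurableSpace Y] [MeasurableSpace X]
    (f : Y → X) (B : Set Y) (A : Set X) : Prop :=
  Measurable f ∧ f ⁻¹' A = B

/-- A subset `A` of a standard Borel space `X` is `Σ¹₁`-hard if every analytic subset of every
standard Borel space is Borel reducible to `A`. -/
def IsSigma11Hard {X : Type u} [MeasurableSpace X] [StandardBorelSpace X] (A : Set X) : Prop :=
  ∀ (Y : Type v) [MeasurableSpace Y] [StandardBorelSpace Y] (B : Set Y),
    IsSigma11 B → ∃ f : Y → X, IsBorelReduction f B A

/-! ## The Effros-Borel structure on the closed linear subspaces -/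

/-- The Effros-Borel structure on the set of closed linear subspaces of `E`: the `σ`-algebra
generated by the sets `{Y | Y ∩ U ≠ ∅}`, `U` open in `E` (it is the trace of the Effros-Borel
structure on the nonempty closed subsets of `E`). -/
instance effrosBorel (E : Type u) [NormedAddCommGroup E] [NormedSpace ℝ E] :
    MeasurableSpace (ClosedSubmodule ℝ E) :=
  MeasurableSpace.generateFrom
    {A | ∃ U : Set E, IsOpen U ∧ A = {Y : ClosedSubmodule ℝ E | ((Y : Set E) ∩ U).Nonempty}}

section StandardBorel

variable {E : Type u} [NormedAddCommGroup E] [NormedSpace ℝ E]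

theorem effrosBorel_measurableSet {U : Set E} (hU : IsOpen U) :
    MeasurableSet {Y : ClosedSubmodule ℝ E | ((Y : Set E) ∩ U).Nonempty} :=
  MeasurableSpace.measurableSet_generateFrom ⟨U, hU, rfl⟩

variable [SecondCountableTopology E]

/-- Which basic open sets does a closed subspace meet? -/
def effrosCode (Y : ClosedSubmodule ℝ E) : countableBasis E → Prop :=
  fun U => ((Y : Set E) ∩ U).Nonempty

theorem effros_meets_iff (Y : ClosedSubmodule ℝ E) {O : Set E} (hO : IsOpen O) :
    ((Y : Set E) ∩ O).Nonempty ↔ ∃ U : countableBasis E, (U : Set E) ⊆ O ∧ effrosCode Y U := by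
  constructor
  · rintro ⟨x, hxY, hxO⟩
    obtain ⟨U, hU, hxU, hUO⟩ := (isBasis_countableBasis E).exists_subset_of_mem_open hxO hO
    exact ⟨⟨U, hU⟩, hUO, x, hxY, hxU⟩
  · rintro ⟨U, hUO, x, hxY, hxU⟩
    exact ⟨x, hxY, hUO hxU⟩

theorem effrosCode_mem_iff (Y : ClosedSubmodule ℝ E) (x : E) :
    x ∈ Y ↔ ∀ U : countableBasis E, x ∈ (U : Set E) → effrosCode Y U := by
  constructor
  · intro hx U hxU
    exact ⟨x, hx, hxU⟩
  · intro h
    rw [← SetLike.mem_coe, ← Y.isClosed.closure_eq, mem_closure_iff]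
    intro O hO hxO
    obtain ⟨U, hU, hxU, hUO⟩ := (isBasis_countableBasis E).exists_subset_of_mem_open hxO hO
    obtain ⟨y, hyY, hyU⟩ := h ⟨U, hU⟩ hxU
    exact ⟨y, hUO hyU, hyY⟩

theorem effrosCode_injective :
    Function.Injective (effrosCode : ClosedSubmodule ℝ E → countableBasis E → Prop) := by
  intro Y Z h
  refine SetLike.ext fun x => ?_
  rw [effrosCode_mem_iff, effrosCode_mem_iff, h]

theorem effrosBorel_eq_comap :
    effrosBorel E = MeasurableSpace.comap effrosCode MeasurableSpace.pi := by
  apply le_antisymm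
  · refine MeasurableSpace.generateFrom_le ?_
    rintro _ ⟨O, hO, rfl⟩
    have : {Y : ClosedSubmodule ℝ E | ((Y : Set E) ∩ O).Nonempty} =
        effrosCode ⁻¹' (⋃ U : {U : countableBasis E // (U : Set E) ⊆ O}, {S | S U.1}) := by
      ext Y
      simp [effros_meets_iff Y hO]
    rw [this]
    have : Countable (countableBasis E) := (countable_countableBasis E).to_subtype
    exact ⟨_, MeasurableSet.iUnion fun U => (measurable_pi_apply U.1).setOf, rfl⟩
  · refine Measurable.comap_le (measurable_pi_iff.2 fun U => ?_)
    exact measurableSet_setOfPred.1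
      (effrosBorel_measurableSet (isOpen_of_mem_countableBasis U.2))

theorem effrosCode_range [CompleteSpace E] :
    range (effrosCode : ClosedSubmodule ℝ E → countableBasis E → Prop) =
      {S | (∀ U : countableBasis E, (0 : E) ∈ (U : Set E) → S U) ∧
        (∀ U V W : countableBasis E,
          (∀ x ∈ (U : Set E), ∀ y ∈ (V : Set E), x + y ∈ (W : Set E)) → S U → S V → S W) ∧
        (∀ (q : ℚ) (U V : countableBasis E),
          (∀ x ∈ (U : Set E), (q : ℝ) • x ∈ (V : Set E)) → S U → S V) ∧
        (∀ (k : ℕ) (U : countableBasis E), S U → ∃ V : countableBasis E,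
          (closure (V : Set E) ⊆ U ∧ ∃ c, (V : Set E) ⊆ Metric.ball c ((1 / 2) ^ k)) ∧ S V)} := by
  have hB := isBasis_countableBasis E
  ext S
  simp only [mem_range, mem_ofPred_eq]
  constructor
  · rintro ⟨Y, rfl⟩
    refine ⟨fun U hU => ⟨0, Y.zero_mem, hU⟩, ?_, ?_, ?_⟩
    · rintro U V W h ⟨x, hx, hxU⟩ ⟨y, hy, hyV⟩
      exact ⟨x + y, Y.add_mem hx hy, h x hxU y hyV⟩
    · rintro q U V h ⟨x, hx, hxU⟩
      exact ⟨(q : ℝ) • x, Y.smul_mem _ hx, h x hxU⟩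
    · rintro k U ⟨x, hx, hxU⟩
      have hO : IsOpen ((U : Set E) ∩ Metric.ball x ((1 / 2) ^ k)) :=
        (isOpen_of_mem_countableBasis U.2).inter Metric.isOpen_ball
      have hxO : x ∈ (U : Set E) ∩ Metric.ball x ((1 / 2) ^ k) :=
        ⟨hxU, Metric.mem_ball_self (by positivity)⟩
      obtain ⟨V, hV, hxV, hVO⟩ := hB.exists_closure_subset (hO.mem_nhds hxO)
      exact ⟨⟨V, hV⟩, ⟨hVO.trans inter_subset_left, x,
        (subset_closure.trans hVO).trans inter_subset_right⟩, x, hx, hxV⟩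
  · rintro ⟨h0, hadd, hsmul, hlim⟩
    have hmono : ∀ U V : countableBasis E, (U : Set E) ⊆ V → S U → S V := by
      intro U V hUV
      refine hsmul 1 U V fun x hx => ?_
      simpa using hUV hx
    refine ⟨⟨{ carrier := {x | ∀ U : countableBasis E, x ∈ (U : Set E) → S U}
               zero_mem' := h0
               add_mem' := ?_
               smul_mem' := ?_ }, ?_⟩, ?_⟩
    · intro x y hx hy W hW
      have hW' : (W : Set E) ∈ nhds (x + y) := (isOpen_of_mem_countableBasis W.2).mem_nhds hW
      have ht := (continuous_add (M := E)).continuousAt (x := (x, y)) hW'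
      obtain ⟨A, hA, A', hA', hAA⟩ := Filter.mem_prod_iff.1 (nhds_prod_eq (x := x) (y := y) ▸ ht)
      obtain ⟨U, hU, hxU, hUA⟩ := hB.mem_nhds_iff.1 hA
      obtain ⟨V, hV, hyV, hVA⟩ := hB.mem_nhds_iff.1 hA'
      refine hadd ⟨U, hU⟩ ⟨V, hV⟩ W (fun a ha b hb => ?_) (hx ⟨U, hU⟩ hxU) (hy ⟨V, hV⟩ hyV)
      have hab : (a, b) ∈ A ×ˢ A' := ⟨hUA ha, hVA hb⟩
      exact hAA hab
    · intro c x hx W hW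
      have hWo := isOpen_of_mem_countableBasis W.2
      have hO : IsOpen {r : ℝ | r • x ∈ (W : Set E)} :=
        hWo.preimage (continuous_id.smul continuous_const)
      obtain ⟨q, hq⟩ := Rat.isDenseEmbedding_coe_real.dense.exists_mem_open hO ⟨c, hW⟩
      have hO' : IsOpen {y : E | (q : ℝ) • y ∈ (W : Set E)} :=
        hWo.preimage (continuous_const_smul _)
      have hq' : x ∈ {y : E | (q : ℝ) • y ∈ (W : Set E)} := hq
      obtain ⟨U, hU, hxU, hUO⟩ := hB.exists_subset_of_mem_open hq' hO'
      exact hsmul q ⟨U, hU⟩ W (fun y hy => hUO hy) (hx _ hxU)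
    · change IsClosed {x | ∀ U : countableBasis E, x ∈ (U : Set E) → S U}
      rw [← isOpen_compl_iff, isOpen_iff_forall_mem_open]
      intro x hx
      simp only [mem_compl_iff, mem_ofPred_eq, not_forall] at hx
      obtain ⟨U, hxU, hSU⟩ := hx
      exact ⟨U, fun y hy h => hSU (h U hy), isOpen_of_mem_countableBasis U.2, hxU⟩
    · funext U₀
      refine propext ⟨?_, ?_⟩
      · rintro ⟨x, hx, hxU⟩
        exact hx U₀ hxU
      · intro hU₀
        choose! N hN using hlim
        let V : ℕ → {U : countableBasis E // S U} := fun n =>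
          Nat.rec ⟨U₀, hU₀⟩ (fun k U => ⟨N k U.1, (hN k U.1 U.2).2⟩) n
        have hVs : ∀ n, closure ((V (n + 1)).1 : Set E) ⊆ (V n).1 :=
          fun n => (hN n (V n).1 (V n).2).1.1
        have hVb : ∀ n, ∃ c, ((V (n + 1)).1 : Set E) ⊆ Metric.ball c ((1 / 2) ^ n) :=
          fun n => (hN n (V n).1 (V n).2).1.2
        have hanti : Antitone fun n => ((V n).1 : Set E) :=
          antitone_nat_of_succ_le fun n => subset_closure.trans (hVs n)
        have hdist : ∀ n, ∀ a ∈ ((V (n + 1)).1 : Set E), ∀ b ∈ ((V (n + 1)).1 : Set E),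
            dist a b ≤ 2 * (1 / 2) ^ n := by
          intro n a ha b hb
          obtain ⟨c, hc⟩ := hVb n
          have h1 := Metric.mem_ball.1 (hc ha)
          have h2 := Metric.mem_ball.1 (hc hb)
          have := dist_triangle_right a b c
          linarith
        have hne : ∀ n, ∃ x, x ∈ ((V (n + 1)).1 : Set E) :=
          fun n => nonempty_of_mem_countableBasis (V (n + 1)).1.2
        choose x hx using hne
        have hcau : CauchySeq x := by
          refine cauchySeq_of_le_geometric (1 / 2) 2 (by norm_num) fun n => ?_
          exact hdist n _ (hx n) _ (hanti (Nat.le_succ _) (hx (n + 1)))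
        obtain ⟨z, hz⟩ := cauchySeq_tendsto_of_complete hcau
        have hzV : ∀ n, z ∈ ((V n).1 : Set E) := by
          intro n
          refine hVs n (mem_closure_of_tendsto hz ?_)
          filter_upwards [Filter.eventually_ge_atTop n] with m hm
          exact hanti (Nat.succ_le_succ hm) (hx m)
        refine ⟨z, ?_, hzV 0⟩
        intro W hzW
        obtain ⟨ε, hε, hball⟩ := Metric.isOpen_iff.1 (isOpen_of_mem_countableBasis W.2) z hzW
        obtain ⟨n, hn⟩ := exists_pow_lt_of_lt_one (show 0 < ε / 2 by positivity)
          (show (1 / 2 : ℝ) < 1 by norm_num)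
        refine hmono (V (n + 1)).1 W (fun y hy => hball ?_) (V (n + 1)).2
        have := hdist n y hy z (hzV (n + 1))
        rw [Metric.mem_ball]
        linarith

/-- The closed linear subspaces of a separable Banach space form a standard Borel space. -/
instance effrosBorel_standardBorelSpace [CompleteSpace E] :
    StandardBorelSpace (ClosedSubmodule ℝ E) := by
  have hc : Countable (countableBasis E) := (countable_countableBasis E).to_subtype
  have hm : ∀ U : countableBasis E,
      Measurable fun S : countableBasis E → Prop => S U := fun U => measurable_pi_apply U
  have hr : MeasurableSet (range (effrosCode (E := E))) := by
    rw [effrosCode_range]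
    refine measurableSet_setOfPred.2 ?_
    refine .and (.forall fun U => .imp measurable_const (hm U)) (.and ?_ (.and ?_ ?_))
    · exact .forall fun U => .forall fun V => .forall fun W =>
        .imp measurable_const (.imp (hm U) (.imp (hm V) (hm W)))
    · exact .forall fun q => .forall fun U => .forall fun V =>
        .imp measurable_const (.imp (hm U) (hm V))
    · exact .forall fun k => .forall fun U => .imp (hm U)
        (.exists fun V => .and measurable_const (hm V))
  have hs : StandardBorelSpace (range (effrosCode (E := E))) := hr.standardBorel
  obtain ⟨τ, hτb, hτp⟩ := hs.polish
  let e := Equiv.ofInjective (effrosCode (E := E)) effrosCode_injective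
  refine ⟨τ.induced e, @BorelSpace.mk _ (τ.induced e) _ ?_, e.polishSpace_induced⟩
  rw [borel_comap, ← hτb.measurable_eq, effrosBorel_eq_comap]
  exact (MeasurableSpace.comap_comp (g := e) (f := Subtype.val)).symm

end StandardBorel

/-! ## The coding of the separable Banach spaces -/

/-- The coding of the separable (real) Banach spaces: the set of all closed linear subspaces of
`C(Δ)`, with `Δ` the Cantor space `{0,1}^ℕ`. -/
abbrev SB : Type := ClosedSubmodule ℝ C(ℕ → Bool, ℝ)

/-- `V ⊆ X` is the direct sum of two infinite dimensional (closed) subspaces. -/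
def IsDecomposable {X : Type u} [NormedAddCommGroup X] [NormedSpace ℝ X]
    (V : Submodule ℝ X) : Prop :=
  ∃ Z W : Submodule ℝ X, IsClosed (Z : Set X) ∧ IsClosed (W : Set X) ∧
    ¬ FiniteDimensional ℝ Z ∧ ¬ FiniteDimensional ℝ W ∧ Z ⊓ W = ⊥ ∧ Z ⊔ W = V

/-- An infinite dimensional Banach space is hereditarily indecomposable if none of its (closed)
subspaces is the direct sum of two infinite dimensional (closed) subspaces. -/
def IsHereditarilyIndecomposable (X : Type u) [NormedAddCommGroup X] [NormedSpace ℝ X] : Prop :=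
  ¬ FiniteDimensional ℝ X ∧
    ∀ V : Submodule ℝ X, IsClosed (V : Set X) → ¬ IsDecomposable V

/-- `X ↪ Y`: there is a linear map from `X` to `Y` that is a homeomorphism onto its image. -/
def LinearlyEmbeds (X : Type u) (Y : Type v) [NormedAddCommGroup X] [NormedSpace ℝ X]
    [NormedAddCommGroup Y] [NormedSpace ℝ Y] : Prop :=
  ∃ T : X →L[ℝ] Y, Topology.IsEmbedding T

/-- The class of hereditarily indecomposable spaces in `SB`. -/
def HI : Set SB := {X | IsHereditarilyIndecomposable X.toSubmodule}

/-- For `P ⊆ SB`, the set of all `Y ∈ SB` into which some element of `P` embeds. -/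
def containing (P : Set SB) : Set SB :=
  {Y | ∃ Z ∈ P, LinearlyEmbeds Z.toSubmodule Y.toSubmodule}

/-!
Let `T` be a tree on `ℕ`. The reduction sends `T` to a closed subspace `treeCode T` of `C(Δ)` that
contains a hereditarily indecomposable space exactly if `T` has an infinite branch. As an analytic
set consists of the points at which a tree depending on the point in a Borel way has an infinite
branch, this proves the hardness.

The branches of the tree carry one fixed hereditarily indecomposable space `X`, of the kind
constructed by Gowers and Maurey: the completion of the finitely supported sequences under the
supremum of `|f x|` over the norming functionals `f` of `MixedTsirelson.Nrm`. A functional of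
index `i` is `1 / mᵢ` times a sum of at most `nᵢ` successive functionals, where
`m₀ < n₀ < m₁ < n₁ < ⋯` grow fast. For even `i` the terms are arbitrary; for odd `i` they form
special sequences, in which the index of each term codes all of its predecessors.
* Long averages of blocks (`HasTails.exists_average`, by James' argument) form rapidly increasing
  sequences, and the normalized averages of these are exact (`IsRIS.isExact`): only functionals of
  one prescribed index `w` are large on them.
* In any two infinite dimensional subspaces there are vectors `x₀, x₂, …` and `x₁, x₃, …` such that
  `x₀, x₁, x₂, …` is dependent: `x k` is exact and is normed by a functional `f k`, and the `f k`
  form a special sequence. The sum of the `f k` shows that `∑ x k` is large. On `∑ (-1) ^ k x k` a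
  special functional is small, since the signs cancel as long as it agrees with the `f k`, and since
  all indices differ once it departs from them (`IsDependent.abs_act_special_le`).
* The estimate for the remaining functionals is `IsRIS.abs_act_le`: an induction on the number
  of times that a functional is expanded into its terms replaces the usual comparison with an
  auxiliary space.
So the sum of the two spaces is not closed (`IsNormedBy.isHISub`).

The tree space is spanned by vectors `nodeVec s`, for the nodes `s` of the tree, with the norm
`‖∑ a_s nodeVec s‖ = sup_σ ‖∑ a_(σ|n) e_n‖`, where `σ` runs over all branches and `e_n` is the basis
of `X`. The nodes on one branch span an isometric copy of `X`, because the basis is monotone. The space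
above a node is, up to one dimension, the `c₀`-sum of the spaces above the children of the node.
Let `Z` be a hereditarily indecomposable subspace of it. If the projections to the children were
strictly singular on `Z`, then a gliding hump would give `c₀` inside `Z`, which is impossible. So
some projection is an isomorphism on an infinite dimensional subspace of `Z`
(`exists_child`), and `Z` leads to an infinite branch (`exists_branch`). An isometric embedding into
`C(Δ)` comes from the Banach–Mazur theorem.
-/


/-! ### The growth of the parameters -/

namespace MixedTsirelson

/-- The number of terms that a functional of weight `x` may have. -/
def growth (x : ℕ) : ℕ := 10 * x ^ (x ^ 2 + 3)

/-- The weights `m₀ < m₁ < ⋯`: a functional of index `i` is `1 / mᵢ` times a sum. -/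
def mm : ℕ → ℕ
  | 0 => 2
  | j + 1 => growth (mm j) ^ 2

/-- The lengths `n₀ < n₁ < ⋯`: a functional of index `i` has at most `nᵢ` terms. -/
def nn (j : ℕ) : ℕ := growth (mm j)

theorem mm_succ (j : ℕ) : mm (j + 1) = nn j ^ 2 := rfl

theorem nn_eq (j : ℕ) : nn j = 10 * mm j ^ (mm j ^ 2 + 1) * mm j ^ 2 := by
  rw [nn, growth, mul_assoc, ← pow_add]

theorem le_growth {x : ℕ} (hx : 1 ≤ x) : x ^ 2 ≤ growth x :=
  calc x ^ 2 ≤ x ^ (x ^ 2 + 3) := Nat.pow_le_pow_right hx (by omega)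
    _ ≤ growth x := by unfold growth; omega

theorem two_le_mm : ∀ j, 2 ≤ mm j
  | 0 => le_rfl
  | j + 1 => by
    have h := two_le_mm j
    have h1 : mm j ^ 2 ≤ growth (mm j) := le_growth (by omega)
    rw [mm]
    have h2 : 2 ≤ growth (mm j) := by nlinarith
    nlinarith

theorem sq_mm_le_nn (j : ℕ) : mm j ^ 2 ≤ nn j := le_growth (by have := two_le_mm j; omega)

theorem mm_le_nn (j : ℕ) : mm j ≤ nn j :=
  (Nat.le_self_pow two_ne_zero _).trans (sq_mm_le_nn j)

theorem nn_le_mm_succ (j : ℕ) : nn j ≤ mm (j + 1) := Nat.le_self_pow two_ne_zero _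

theorem mm_strictMono : StrictMono mm := strictMono_nat_of_lt_succ fun j => by
  have h := two_le_mm j
  have h1 := sq_mm_le_nn j
  have h2 := nn_le_mm_succ j
  nlinarith

theorem nn_le_mm {i j : ℕ} (h : i < j) : nn i ≤ mm j :=
  (nn_le_mm_succ i).trans (mm_strictMono.monotone h)

theorem nn_mono : Monotone nn := monotone_nat_of_le_succ fun j =>
  (nn_le_mm_succ j).trans (mm_le_nn _)

theorem sq_mm_le_mm {i j : ℕ} (h : i < j) : mm i ^ 2 ≤ mm j :=
  (sq_mm_le_nn i).trans (nn_le_mm h)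

theorem mm_pos (j : ℕ) : (0 : ℝ) < mm j := by
  have := two_le_mm j
  positivity

theorem two_le_mm' (j : ℕ) : (2 : ℝ) ≤ mm j := by exact_mod_cast two_le_mm j

theorem mm_mono' {i j : ℕ} (h : i ≤ j) : (mm i : ℝ) ≤ mm j := by
  exact_mod_cast mm_strictMono.monotone h

theorem lt_mm (j : ℕ) : j < mm j := (mm_strictMono.le_apply (x := j)).lt_of_ne fun h => by
  rcases j with _ | j
  · simp [mm] at h
  · have h1 : j ≤ mm j := mm_strictMono.le_apply
    have h2 := sq_mm_le_mm (Nat.lt_succ_self j)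
    have h3 := two_le_mm j
    have h4 : mm (j + 1) = j + 1 := h.symm
    rw [Nat.succ_eq_add_one, h4] at h2
    nlinarith

/-! ### Interval restrictions and the action of functionals -/

/-- The restriction of a finitely supported functional to the interval `[a, b)`. -/
def cut (a b : ℕ) (f : ℕ →₀ ℚ) : ℕ →₀ ℚ := f.filter fun k => a ≤ k ∧ k < b

theorem cut_apply (a b : ℕ) (f : ℕ →₀ ℚ) (n : ℕ) :
    cut a b f n = if a ≤ n ∧ n < b then f n else 0 := Finsupp.filter_apply ..

theorem cut_cut (a b c d : ℕ) (f : ℕ →₀ ℚ) :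
    cut a b (cut c d f) = cut (max a c) (min b d) f := by
  ext n
  simp only [cut_apply]
  split_ifs <;> first | rfl | omega

/-- Restricting to `[a, b)` amounts to moving the end points of the other interval into it. -/
theorem cut_cut_clamp (a b c d : ℕ) (h : c ≤ d) (f : ℕ →₀ ℚ) :
    cut a b (cut c d f) = cut (max a (min b c)) (max a (min b d)) f := by
  ext n
  simp only [cut_apply]
  split_ifs <;> first | rfl | omega

theorem cut_smul (a b : ℕ) (t : ℚ) (f : ℕ →₀ ℚ) : cut a b (t • f) = t • cut a b f := by
  ext n
  simp [cut_apply]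

theorem cut_sum (a b : ℕ) {ι : Type*} (s : Finset ι) (g : ι → ℕ →₀ ℚ) :
    cut a b (∑ l ∈ s, g l) = ∑ l ∈ s, cut a b (g l) := by
  ext n
  simp only [cut_apply, Finsupp.finsetSum_apply]
  split_ifs <;> simp

theorem exists_cut_eq_self (f : ℕ →₀ ℚ) : ∃ b, ∀ a, cut 0 (b + a) f = f := by
  refine ⟨f.support.sup id + 1, fun a => ?_⟩
  ext n
  rw [cut_apply]
  split_ifs with h
  · rfl
  · by_contra hn
    have hn' : n ∈ f.support := by
      rw [Finsupp.mem_support_iff]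
      exact fun h0 => hn h0.symm
    have := Finset.le_sup (f := id) hn'
    simp only [id] at this
    omega

/-- The action of a functional on finitely supported vectors. -/
noncomputable def act (f : ℕ →₀ ℚ) : (ℕ →₀ ℝ) →ₗ[ℝ] ℝ :=
  Finsupp.linearCombination ℝ fun n => (f n : ℝ)

theorem act_apply (f : ℕ →₀ ℚ) (x : ℕ →₀ ℝ) : act f x = x.sum fun n c => c * f n := by
  simp [act, Finsupp.linearCombination_apply]

theorem act_congr {f g : ℕ →₀ ℚ} {x : ℕ →₀ ℝ} (h : ∀ n, x n ≠ 0 → f n = g n) :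
    act f x = act g x := by
  rw [act_apply, act_apply]
  refine Finsupp.sum_congr fun n hn => ?_
  rw [h n (Finsupp.mem_support_iff.1 hn)]

theorem act_eq_zero {f : ℕ →₀ ℚ} {x : ℕ →₀ ℝ} (h : ∀ n, x n ≠ 0 → f n = 0) :
    act f x = 0 := by
  rw [act_congr (g := 0) (fun n hn => by simp [h n hn]), act_apply]
  simp

theorem act_smul (t : ℚ) (f : ℕ →₀ ℚ) (x : ℕ →₀ ℝ) : act (t • f) x = t * act f x := by
  rw [act_apply, act_apply, Finsupp.mul_sum]
  refine Finsupp.sum_congr fun n _ => ?_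
  simp
  ring

theorem act_sum {ι : Type*} (s : Finset ι) (g : ι → ℕ →₀ ℚ) (x : ℕ →₀ ℝ) :
    act (∑ l ∈ s, g l) x = ∑ l ∈ s, act (g l) x := by
  simp only [act_apply, Finsupp.sum]
  rw [Finset.sum_comm]
  refine Finset.sum_congr rfl fun n _ => ?_
  rw [Finsupp.finsetSum_apply, ← Finset.mul_sum]
  push_cast
  rfl

theorem act_single (n : ℕ) (s : ℚ) (x : ℕ →₀ ℝ) : act (Finsupp.single n s) x = s * x n := by
  rw [act_apply, Finsupp.sum, Finset.sum_eq_single n]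
  · simp [mul_comm]
  · intro k _ hk
    simp [hk.symm]
  · intro h
    simp [Finsupp.notMem_support_iff.1 h]

/-! ### The norming functionals -/

/-- An injective numbering of the finitely supported rational functionals. -/
noncomputable def enc : (ℕ →₀ ℚ) → ℕ := (Countable.exists_injective_nat (ℕ →₀ ℚ)).choose

theorem enc_injective : Function.Injective enc :=
  (Countable.exists_injective_nat (ℕ →₀ ℚ)).choose_spec

/-- The coding of special sequences: `code q g l` codes the pair of `q` and `g 0, …, g (l - 1)`. -/
noncomputable def code (q : ℕ) (g : ℕ → ℕ →₀ ℚ) : ℕ → ℕ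
  | 0 => Nat.pair q 0 + 1
  | l + 1 => Nat.pair (code q g l) (enc (g l) + 1) + 1

theorem code_lt_succ (q : ℕ) (g : ℕ → ℕ →₀ ℚ) (l : ℕ) : code q g l < code q g (l + 1) :=
  Nat.lt_succ_of_le (Nat.left_le_pair _ _)

theorem code_strictMono (q : ℕ) (g : ℕ → ℕ →₀ ℚ) : StrictMono (code q g) :=
  strictMono_nat_of_lt_succ (code_lt_succ q g)

theorem lt_code (q : ℕ) (g : ℕ → ℕ →₀ ℚ) (l : ℕ) : q < code q g l :=
  lt_of_lt_of_le (Nat.lt_succ_of_le (Nat.left_le_pair q 0))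
    ((code_strictMono q g).monotone (Nat.zero_le l))

theorem code_congr (q : ℕ) {g g' : ℕ → ℕ →₀ ℚ} :
    ∀ {l : ℕ}, (∀ i < l, g i = g' i) → code q g l = code q g' l
  | 0, _ => rfl
  | l + 1, h => by
    rw [code, code, code_congr q fun i hi => h i (Nat.lt_succ_of_lt hi), h l (Nat.lt_succ_self l)]

/-- The coding is injective: equal codes come from equal initial segments. -/
theorem code_injective {q : ℕ} {g g' : ℕ → ℕ →₀ ℚ} :
    ∀ {l l' : ℕ}, code q g l = code q g' l' → l = l' ∧ ∀ i < l, g i = g' i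
  | 0, 0, _ => ⟨rfl, by simp⟩
  | 0, l' + 1, h => by simp [code, Nat.pair_eq_pair] at h
  | l + 1, 0, h => by simp [code, Nat.pair_eq_pair] at h
  | l + 1, l' + 1, h => by
    simp only [code, Nat.add_right_cancel_iff, Nat.pair_eq_pair] at h
    obtain ⟨h1, h2⟩ := code_injective h.1
    subst h1
    refine ⟨rfl, fun i hi => ?_⟩
    rcases Nat.lt_succ_iff_lt_or_eq.1 hi with hi | rfl
    · exact h2 i hi
    · exact enc_injective h.2

/-- The norming functionals. `Nrm none f` says that `f` is a multiple of a coordinate functional,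
by a factor of modulus at most one; `Nrm (some i) f` says that `f` is a norming functional of
index `i`, i.e. of weight `mᵢ`. For even `i` the terms `g l` are arbitrary norming functionals,
restricted to successive intervals; for odd `i` they form a special sequence: the index of each
term is prescribed by the code of its predecessors. -/
inductive Nrm : Option ℕ → (ℕ →₀ ℚ) → Prop
  | unit (n : ℕ) (s : ℚ) (hs : |s| ≤ 1) : Nrm none (Finsupp.single n s)
  | free (p d : ℕ) (hd : d ≤ nn (2 * p)) (g : ℕ → ℕ →₀ ℚ) (o : ℕ → Option ℕ)
      (c : ℕ → ℕ) (hc : Monotone c) (hg : ∀ l < d, Nrm (o l) (g l)) :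
      Nrm (some (2 * p)) ((1 / mm (2 * p) : ℚ) • ∑ l ∈ Finset.range d, cut (c l) (c (l + 1)) (g l))
  | special (q d : ℕ) (hd : d ≤ nn (2 * q + 1)) (s : ℚ) (hs : |s| ≤ 1) (a b : ℕ)
      (g : ℕ → ℕ →₀ ℚ) (c : ℕ → ℕ) (hc : Monotone c)
      (hcut : ∀ l < d, cut (c l) (c (l + 1)) (g l) = g l)
      (hg : ∀ l < d, Nrm (some (2 * code q g l)) (g l)) :
      Nrm (some (2 * q + 1)) ((1 / mm (2 * q + 1) : ℚ) • (s • cut a b (∑ l ∈ Finset.range d, g l)))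

theorem monotone_clamp {c : ℕ → ℕ} (hc : Monotone c) (a b : ℕ) :
    Monotone fun l => max a (min b (c l)) := fun l l' h => by
  have := hc h
  simp only
  omega

theorem Nrm.cut {o : Option ℕ} {f : ℕ →₀ ℚ} (h : Nrm o f) (a b : ℕ) : Nrm o (cut a b f) := by
  cases h with
  | unit n s hs =>
    have : MixedTsirelson.cut a b (Finsupp.single n s) =
        Finsupp.single n (if a ≤ n ∧ n < b then s else 0) := by
      ext k
      rw [cut_apply, Finsupp.single_apply, Finsupp.single_apply]
      split_ifs <;> first | rfl | (subst_vars; tauto)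
    rw [this]
    refine .unit _ _ ?_
    split_ifs
    · exact hs
    · simp
  | free p d hd g o c hc hg =>
    rw [cut_smul, cut_sum]
    simp_rw [cut_cut_clamp a b _ _ (hc (Nat.le_succ _))]
    exact .free p d hd g o _ (monotone_clamp hc a b) hg
  | special q d hd s hs a' b' g c hc hcut hg =>
    rw [cut_smul, cut_smul, cut_cut]
    exact .special q d hd s hs _ _ g c hc hcut hg

theorem Nrm.smul {o : Option ℕ} {f : ℕ →₀ ℚ} (h : Nrm o f) {t : ℚ} (ht : |t| ≤ 1) :
    Nrm o (t • f) := by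
  have hmul : ∀ {s : ℚ}, |s| ≤ 1 → |t * s| ≤ 1 := fun {s} hs => by
    rw [abs_mul]
    exact mul_le_one₀ ht (abs_nonneg _) hs
  induction h with
  | unit n s hs =>
    rw [Finsupp.smul_single]
    exact .unit _ _ (hmul hs)
  | free p d hd g o c hc hg ih =>
    rw [smul_comm, Finset.smul_sum]
    simp_rw [← cut_smul]
    exact .free p d hd (fun l => t • g l) o _ hc ih
  | special q d hd s hs a' b' g c hc hcut hg _ =>
    rw [smul_comm, smul_smul t s]
    exact .special q d hd _ (hmul hs) _ _ g c hc hcut hg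

/-- Every norming functional of index `i`, cut down to an interval, is `1 / mᵢ` times a sum of at
most `nᵢ` norming functionals restricted to successive subintervals. -/
theorem Nrm.exists_eq_sum {i : ℕ} {f : ℕ →₀ ℚ} (h : Nrm (some i) f) (a b : ℕ) :
    ∃ (d : ℕ) (g : ℕ → ℕ →₀ ℚ) (o : ℕ → Option ℕ) (c : ℕ → ℕ), d ≤ nn i ∧ Monotone c ∧
      (∀ n, c 0 ≤ n → n < c d → a ≤ n ∧ n < b) ∧ (∀ l < d, Nrm (o l) (g l)) ∧
      MixedTsirelson.cut a b f =
        (1 / mm i : ℚ) • ∑ l ∈ Finset.range d, MixedTsirelson.cut (c l) (c (l + 1)) (g l) := by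
  cases h with
  | free p d hd g o c hc hg =>
    refine ⟨d, g, o, fun l => max a (min b (c l)), hd, monotone_clamp hc a b,
      fun n h1 h2 => by simp only at h1 h2; omega, hg, ?_⟩
    rw [cut_smul, cut_sum]
    simp_rw [cut_cut_clamp a b _ _ (hc (Nat.le_succ _))]
  | special q d hd s hs a' b' g c hc hcut hg =>
    refine ⟨d, fun l => s • MixedTsirelson.cut a' b' (g l), fun l => some (2 * code q g l),
      fun l => max a (min b (c l)), hd, monotone_clamp hc a b,
      fun n h1 h2 => by simp only at h1 h2; omega,
      fun l hl => ((hg l hl).cut a' b').smul hs, ?_⟩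
    rw [cut_smul, cut_smul, cut_cut, cut_sum, Finset.smul_sum]
    congr 1
    refine Finset.sum_congr rfl fun l hl => ?_
    rw [cut_smul]
    congr 1
    ext n
    have hn : g l n ≠ 0 → c l ≤ n ∧ n < c (l + 1) := by
      rw [← hcut l (Finset.mem_range.1 hl), cut_apply]
      intro h
      by_contra h'
      exact h (if_neg h')
    have := hc (Nat.le_succ l)
    simp only [cut_apply]
    by_cases h0 : g l n = 0
    · simp [h0]
    · have := hn h0
      split_ifs <;> first | rfl | omega

/-- Terms of modulus at most one, restricted to successive intervals, do not add up. -/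
theorem abs_sum_cut_apply_le_one {n : ℕ} (g : ℕ → ℕ →₀ ℚ) {c : ℕ → ℕ} (hc : Monotone c) {d : ℕ}
    (hg : ∀ l < d, |g l n| ≤ 1) : |∑ l ∈ Finset.range d, cut (c l) (c (l + 1)) (g l) n| ≤ 1 := by
  suffices h : |∑ l ∈ Finset.range d, cut (c l) (c (l + 1)) (g l) n| ≤ 1 ∧
      (c d ≤ n → ∑ l ∈ Finset.range d, cut (c l) (c (l + 1)) (g l) n = 0) from h.1
  induction d with
  | zero => simp
  | succ d ih =>
    obtain ⟨h1, h2⟩ := ih fun l hl => hg l (by omega)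
    rw [Finset.sum_range_succ, cut_apply]
    have hcd := hc (Nat.le_succ d)
    split_ifs with hn
    · rw [h2 hn.1, zero_add]
      exact ⟨hg d (by omega), fun h => absurd hn.2 (by omega)⟩
    · rw [add_zero]
      exact ⟨h1, fun h => h2 (hcd.trans h)⟩

theorem Nrm.abs_apply_le_one {o : Option ℕ} {f : ℕ →₀ ℚ} (h : Nrm o f) (n : ℕ) : |f n| ≤ 1 := by
  have hm : ∀ {i : ℕ} {s : ℚ}, |s| ≤ 1 → |(1 / mm i : ℚ) * s| ≤ 1 := fun {i s} hs => by
    have h2 : (2 : ℚ) ≤ mm i := by exact_mod_cast two_le_mm i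
    rw [abs_mul, abs_of_nonneg (by positivity)]
    refine mul_le_one₀ ?_ (abs_nonneg _) hs
    rw [div_le_one (by linarith)]
    linarith
  induction h with
  | unit k s hs =>
    rw [Finsupp.single_apply]
    split_ifs
    · exact hs
    · simp
  | free p d hd g o c hc hg ih =>
    rw [Finsupp.smul_apply, Finsupp.finsetSum_apply, smul_eq_mul]
    exact hm (abs_sum_cut_apply_le_one g hc ih)
  | special q d hd s hs a' b' g c hc hcut hg ih =>
    rw [Finsupp.smul_apply, smul_eq_mul]
    refine hm ?_
    rw [Finsupp.smul_apply, smul_eq_mul, abs_mul]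
    refine mul_le_one₀ hs (abs_nonneg _) ?_
    rw [cut_apply]
    split_ifs
    · rw [Finsupp.finsetSum_apply, ← Finset.sum_congr rfl fun l hl =>
        DFunLike.congr_fun (hcut l (Finset.mem_range.1 hl)) n]
      exact abs_sum_cut_apply_le_one g hc ih
    · simp

theorem Nrm.abs_apply_le {i : ℕ} {f : ℕ →₀ ℚ} (h : Nrm (some i) f) (n : ℕ) :
    |f n| ≤ 1 / mm i := by
  obtain ⟨d, g, o, c, -, hc, -, hg, heq⟩ := h.exists_eq_sum 0 (n + 1)
  have h1 := DFunLike.congr_fun heq n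
  rw [cut_apply, if_pos (by omega), Finsupp.smul_apply, Finsupp.finsetSum_apply, smul_eq_mul] at h1
  rw [h1, abs_mul, abs_of_nonneg (by positivity)]
  exact mul_le_of_le_one_right (by positivity)
    (abs_sum_cut_apply_le_one g hc fun l hl => (hg l hl).abs_apply_le_one n)

theorem abs_act_le_of_abs_apply_le {f : ℕ →₀ ℚ} {t : ℝ} (h : ∀ n, |(f n : ℝ)| ≤ t)
    (x : ℕ →₀ ℝ) : |act f x| ≤ (∑ n ∈ x.support, |x n|) * t := by
  rw [act_apply, Finsupp.sum, Finset.sum_mul]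
  refine (Finset.abs_sum_le_sum_abs _ _).trans (Finset.sum_le_sum fun n _ => ?_)
  rw [abs_mul]
  exact mul_le_mul_of_nonneg_left (h n) (abs_nonneg _)

theorem Nrm.abs_act_le {i : ℕ} {f : ℕ →₀ ℚ} (h : Nrm (some i) f) (x : ℕ →₀ ℝ) :
    |act f x| ≤ (∑ n ∈ x.support, |x n|) / mm i := by
  rw [div_eq_mul_one_div]
  refine abs_act_le_of_abs_apply_le (fun n => ?_) x
  have := (Rat.cast_le (K := ℝ)).2 (h.abs_apply_le n)
  push_cast at this
  exact this

theorem Nrm.abs_act_le_sum {o : Option ℕ} {f : ℕ →₀ ℚ} (h : Nrm o f) (x : ℕ →₀ ℝ) :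
    |act f x| ≤ ∑ n ∈ x.support, |x n| := by
  rw [← mul_one (∑ n ∈ x.support, |x n|)]
  refine abs_act_le_of_abs_apply_le (fun n => ?_) x
  have := h.abs_apply_le_one n
  exact_mod_cast this

/-- `Bd x r` says that the norm of `x` is at most `r`. -/
def Bd (x : ℕ →₀ ℝ) (r : ℝ) : Prop := ∀ o f, Nrm o f → |act f x| ≤ r

theorem Bd.nonneg {x : ℕ →₀ ℝ} {r : ℝ} (h : Bd x r) : 0 ≤ r :=
  (abs_nonneg _).trans (h none _ (.unit 0 0 (by simp)))

theorem Bd.smul {x : ℕ →₀ ℝ} {r : ℝ} (h : Bd x r) (t : ℝ) : Bd (t • x) (|t| * r) := by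
  intro o f hf
  rw [map_smul, smul_eq_mul, abs_mul]
  exact mul_le_mul_of_nonneg_left (h o f hf) (abs_nonneg _)

theorem Bd.abs_apply_le {x : ℕ →₀ ℝ} {r : ℝ} (h : Bd x r) (n : ℕ) : |x n| ≤ r := by
  simpa [act_single] using h none _ (.unit n 1 (by simp))

theorem Nrm.exists_act_gt {x : ℕ →₀ ℝ} {r : ℝ} (h : ¬ Bd x r) : ∃ o f, Nrm o f ∧ r < act f x := by
  unfold Bd at h
  push Not at h
  obtain ⟨o, f, hf, hr⟩ := h
  rcases lt_abs.1 hr with hr | hr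
  · exact ⟨o, f, hf, hr⟩
  · refine ⟨o, (-1 : ℚ) • f, hf.smul (by simp), ?_⟩
    rw [act_smul]
    simpa using hr

/-- Every nonzero vector can be scaled to a norm between `1 / 2` and `1`. -/
theorem exists_smul_bd {x : ℕ →₀ ℝ} (hx : x ≠ 0) :
    ∃ t : ℝ, 0 < t ∧ Bd (t • x) 1 ∧ ∃ o f, Nrm o f ∧ 1 / 2 < act f (t • x) := by
  set S : Set ℝ := {s | ∃ o f, Nrm o f ∧ s = |act f x|} with hS
  have hbdd : BddAbove S := ⟨∑ n ∈ x.support, |x n|, by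
    rintro _ ⟨o, f, hf, rfl⟩
    exact hf.abs_act_le_sum x⟩
  have hbd : Bd x (sSup S) := fun o f hf => le_csSup hbdd ⟨o, f, hf, rfl⟩
  have hpos : 0 < sSup S := by
    obtain ⟨n, hn⟩ := Finsupp.ne_iff.1 hx
    exact (abs_pos.2 hn).trans_le (hbd.abs_apply_le n)
  refine ⟨(sSup S)⁻¹, inv_pos.2 hpos, ?_, Nrm.exists_act_gt fun h => ?_⟩
  · have := hbd.smul (sSup S)⁻¹
    rwa [abs_of_pos (inv_pos.2 hpos), inv_mul_cancel₀ hpos.ne'] at this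
  · have h1 : sSup S ≤ sSup S / 2 := by
      refine csSup_le ⟨_, none, _, .unit 0 0 (by simp), rfl⟩ ?_
      rintro _ ⟨o, f, hf, rfl⟩
      have h2 := h o f hf
      rw [map_smul, smul_eq_mul, abs_mul, abs_of_pos (inv_pos.2 hpos), inv_mul_le_iff₀ hpos] at h2
      linarith
    linarith

end MixedTsirelson

/-! ### Rapidly increasing sequences -/

namespace MixedTsirelson

/-- The number of the blocks `[r k, r (k + 1))`, `k < N`, that start in the interval `[a, b)`. -/
def starts (N : ℕ) (r : ℕ → ℕ) (a b : ℕ) : ℕ :=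
  ((Finset.range N).filter fun k => a ≤ r k ∧ r k < b).card

theorem starts_le (N : ℕ) (r : ℕ → ℕ) (a b : ℕ) : starts N r a b ≤ N :=
  (Finset.card_filter_le _ _).trans (Finset.card_range N).le

theorem starts_mono (N : ℕ) (r : ℕ → ℕ) {a b c d : ℕ} (h : ∀ n, c ≤ n → n < d → a ≤ n ∧ n < b) :
    starts N r c d ≤ starts N r a b :=
  Finset.card_le_card fun k => by
    simp only [Finset.mem_filter]
    exact fun hk => ⟨hk.1, h _ hk.2.1 hk.2.2⟩

theorem sum_starts (N : ℕ) (r : ℕ → ℕ) {c : ℕ → ℕ} (hc : Monotone c) (d : ℕ) :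
    ∑ l ∈ Finset.range d, starts N r (c l) (c (l + 1)) = starts N r (c 0) (c d) := by
  induction d with
  | zero => simp [starts, show ∀ k, ¬ (c 0 ≤ r k ∧ r k < c 0) from fun k => by omega]
  | succ d ih =>
    rw [Finset.sum_range_succ, ih, starts, starts, starts, ← Finset.card_union_of_disjoint]
    · congr 1
      ext k
      have h1 := hc (Nat.zero_le d)
      have h2 := hc (Nat.le_succ d)
      simp only [Finset.mem_union, Finset.mem_filter, Finset.mem_range, Nat.succ_eq_add_one] at *
      omega
    · rw [Finset.disjoint_left]
      intro k
      simp only [Finset.mem_filter]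
      omega

/-- The vectors `x k`, `k < N`, are supported in the successive intervals `[r k, r (k + 1))`. -/
structure IsBlock (N : ℕ) (r : ℕ → ℕ) (x : ℕ → ℕ →₀ ℝ) : Prop where
  mono : Monotone r
  supp : ∀ k < N, ∀ n, x k n ≠ 0 → r k ≤ n ∧ n < r (k + 1)

theorem IsBlock.act_cut_eq_zero {N : ℕ} {r : ℕ → ℕ} {x : ℕ → ℕ →₀ ℝ} (h : IsBlock N r x)
    {k : ℕ} (hk : k < N) {a b : ℕ} (hab : b ≤ r k ∨ r (k + 1) ≤ a) (f : ℕ →₀ ℚ) :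
    act (cut a b f) (x k) = 0 := by
  refine act_eq_zero fun n hn => ?_
  have := h.supp k hk n hn
  rw [cut_apply, if_neg (by omega)]

/-- If `f`, restricted to `[a, b)`, is at most `B` on every block but one, on which it is at most
`C`, then only the blocks that start in `[a, b)`, and at most one more, contribute to its value on
the sum of the blocks. -/
theorem IsBlock.abs_act_sum_le {N : ℕ} {r : ℕ → ℕ} {x : ℕ → ℕ →₀ ℝ} (h : IsBlock N r x)
    {f : ℕ →₀ ℚ} {a b : ℕ} {B C : ℝ} (hB : 0 ≤ B) (hC : 0 ≤ C) (k₀ : ℕ)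
    (hk : ∀ k < N, k ≠ k₀ → |act (cut a b f) (x k)| ≤ B)
    (hk₀ : k₀ < N → |act (cut a b f) (x k₀)| ≤ C) :
    |act (cut a b f) (∑ k ∈ Finset.range N, x k)| ≤ C + B * (starts N r a b + 1) := by
  classical
  set S := (Finset.range N).filter fun k => a ≤ r k ∧ r k < b with hS
  set T := (Finset.range N).filter fun k => r k < a ∧ a < r (k + 1) with hT
  have hTcard : T.card ≤ 1 := by
    rw [Finset.card_le_one]
    intro k hk k' hk'
    simp only [hT, Finset.mem_filter] at hk hk'
    by_contra hne
    rcases lt_or_gt_of_ne hne with hlt | hlt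
    · have := h.mono (Nat.succ_le_of_lt hlt)
      simp only [Nat.succ_eq_add_one] at this
      omega
    · have := h.mono (Nat.succ_le_of_lt hlt)
      simp only [Nat.succ_eq_add_one] at this
      omega
  have hle : ∀ k ∈ Finset.range N, |act (cut a b f) (x k)| ≤
      (if k = k₀ then C else 0) + ((if k ∈ S then B else 0) + if k ∈ T then B else 0) := by
    intro k hkN
    have hkN' := Finset.mem_range.1 hkN
    have h1 : (0 : ℝ) ≤ if k = k₀ then C else 0 := by split_ifs <;> simp [hC]
    have h2 : (0 : ℝ) ≤ if k ∈ S then B else 0 := by split_ifs <;> simp [hB]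
    have h3 : (0 : ℝ) ≤ if k ∈ T then B else 0 := by split_ifs <;> simp [hB]
    by_cases hkk : k = k₀
    · subst hkk
      rw [if_pos rfl]
      linarith [hk₀ hkN']
    · by_cases hkS : k ∈ S
      · rw [if_pos hkS]
        linarith [hk k hkN' hkk]
      · by_cases hkT : k ∈ T
        · rw [if_pos hkT]
          linarith [hk k hkN' hkk]
        · rw [h.act_cut_eq_zero hkN' (by
            simp only [hS, hT, Finset.mem_filter, hkN, true_and] at hkS hkT
            omega)]
          simp only [abs_zero]
          linarith
  rw [map_sum]
  calc _ ≤ ∑ k ∈ Finset.range N, |act (cut a b f) (x k)| := Finset.abs_sum_le_sum_abs _ _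
    _ ≤ _ := Finset.sum_le_sum hle
    _ ≤ C + (B * S.card + B * T.card) := by
      rw [Finset.sum_add_distrib, Finset.sum_add_distrib, Finset.sum_ite_eq', Finset.sum_ite_mem,
        Finset.sum_ite_mem, Finset.sum_const, Finset.sum_const,
        Finset.inter_eq_right.2 (Finset.filter_subset _ _),
        Finset.inter_eq_right.2 (Finset.filter_subset _ _), nsmul_eq_mul, nsmul_eq_mul]
      refine add_le_add ?_ (by rw [mul_comm, mul_comm _ B])
      split_ifs <;> simp [hC]
    _ ≤ _ := by
      have : (T.card : ℝ) ≤ 1 := by exact_mod_cast hTcard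
      have := mul_le_mul_of_nonneg_left this hB
      rw [starts, ← hS]
      linarith

/-- A rapidly increasing sequence of `N` blocks: all norms are at most `C`, a functional of index
below `a k` is bounded on `x k` by `C` over its weight, and one of index above `b k` is bounded
by `C * ε`. -/
structure IsRIS (C ε : ℝ) (N : ℕ) (r : ℕ → ℕ) (x : ℕ → ℕ →₀ ℝ) (a b : ℕ → ℕ) : Prop
    extends IsBlock N r x where
  bd : ∀ k < N, Bd (x k) C
  low : ∀ k < N, ∀ i < a k, ∀ f, Nrm (some i) f → |act f (x k)| ≤ C / mm i
  high : ∀ k < N, ∀ i, b k < i → ∀ f, Nrm (some i) f → |act f (x k)| ≤ C * ε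
  lt : ∀ k k', k < k' → k' < N → b k < a k'

theorem IsRIS.nonneg {C ε : ℝ} {N : ℕ} {r : ℕ → ℕ} {x : ℕ → ℕ →₀ ℝ} {a b : ℕ → ℕ}
    (h : IsRIS C ε N r x a b) (hN : 0 < N) : 0 ≤ C :=
  (abs_nonneg _).trans (h.bd 0 hN none _ (.unit 0 0 (by simp)))

/-- A functional of index above `j` is small on all blocks of a rapidly increasing sequence but
at most one: its index lies in at most one of the disjoint intervals `[a k, b k]`. -/
theorem IsRIS.abs_act_le_of_gt {C ε : ℝ} {N : ℕ} {r : ℕ → ℕ} {x : ℕ → ℕ →₀ ℝ} {a b : ℕ → ℕ}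
    (h : IsRIS C ε N r x a b) (hC : 0 ≤ C) (hε : 0 ≤ ε) {i j : ℕ} (hij : j < i) {f : ℕ →₀ ℚ}
    (hf : Nrm (some i) f) (s t : ℕ) :
    |act (cut s t f) (∑ k ∈ Finset.range N, x k)| ≤
      C + C * (1 / mm (j + 1) + ε) * (starts N r s t + 1) := by
  have hm := mm_pos (j + 1)
  have key : ∀ k < N, (i < a k ∨ b k < i) →
      |act (cut s t f) (x k)| ≤ C * (1 / mm (j + 1) + ε) := by
    rintro k hk (hi | hi)
    · refine (h.low k hk i hi _ (hf.cut s t)).trans ?_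
      rw [div_eq_mul_one_div]
      refine mul_le_mul_of_nonneg_left ?_ hC
      have : (1 : ℝ) / mm i ≤ 1 / mm (j + 1) := one_div_le_one_div_of_le hm (mm_mono' hij)
      linarith
    · refine (h.high k hk i hi _ (hf.cut s t)).trans ?_
      refine mul_le_mul_of_nonneg_left ?_ hC
      have : (0 : ℝ) ≤ 1 / mm (j + 1) := by positivity
      linarith
  have hB : 0 ≤ C * (1 / mm (j + 1) + ε) := by positivity
  by_cases hex : ∃ k₀ < N, a k₀ ≤ i ∧ i ≤ b k₀
  · obtain ⟨k₀, hk₀, h1, h2⟩ := hex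
    refine h.abs_act_sum_le hB hC k₀ (fun k hk hne => key k hk ?_)
      fun _ => h.bd k₀ hk₀ _ _ (hf.cut s t)
    rcases lt_or_gt_of_ne hne with hlt | hlt
    · exact Or.inr ((h.lt k k₀ hlt hk₀).trans_le h1)
    · exact Or.inl (h2.trans_lt (h.lt k₀ k hlt hk))
  · push Not at hex
    refine h.abs_act_sum_le hB hC N (fun k hk _ => key k hk ?_) fun h => absurd h (lt_irrefl _)
    by_contra hcon
    push Not at hcon
    exact absurd hcon.2 (not_le.2 (hex k hk hcon.1))

/-- Averaging an estimate over the terms of a functional of index `i` gains a factor `1 / mᵢ`. -/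
theorem abs_act_le_of_terms {i N Q : ℕ} {r : ℕ → ℕ} {y : ℕ →₀ ℝ} {A θ : ℝ} (hA : 0 ≤ A)
    (hθ : 0 ≤ θ) (hQ : nn i ≤ Q)
    (h : ∀ o f, Nrm o f → ∀ s t, |act (cut s t f) y| ≤ A + θ * starts N r s t)
    {f : ℕ →₀ ℚ} (hf : Nrm (some i) f) (s t : ℕ) :
    |act (cut s t f) y| ≤ (Q * A + θ * starts N r s t) / mm i := by
  obtain ⟨d, g, o, c, hd, hc, hst, hg, hfeq⟩ := hf.exists_eq_sum s t
  have hm := mm_pos i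
  rw [hfeq, act_smul, act_sum, abs_mul]
  push_cast
  rw [abs_of_nonneg (by positivity), one_div, inv_mul_eq_div]
  refine div_le_div_of_nonneg_right ?_ hm.le
  calc |∑ l ∈ Finset.range d, act (cut (c l) (c (l + 1)) (g l)) y|
      ≤ ∑ l ∈ Finset.range d, |act (cut (c l) (c (l + 1)) (g l)) y| :=
        Finset.abs_sum_le_sum_abs _ _
    _ ≤ ∑ l ∈ Finset.range d, (A + θ * starts N r (c l) (c (l + 1))) :=
        Finset.sum_le_sum fun l hl => h _ _ (hg l (Finset.mem_range.1 hl)) _ _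
    _ = d * A + θ * (starts N r (c 0) (c d) : ℕ) := by
        rw [Finset.sum_add_distrib, Finset.sum_const, Finset.card_range, nsmul_eq_mul,
          ← Finset.mul_sum, ← sum_starts N r hc d]
        push_cast
        rfl
    _ ≤ _ := by
        have h1 : (starts N r (c 0) (c d) : ℝ) ≤ starts N r s t := by
          exact_mod_cast starts_mono N r hst
        have h2 : (d : ℝ) ≤ Q := by exact_mod_cast hd.trans hQ
        exact add_le_add (mul_le_mul_of_nonneg_right h2 hA) (mul_le_mul_of_nonneg_left h1 hθ)

/-- The upper estimate for sums of rapidly increasing sequences, from a bound `H` for the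
functionals of one index `j`. The functionals of smaller index are expanded `p` times: every
expansion multiplies the number of terms by at most `Q`, and halves the contribution of the
blocks. The functionals of larger index are negligible on all blocks but one. -/
theorem IsRIS.abs_act_le {C ε δ c₀ : ℝ} {N : ℕ} {r : ℕ → ℕ} {x : ℕ → ℕ →₀ ℝ} {a b : ℕ → ℕ}
    (h : IsRIS C ε N r x a b) (hC : 0 ≤ C) (hε : 0 ≤ ε) (hε1 : ε ≤ 1) (hδ : 0 ≤ δ) (hc₀ : 0 ≤ c₀)
    {j : ℕ} (hj : ∀ k < N, j < a k)
    (H : ∀ f, Nrm (some j) f → ∀ s t, |act (cut s t f) (∑ k ∈ Finset.range N, x k)| ≤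
      C * (c₀ + δ * starts N r s t))
    {Q : ℕ} (hQ1 : 1 ≤ Q) (hQ : ∀ i < j, nn i ≤ Q) (p : ℕ) {o : Option ℕ} {f : ℕ →₀ ℚ}
    (hf : Nrm o f) (s t : ℕ) :
    |act (cut s t f) (∑ k ∈ Finset.range N, x k)| ≤
      C * ((3 + c₀) * Q ^ p) +
        C * ((1 / 2) ^ p + δ + ε + 1 / mm (j + 1)) * starts N r s t := by
  have hQ1' : (1 : ℝ) ≤ Q := by exact_mod_cast hQ1
  have hm := mm_pos (j + 1)
  have hm2 := two_le_mm' (j + 1)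
  have hm1 : (1 : ℝ) / mm (j + 1) ≤ 1 := by
    rw [div_le_one hm]
    linarith
  have hm0 : (0 : ℝ) ≤ 1 / mm (j + 1) := by positivity
  induction p generalizing o f s t with
  | zero =>
    have := h.abs_act_sum_le (f := f) (a := s) (b := t) hC le_rfl N
      (fun k hk _ => h.bd k hk _ _ (hf.cut s t)) fun h => absurd h (lt_irrefl _)
    refine this.trans ?_
    have hν : (0 : ℝ) ≤ starts N r s t := Nat.cast_nonneg _
    have e1 : C * 1 ≤ C * ((3 + c₀) * Q ^ 0) := mul_le_mul_of_nonneg_left (by simp; linarith) hC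
    have e2 : C * 1 ≤ C * ((1 / 2) ^ 0 + δ + ε + 1 / mm (j + 1)) :=
      mul_le_mul_of_nonneg_left (by simp only [pow_zero]; linarith) hC
    have := mul_le_mul_of_nonneg_right e2 hν
    linarith
  | succ p ih =>
    have hν : (0 : ℝ) ≤ starts N r s t := Nat.cast_nonneg _
    have hQp : (1 : ℝ) ≤ Q ^ (p + 1) := one_le_pow₀ hQ1'
    have hA : C * (3 + c₀) ≤ C * ((3 + c₀) * Q ^ (p + 1)) :=
      mul_le_mul_of_nonneg_left (le_mul_of_one_le_right (by linarith) hQp) hC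
    have hhalf : (0 : ℝ) ≤ (1 / 2) ^ (p + 1) := by positivity
    have hθ : 0 ≤ C * ((1 / 2) ^ (p + 1) + δ + ε + 1 / mm (j + 1)) * starts N r s t := by positivity
    have hCc : 0 ≤ C * c₀ := mul_nonneg hC hc₀
    match o, hf with
    | none, hf =>
      cases hf with
      | unit n q hq =>
        have hzero : ∀ k < N, ¬ (r k ≤ n ∧ n < r (k + 1)) →
            act (cut s t (Finsupp.single n q)) (x k) = 0 := fun k hk hn => by
          refine act_eq_zero fun n' hn' => ?_
          have := h.supp k hk n' hn'
          have hne : n ≠ n' := by rintro rfl; exact hn this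
          rw [cut_apply, Finsupp.single_apply, if_neg hne, ite_self]
        have : |act (cut s t (Finsupp.single n q)) (∑ k ∈ Finset.range N, x k)| ≤
            C + 0 * (starts N r s t + 1) := by
          by_cases hex : ∃ k₀, r k₀ ≤ n ∧ n < r (k₀ + 1)
          · obtain ⟨k₀, hk₀⟩ := hex
            refine h.abs_act_sum_le le_rfl hC k₀ (fun k hk hne => ?_)
              fun hk₀ => h.bd k₀ hk₀ _ _ ((Nrm.unit n q hq).cut s t)
            rw [hzero k hk, abs_zero]
            rintro ⟨h1, h2⟩
            rcases lt_or_gt_of_ne hne with hlt | hlt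
            · have := h.mono (Nat.succ_le_of_lt hlt)
              simp only [Nat.succ_eq_add_one] at this
              omega
            · have := h.mono (Nat.succ_le_of_lt hlt)
              simp only [Nat.succ_eq_add_one] at this
              omega
          · push Not at hex
            refine h.abs_act_sum_le le_rfl hC N (fun k hk _ => ?_) fun h => absurd h (lt_irrefl _)
            rw [hzero k hk fun hn => absurd hn.2 (not_lt.2 (hex k hn.1)), abs_zero]
        linarith
    | some i, hf =>
      rcases lt_trichotomy i j with hij | rfl | hij
      · have := abs_act_le_of_terms (by positivity) (by positivity) (hQ i hij)
          (fun o f hf s t => ih hf s t) hf s t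
        refine this.trans ?_
        rw [div_le_iff₀ (mm_pos i)]
        have hmi := two_le_mm' i
        set P := C * ((3 + c₀) * (Q : ℝ) ^ (p + 1)) +
          C * ((1 / 2) ^ (p + 1) + δ + ε + 1 / mm (j + 1)) * starts N r s t with hP
        have hP0 : 0 ≤ P := by positivity
        have h2P := mul_le_mul_of_nonneg_left hmi hP0
        refine le_trans ?_ h2P
        have e0 : 0 ≤ C * ((3 + c₀) * (Q : ℝ) ^ (p + 1)) := by positivity
        have e1 : (0 : ℝ) ≤ C * (δ + ε + 1 / mm (j + 1)) * starts N r s t := by positivity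
        have : P * 2 - (Q * (C * ((3 + c₀) * (Q : ℝ) ^ p)) +
            C * ((1 / 2) ^ p + δ + ε + 1 / mm (j + 1)) * starts N r s t) =
            C * ((3 + c₀) * (Q : ℝ) ^ (p + 1)) +
              C * (δ + ε + 1 / mm (j + 1)) * starts N r s t := by
          rw [hP]
          ring
        linarith
      · refine (H f hf s t).trans ?_
        have : C * δ * starts N r s t ≤
            C * ((1 / 2) ^ (p + 1) + δ + ε + 1 / mm (i + 1)) * starts N r s t :=
          mul_le_mul_of_nonneg_right (mul_le_mul_of_nonneg_left (by linarith) hC) hν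
        linarith
      · refine (h.abs_act_le_of_gt hC hε hij hf s t).trans ?_
        have e1 : C * (1 / mm (j + 1) + ε) * starts N r s t ≤
            C * ((1 / 2) ^ (p + 1) + δ + ε + 1 / mm (j + 1)) * starts N r s t :=
          mul_le_mul_of_nonneg_right (mul_le_mul_of_nonneg_left (by linarith) hC) hν
        have e2 : C * (1 / mm (j + 1) + ε) ≤ C * 2 := mul_le_mul_of_nonneg_left (by linarith) hC
        linarith

theorem half_pow_sq_mm_le (j : ℕ) : (1 / 2 : ℝ) ^ (mm j ^ 2) ≤ 1 / (mm j : ℝ) ^ 2 := by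
  rw [one_div_pow]
  refine one_div_le_one_div_of_le (by have := mm_pos j; positivity) ?_
  exact_mod_cast (Nat.lt_two_pow_self (n := mm j ^ 2)).le

theorem one_div_mm_succ_le (j : ℕ) : (1 : ℝ) / mm (j + 1) ≤ 1 / (mm j : ℝ) ^ 2 := by
  refine one_div_le_one_div_of_le (by have := mm_pos j; positivity) ?_
  exact_mod_cast sq_mm_le_mm (Nat.lt_succ_self j)

theorem nn_cast_eq (j : ℕ) : (nn j : ℝ) = 10 * (mm j : ℝ) ^ (mm j ^ 2 + 1) * (mm j : ℝ) ^ 2 := by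
  exact_mod_cast nn_eq j

theorem one_le_nn (j : ℕ) : 1 ≤ nn j := by
  have h1 := two_le_mm j
  have h2 := mm_le_nn j
  omega

/-! ### Exact vectors -/

/-- A vector of norm at most `C` on which only functionals of index `w` can be large. -/
structure IsExact (C : ℝ) (w : ℕ) (x : ℕ →₀ ℝ) : Prop where
  bd : Bd x C
  low : ∀ i < w, ∀ f, Nrm (some i) f → |act f x| ≤ C / mm i
  high : ∀ i, w < i → ∀ f, Nrm (some i) f → |act f x| ≤ C / mm w

theorem IsExact.smul {C : ℝ} {w : ℕ} {x : ℕ →₀ ℝ} (h : IsExact C w x) {t : ℝ} (ht : |t| ≤ 1) :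
    IsExact C w (t • x) := by
  have key : ∀ f B, |act f x| ≤ B → |act f (t • x)| ≤ B := fun f B hB => by
    rw [map_smul, smul_eq_mul, abs_mul]
    exact (mul_le_of_le_one_left (abs_nonneg _) ht).trans hB
  exact ⟨fun o f hf => key f _ (h.bd o f hf), fun i hi f hf => key f _ (h.low i hi f hf),
    fun i hi f hf => key f _ (h.high i hi f hf)⟩

/-- The normalized average of a rapidly increasing sequence of length `n_w` is exact. -/
theorem IsRIS.isExact {C ε : ℝ} {w : ℕ} {r : ℕ → ℕ} {x : ℕ → ℕ →₀ ℝ} {a b : ℕ → ℕ}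
    (h : IsRIS C ε (nn w) r x a b) (hε : 0 ≤ ε) (hε' : ε ≤ 1 / (mm w : ℝ) ^ 2)
    (hw : ∀ k < nn w, w < a k) :
    IsExact (5 * C) w (((mm w : ℝ) / nn w) • ∑ k ∈ Finset.range (nn w), x k) := by
  have hC : 0 ≤ C := h.nonneg (one_le_nn w)
  have hm2 := two_le_mm' w
  have hm := mm_pos w
  have hn1 : (1 : ℝ) ≤ nn w := by exact_mod_cast one_le_nn w
  have hn : (0 : ℝ) < nn w := by linarith
  have hnm : (mm w : ℝ) ^ 2 ≤ nn w := by exact_mod_cast sq_mm_le_nn w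
  set m : ℝ := (mm w : ℝ) with hmdef
  set n : ℝ := (nn w : ℝ) with hndef
  have hsq : 1 / m ^ 2 ≤ 1 / m :=
    one_div_le_one_div_of_le hm (by nlinarith)
  have hm1 : 1 / m ≤ 1 := by
    rw [div_le_one hm]
    linarith
  have hm0 : 0 ≤ 1 / m := by positivity
  have hsucc := one_div_mm_succ_le w
  have hpow := half_pow_sq_mm_le w
  rw [← hmdef] at hsucc hpow
  have hneq := nn_cast_eq w
  rw [← hmdef, ← hndef] at hneq
  have H : ∀ f, Nrm (some w) f → ∀ s t, |act (cut s t f) (∑ k ∈ Finset.range (nn w), x k)| ≤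
      C * (1 + 1 / m * starts (nn w) r s t) := by
    intro f hf s t
    have := h.abs_act_sum_le (f := f) (a := s) (b := t) (B := C / m) (by positivity) le_rfl (nn w)
      (fun k hk _ => h.low k hk w (hw k hk) _ (hf.cut s t)) fun h => absurd h (lt_irrefl _)
    refine this.trans ?_
    have := mul_le_mul_of_nonneg_left hm1 hC
    rw [div_eq_mul_one_div]
    linarith
  have main : ∀ o f, Nrm o f → ∀ s t, |act (cut s t f) (∑ k ∈ Finset.range (nn w), x k)| ≤
      C * (4 * m ^ (mm w ^ 2)) + C * (4 / m) * starts (nn w) r s t := by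
    intro o f hf s t
    have := h.abs_act_le hC hε (by linarith) hm0 zero_le_one hw H (Q := mm w)
      (by have := two_le_mm w; omega) (fun i hi => nn_le_mm hi) (mm w ^ 2) hf s t
    refine this.trans ?_
    have hν : (0 : ℝ) ≤ starts (nn w) r s t := Nat.cast_nonneg _
    have e : (1 / 2 : ℝ) ^ (mm w ^ 2) + 1 / m + ε + 1 / mm (w + 1) ≤ 4 / m := by
      have : 4 / m = 4 * (1 / m) := by ring
      linarith
    have := mul_le_mul_of_nonneg_right (mul_le_mul_of_nonneg_left e hC) hν
    have e3 : C * ((3 + 1) * m ^ (mm w ^ 2)) = C * (4 * m ^ (mm w ^ 2)) := by ring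
    linarith
  have hstarts : ∀ s t, (starts (nn w) r s t : ℝ) ≤ n := fun s t =>
    Nat.cast_le.2 (starts_le (nn w) r s t)
  -- the number of terms coming from the expansion is negligible against the length `n`
  have hbig : m * (C * (4 * m ^ (mm w ^ 2))) ≤ C * (n / m) := by
    have e1 : n / m = 10 * m ^ (mm w ^ 2 + 1) * m := by
      rw [hneq]
      field_simp
    rw [e1, pow_succ m (mm w ^ 2)]
    have e2 : 0 ≤ m ^ (mm w ^ 2) := by positivity
    have e3 : C * (m ^ (mm w ^ 2) * m * 4) ≤ C * (10 * (m ^ (mm w ^ 2) * m) * m) := by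
      refine mul_le_mul_of_nonneg_left ?_ hC
      have : 0 ≤ m ^ (mm w ^ 2) * m := by positivity
      nlinarith
    linarith
  have hact : ∀ f B, |act f (∑ k ∈ Finset.range (nn w), x k)| ≤ n / m * B →
      |act f ((m / n) • ∑ k ∈ Finset.range (nn w), x k)| ≤ B := fun f B hB => by
    rw [map_smul, smul_eq_mul, abs_mul, abs_of_nonneg (by positivity)]
    calc m / n * _ ≤ m / n * (n / m * B) := mul_le_mul_of_nonneg_left hB (by positivity)
      _ = B := by field_simp
  have h4 : C * (4 / m) * n = n / m * (4 * C) := by ring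
  refine ⟨fun o f hf => hact f _ ?_, fun i hi f hf => hact f _ ?_, fun i hi f hf => hact f _ ?_⟩
  · obtain ⟨t, ht⟩ := exists_cut_eq_self f
    rw [← ht 0]
    refine (main o f hf _ _).trans ?_
    have e1 : C * (4 / m) * starts (nn w) r 0 (t + 0) ≤ C * (4 / m) * n :=
      mul_le_mul_of_nonneg_left (hstarts _ _) (by positivity)
    have e2 : C * (4 * m ^ (mm w ^ 2)) ≤ m * (C * (4 * m ^ (mm w ^ 2))) :=
      le_mul_of_one_le_left (by positivity) (by linarith)
    linarith
  · obtain ⟨t, ht⟩ := exists_cut_eq_self f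
    rw [← ht 0]
    refine (abs_act_le_of_terms (by positivity) (by positivity) (nn_le_mm hi) main hf _ _).trans ?_
    have e0 : n / m * (5 * C / mm i) = n / m * (5 * C) / mm i := by ring
    rw [e0]
    refine div_le_div_of_nonneg_right ?_ (mm_pos i).le
    have e1 : C * (4 / m) * starts (nn w) r 0 (t + 0) ≤ C * (4 / m) * n :=
      mul_le_mul_of_nonneg_left (hstarts _ _) (by positivity)
    linarith
  · obtain ⟨t, ht⟩ := exists_cut_eq_self f
    rw [← ht 0]
    refine (h.abs_act_le_of_gt hC hε hi hf _ _).trans ?_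
    have e1 : C * (1 / mm (w + 1) + ε) * (starts (nn w) r 0 (t + 0) + 1) ≤
        C * (2 * (1 / m ^ 2)) * (n + 1) := by
      refine mul_le_mul (mul_le_mul_of_nonneg_left (by linarith) hC)
        (by linarith [hstarts 0 (t + 0)]) (by positivity) (by positivity)
    have e2 : C ≤ C * (n / m ^ 2) :=
      le_mul_of_one_le_right hC ((one_le_div (by positivity)).2 hnm)
    have e3 : C * (2 * (1 / m ^ 2)) * (n + 1) ≤ C * (4 * (n / m ^ 2)) := by
      have : C * (4 * (n / m ^ 2)) - C * (2 * (1 / m ^ 2)) * (n + 1) =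
        C * (2 * (1 / m ^ 2)) * (n - 1) := by ring
      have : 0 ≤ C * (2 * (1 / m ^ 2)) * (n - 1) :=
        mul_nonneg (by positivity) (by linarith)
      linarith
    have e4 : n / m * (5 * C / m) = 5 * (C * (n / m ^ 2)) := by ring
    rw [e4]
    linarith

/-! ### Averages of blocks -/

/-- A space of finitely supported vectors that contains nonzero vectors supported arbitrarily
far out. -/
def HasTails (V : Submodule ℝ (ℕ →₀ ℝ)) : Prop :=
  ∀ M, ∃ x ∈ V, x ≠ 0 ∧ ∀ n, x n ≠ 0 → M ≤ n

/-- `SuppIn M M' x` says that `x` is supported in the interval `[M, M')`. -/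
def SuppIn (M M' : ℕ) (x : ℕ →₀ ℝ) : Prop := ∀ n, x n ≠ 0 → M ≤ n ∧ n < M'

theorem SuppIn.smul {M M' : ℕ} {x : ℕ →₀ ℝ} (h : SuppIn M M' x) (t : ℝ) : SuppIn M M' (t • x) :=
  fun n hn => h n fun h0 => hn (by simp [h0])

theorem SuppIn.sum {ι : Type*} {M M' : ℕ} {s : Finset ι} {x : ι → ℕ →₀ ℝ}
    (h : ∀ k ∈ s, SuppIn M M' (x k)) : SuppIn M M' (∑ k ∈ s, x k) := fun n hn => by
  rw [Finsupp.finsetSum_apply] at hn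
  obtain ⟨k, hk, hkn⟩ := Finset.exists_ne_zero_of_sum_ne_zero hn
  exact h k hk n hkn

theorem SuppIn.mono {M M' L L' : ℕ} {x : ℕ →₀ ℝ} (h : SuppIn M M' x) (h1 : L ≤ M) (h2 : M' ≤ L') :
    SuppIn L L' x := fun n hn => ⟨h1.trans (h n hn).1, (h n hn).2.trans_le h2⟩

theorem exists_suppIn {M : ℕ} {x : ℕ →₀ ℝ} (h : ∀ n, x n ≠ 0 → M ≤ n) :
    ∃ M', M ≤ M' ∧ SuppIn M M' x := by
  refine ⟨max M (x.support.sup id + 1), le_max_left _ _, fun n hn => ⟨h n hn, ?_⟩⟩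
  have := Finset.le_sup (f := id) (Finsupp.mem_support_iff.2 hn)
  simp only [id] at this
  omega

theorem act_cut_of_suppIn {M M' : ℕ} {x : ℕ →₀ ℝ} (h : SuppIn M M' x) (f : ℕ →₀ ℚ) :
    act (cut M M' f) x = act f x :=
  act_congr fun n hn => by rw [cut_apply, if_pos (h n hn)]

/-- Functionals restricted to the intervals of a block sequence act diagonally. -/
theorem IsBlock.act_sum_cut {N : ℕ} {r : ℕ → ℕ} {x : ℕ → ℕ →₀ ℝ} (h : IsBlock N r x)
    (f : ℕ → ℕ →₀ ℚ) :
    act (∑ l ∈ Finset.range N, cut (r l) (r (l + 1)) (f l)) (∑ k ∈ Finset.range N, x k) =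
      ∑ k ∈ Finset.range N, act (f k) (x k) := by
  rw [act_sum]
  refine Finset.sum_congr rfl fun l hl => ?_
  have hl' := Finset.mem_range.1 hl
  rw [map_sum, Finset.sum_eq_single l]
  · exact act_cut_of_suppIn (h.supp l hl') _
  · intro k hk hkl
    refine h.act_cut_eq_zero (Finset.mem_range.1 hk) ?_ _
    rcases lt_or_gt_of_ne hkl with hlt | hlt
    · exact Or.inr (h.mono hlt)
    · exact Or.inl (h.mono hlt)
  · exact fun h => absurd hl h

/-- A step-by-step construction: if every state admits a successor with the property `P`, there is
an infinite chain of successors starting at any given state. -/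
theorem exists_chain {α : Type*} {P : α → α → Prop} (h : ∀ s, ∃ s', P s s') (s₀ : α) :
    ∃ σ : ℕ → α, σ 0 = s₀ ∧ ∀ k, P (σ k) (σ (k + 1)) := by
  choose F hF using h
  exact ⟨fun k => F^[k] s₀, rfl, fun k => by
    simp only [Function.iterate_succ_apply']
    exact hF _⟩

theorem HasTails.exists_block {V : Submodule ℝ (ℕ →₀ ℝ)} (hV : HasTails V) (M : ℕ) :
    ∃ (r : ℕ → ℕ) (u : ℕ → ℕ →₀ ℝ), r 0 = M ∧ Monotone r ∧ ∀ k, SuppIn (r k) (r (k + 1)) (u k) ∧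
      u k ∈ V ∧ Bd (u k) 1 ∧ ∃ o f, Nrm o f ∧ 1 / 2 < act f (u k) := by
  obtain ⟨σ, h0, hσ⟩ := exists_chain (α := ℕ × (ℕ →₀ ℝ))
    (P := fun s s' => s.1 ≤ s'.1 ∧ SuppIn s.1 s'.1 s'.2 ∧ s'.2 ∈ V ∧ Bd s'.2 1 ∧
      ∃ o f, Nrm o f ∧ 1 / 2 < act f s'.2) (fun s => by
    obtain ⟨x, hxV, hx0, hx⟩ := hV s.1
    obtain ⟨M', hM', hs⟩ := exists_suppIn hx
    obtain ⟨t, ht, hbd, hf⟩ := exists_smul_bd hx0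
    exact ⟨(M', t • x), hM', hs.smul t, V.smul_mem t hxV, hbd, hf⟩) (M, 0)
  exact ⟨fun k => (σ k).1, fun k => (σ (k + 1)).2, by simp [h0],
    monotone_nat_of_le_succ fun k => (hσ k).1, fun k => (hσ k).2⟩

theorem sum_range_mul (n d i : ℕ) (u : ℕ → ℕ →₀ ℝ) :
    ∑ q ∈ Finset.range n, ∑ t ∈ Finset.range d, u (i + q * d + t) =
      ∑ t ∈ Finset.range (n * d), u (i + t) := by
  induction n with
  | zero => simp
  | succ n ih =>
    rw [Finset.sum_range_succ, ih, Nat.succ_mul, Finset.sum_range_add]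
    simp only [add_assoc]

/-- James' argument: if all averages of `n` blocks of norm at most two had norm at most one, then
iterated averages of `n ^ s` blocks would have norm at most `2⁻ˢ`, against the lower estimate
by functionals of an even index. -/
theorem HasTails.exists_average {V : Submodule ℝ (ℕ →₀ ℝ)} (hV : HasTails V) {n : ℕ} (hn : 1 ≤ n)
    (M : ℕ) : ∃ (r : ℕ → ℕ) (y : ℕ → ℕ →₀ ℝ), M ≤ r 0 ∧ IsBlock n r y ∧ (∀ k < n, y k ∈ V) ∧
      (∀ k < n, Bd (y k) 2) ∧ ∃ o f, Nrm o f ∧ n < act f (∑ k ∈ Finset.range n, y k) := by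
  by_contra hcon
  have hn0 : (0 : ℝ) < n := by exact_mod_cast hn
  have key : ∀ (r : ℕ → ℕ) (y : ℕ → ℕ →₀ ℝ) (ρ : ℝ), 0 < ρ → M ≤ r 0 → IsBlock n r y →
      (∀ k < n, y k ∈ V) → (∀ k < n, Bd (y k) ρ) →
      Bd (∑ k ∈ Finset.range n, y k) (n / 2 * ρ) := by
    intro r y ρ hρ hM hb hyV hbd
    by_contra hnb
    refine hcon ⟨r, fun k => (2 / ρ) • y k, hM, ⟨hb.mono, fun k hk => SuppIn.smul (hb.supp k hk) _⟩,
      fun k hk => V.smul_mem _ (hyV k hk), fun k hk => ?_, ?_⟩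
    · have := (hbd k hk).smul (2 / ρ)
      rwa [abs_of_pos (by positivity), div_mul_cancel₀ _ hρ.ne'] at this
    · obtain ⟨o, f, hf, hlt⟩ := Nrm.exists_act_gt hnb
      refine ⟨o, f, hf, ?_⟩
      rw [← Finset.smul_sum, map_smul, smul_eq_mul]
      calc (n : ℝ) = 2 / ρ * (n / 2 * ρ) := by field_simp
        _ < _ := mul_lt_mul_of_pos_left hlt (by positivity)
  obtain ⟨r, u, hr0, hr, hu⟩ := hV.exists_block M
  have hpow : ∀ s i, Bd (∑ t ∈ Finset.range (n ^ s), u (i + t)) ((n / 2 : ℝ) ^ s) := by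
    intro s
    induction s with
    | zero =>
      intro i
      simpa using (hu i).2.2.1
    | succ s ih =>
      intro i
      have := key (fun q => r (i + q * n ^ s))
        (fun q => ∑ t ∈ Finset.range (n ^ s), u (i + q * n ^ s + t)) ((n / 2 : ℝ) ^ s)
        (by positivity) (by rw [← hr0]; exact hr (Nat.zero_le _))
        ⟨fun q q' h => hr (Nat.add_le_add_left (Nat.mul_le_mul_right _ h) _), fun q _ => ?_⟩
        (fun q _ => V.sum_mem fun t _ => (hu _).2.1) fun q _ => ih _
      · rwa [sum_range_mul, mul_comm n, ← pow_succ, mul_comm (n / 2 : ℝ), ← pow_succ] at this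
      · refine SuppIn.sum fun t ht => (hu _).1.mono (hr (Nat.le_add_right _ _)) (hr ?_)
        have := Finset.mem_range.1 ht
        rw [Nat.succ_mul]
        omega
  set m := mm (2 * n) with hm
  have hnm : n ≤ m := by
    have := lt_mm (2 * n)
    omega
  have hm2 : 2 ≤ m := two_le_mm _
  have hlen : n ^ (2 * m) ≤ nn (2 * n) :=
    calc n ^ (2 * m) ≤ m ^ (2 * m) := Nat.pow_le_pow_left hnm _
      _ ≤ m ^ (m ^ 2 + 3) := Nat.pow_le_pow_right (by omega) (by nlinarith)
      _ ≤ nn (2 * n) := by rw [nn, growth, ← hm]; omega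
  choose o f hf hfu using fun k => (hu k).2.2.2
  have hF := Nrm.free n (n ^ (2 * m)) hlen f o r hr fun l _ => hf l
  have h1 := hpow (2 * m) 0 _ _ hF
  have hblock : IsBlock (n ^ (2 * m)) r u := ⟨hr, fun k _ => (hu k).1⟩
  simp only [zero_add] at h1
  rw [act_smul, hblock.act_sum_cut] at h1
  have h2 : ((n ^ (2 * m) : ℕ) : ℝ) * (1 / 2) ≤
      ∑ k ∈ Finset.range (n ^ (2 * m)), act (f k) (u k) := by
    rw [← nsmul_eq_mul, ← Finset.card_range (n ^ (2 * m)), ← Finset.sum_const]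
    simp only [Finset.card_range]
    exact Finset.sum_le_sum fun k _ => (hfu k).le
  have hmpos : (0 : ℝ) < m := by positivity
  have h3 := (le_abs_self _).trans h1
  push_cast at h3 h2
  rw [← hm, one_div, inv_mul_le_iff₀ hmpos, div_pow, mul_div_assoc'] at h3
  have h4 := h2.trans h3
  rw [le_div_iff₀ (by positivity)] at h4
  have h5 : (2 * m : ℝ) < 2 ^ (2 * m) := by exact_mod_cast Nat.lt_two_pow_self (n := 2 * m)
  have h6 : (0 : ℝ) < (n : ℝ) ^ (2 * m) := by positivity
  nlinarith

theorem HasTails.exists_average_vector {V : Submodule ℝ (ℕ →₀ ℝ)} (hV : HasTails V) (w M : ℕ)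
    {ε : ℝ} (hε : 0 < ε) : ∃ (u : ℕ →₀ ℝ) (M' b : ℕ), w + 1 ≤ b ∧ M ≤ M' ∧ SuppIn M M' u ∧ u ∈ V ∧
      Bd u 4 ∧ (∀ i < w + 1, ∀ f, Nrm (some i) f → |act f u| ≤ 4 / mm i) ∧
      (∀ i, b < i → ∀ f, Nrm (some i) f → |act f u| ≤ 4 * ε) ∧ ∃ o f, Nrm o f ∧ 1 < act f u := by
  obtain ⟨r, y, hM, hb, hyV, hbd, o, f, hf, hlt⟩ := hV.exists_average (one_le_nn w) M
  have hn : (0 : ℝ) < nn w := by exact_mod_cast one_le_nn w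
  have hn1 : (1 : ℝ) ≤ nn w := by exact_mod_cast one_le_nn w
  set S := ∑ k ∈ Finset.range (nn w), y k with hS
  set u : ℕ →₀ ℝ := (1 / nn w : ℝ) • S with hu
  have hact : ∀ g B, |act g S| ≤ nn w * B → |act g u| ≤ B := fun g B hB => by
    rw [hu, map_smul, smul_eq_mul, abs_mul, abs_of_nonneg (by positivity), one_div,
      inv_mul_le_iff₀ hn]
    exact hB
  have base : ∀ o g, Nrm o g → ∀ s t, |act (cut s t g) S| ≤ 2 + 2 * starts (nn w) r s t := by
    intro o g hg s t
    have := hb.abs_act_sum_le (f := g) (a := s) (b := t) zero_le_two le_rfl (nn w)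
      (fun k hk _ => hbd k hk _ _ (hg.cut s t)) fun h => absurd h (lt_irrefl _)
    linarith
  have hst : ∀ s t, (starts (nn w) r s t : ℝ) ≤ nn w := fun s t => Nat.cast_le.2 (starts_le _ _ s t)
  obtain ⟨c, hc⟩ := exists_nat_ge ((∑ n ∈ u.support, |u n|) / (4 * ε))
  refine ⟨u, r (nn w) + M, w + 1 + c, by omega, by omega, ?_, ?_, ?_, ?_, ?_, o, f, hf, ?_⟩
  · refine SuppIn.smul (SuppIn.sum fun k hk => ?_) _
    have hk' := Finset.mem_range.1 hk
    refine SuppIn.mono (hb.supp k hk') (hM.trans (hb.mono (Nat.zero_le _))) ?_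
    exact (hb.mono hk').trans (Nat.le_add_right _ _)
  · exact V.smul_mem _ (V.sum_mem fun k hk => hyV k (Finset.mem_range.1 hk))
  · intro o g hg
    refine hact g _ ?_
    obtain ⟨t, ht⟩ := exists_cut_eq_self g
    rw [← ht 0]
    linarith [base o g hg 0 (t + 0), hst 0 (t + 0)]
  · intro i hi g hg
    refine hact g _ ?_
    obtain ⟨t, ht⟩ := exists_cut_eq_self g
    rw [← ht 0]
    refine (abs_act_le_of_terms zero_le_two zero_le_two (nn_mono (Nat.le_of_lt_succ hi)) base hg
      _ _).trans ?_
    rw [mul_div_assoc']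
    refine div_le_div_of_nonneg_right ?_ (mm_pos i).le
    linarith [hst 0 (t + 0)]
  · intro i hi g hg
    refine (hg.abs_act_le u).trans ?_
    rw [div_le_iff₀ (by positivity)] at hc
    rw [div_le_iff₀ (mm_pos i)]
    have h1 : (c : ℝ) ≤ mm i := by
      have := lt_mm i
      exact_mod_cast (by omega : c ≤ mm i)
    have := mul_le_mul_of_nonneg_right h1 (by positivity : 0 ≤ 4 * ε)
    linarith
  · rw [hu, map_smul, smul_eq_mul, one_div, lt_inv_mul_iff₀ hn, mul_one]
    exact hlt

theorem HasTails.exists_isRIS {V : Submodule ℝ (ℕ →₀ ℝ)} (hV : HasTails V) (w M N : ℕ)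
    {ε : ℝ} (hε : 0 < ε) : ∃ (r : ℕ → ℕ) (u : ℕ → ℕ →₀ ℝ) (a b : ℕ → ℕ), r 0 = M ∧
      IsRIS 4 ε N r u a b ∧ (∀ k, w < a k) ∧ (∀ k, u k ∈ V) ∧
      ∀ k, ∃ o f, Nrm o f ∧ 1 < act f (u k) := by
  obtain ⟨σ, h0, hσ⟩ := exists_chain (α := (ℕ →₀ ℝ) × ℕ × ℕ)
    (P := fun s s' => s.2.2 + 1 ≤ s'.2.2 ∧ s.2.1 ≤ s'.2.1 ∧ SuppIn s.2.1 s'.2.1 s'.1 ∧ s'.1 ∈ V ∧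
      Bd s'.1 4 ∧ (∀ i < s.2.2 + 1, ∀ f, Nrm (some i) f → |act f s'.1| ≤ 4 / mm i) ∧
      (∀ i, s'.2.2 < i → ∀ f, Nrm (some i) f → |act f s'.1| ≤ 4 * ε) ∧
      ∃ o f, Nrm o f ∧ 1 < act f s'.1) (fun s => by
    obtain ⟨u, M', b, h⟩ := hV.exists_average_vector s.2.2 s.2.1 hε
    exact ⟨(u, M', b), h⟩) (0, M, w)
  have hmono : Monotone fun k => (σ k).2.2 := monotone_nat_of_le_succ fun k => by
    have := (hσ k).1
    omega
  refine ⟨fun k => (σ k).2.1, fun k => (σ (k + 1)).1, fun k => (σ k).2.2 + 1,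
    fun k => (σ (k + 1)).2.2, by simp [h0],
    { mono := monotone_nat_of_le_succ fun k => (hσ k).2.1
      supp := fun k _ => (hσ k).2.2.1
      bd := fun k _ => (hσ k).2.2.2.2.1
      low := fun k _ => (hσ k).2.2.2.2.2.1
      high := fun k _ => (hσ k).2.2.2.2.2.2.1
      lt := fun k k' h _ => Nat.lt_succ_of_le (hmono h) },
    fun k => ?_, fun k => (hσ k).2.2.2.1, fun k => (hσ k).2.2.2.2.2.2.2⟩
  have := hmono (Nat.zero_le k)
  simp only [h0] at this
  exact Nat.lt_succ_of_le this

/-- Exact pairs of any even index exist arbitrarily far out in any space with tails. -/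
theorem HasTails.exists_exact_pair {V : Submodule ℝ (ℕ →₀ ℝ)} (hV : HasTails V) (p M : ℕ) :
    ∃ (x : ℕ →₀ ℝ) (f : ℕ →₀ ℚ) (M' : ℕ), M ≤ M' ∧ SuppIn M M' x ∧ x ∈ V ∧
      IsExact 20 (2 * p) x ∧ Nrm (some (2 * p)) f ∧ cut M M' f = f ∧ act f x = 1 := by
  have hm := mm_pos (2 * p)
  obtain ⟨r, u, a, b, hr0, hR, ha, huV, hf⟩ := hV.exists_isRIS (2 * p) M (nn (2 * p))
    (ε := 1 / (mm (2 * p) : ℝ) ^ 2) (by positivity)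
  have hex := hR.isExact (by positivity) le_rfl fun k _ => ha k
  choose o f hf hfu using hf
  set n := nn (2 * p) with hn
  have hn0 : (0 : ℝ) < n := by exact_mod_cast one_le_nn (2 * p)
  set x := ((mm (2 * p) : ℝ) / n) • ∑ k ∈ Finset.range n, u k with hx
  set F := (1 / mm (2 * p) : ℚ) • ∑ l ∈ Finset.range n, cut (r l) (r (l + 1)) (f l) with hF
  have hFN : Nrm (some (2 * p)) F := .free p n hn.le f o r hR.mono fun l _ => hf l
  have hact : 1 ≤ act F x := by
    rw [hF, hx, act_smul, map_smul, hR.act_sum_cut, smul_eq_mul]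
    push_cast
    have h2 : (n : ℝ) ≤ ∑ k ∈ Finset.range n, act (f k) (u k) := by
      calc (n : ℝ) = ∑ k ∈ Finset.range n, (1 : ℝ) := by simp
        _ ≤ _ := Finset.sum_le_sum fun k _ => (hfu k).le
    calc (1 : ℝ) = 1 / mm (2 * p) * (mm (2 * p) / n * n) := by field_simp
      _ ≤ _ := by gcongr
  have hsupp : SuppIn M (r n) x := by
    refine SuppIn.smul (SuppIn.sum fun k hk => ?_) _
    have hk' := Finset.mem_range.1 hk
    exact SuppIn.mono (hR.supp k hk') (by rw [← hr0]; exact hR.mono (Nat.zero_le k)) (hR.mono hk')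
  have hpos : 0 < act F x := by linarith
  refine ⟨(act F x)⁻¹ • x, cut M (r n) F, r n, by rw [← hr0]; exact hR.mono (Nat.zero_le n),
    hsupp.smul _, V.smul_mem _ (V.smul_mem _ (V.sum_mem fun k _ => huV k)), ?_, hFN.cut _ _, ?_, ?_⟩
  · have := hex.smul (t := (act F x)⁻¹) (by
      rw [abs_of_pos (inv_pos.2 hpos)]
      exact inv_le_one_of_one_le₀ hact)
    norm_num at this
    exact this
  · rw [cut_cut, max_self, min_self]
  · rw [act_cut_of_suppIn (hsupp.smul _), map_smul, smul_eq_mul, inv_mul_cancel₀ hpos.ne']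

/-! ### Dependent sequences -/

/-- A dependent sequence: exact pairs `(x k, f k)` whose indices are given by the coding. -/
structure IsDependent (q : ℕ) (r : ℕ → ℕ) (x : ℕ → ℕ →₀ ℝ) (f : ℕ → ℕ →₀ ℚ) : Prop where
  mono : Monotone r
  supp : ∀ k, SuppIn (r k) (r (k + 1)) (x k)
  exact : ∀ k, IsExact 20 (2 * code q f k) (x k)
  nrm : ∀ k, Nrm (some (2 * code q f k)) (f k)
  cut_eq : ∀ k, cut (r k) (r (k + 1)) (f k) = f k
  act_eq : ∀ k, act (f k) (x k) = 1

theorem exists_isDependent {V : ℕ → Submodule ℝ (ℕ →₀ ℝ)} (hV : ∀ k, HasTails (V k)) (q : ℕ) :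
    ∃ r x f, IsDependent q r x f ∧ ∀ k, x k ∈ V k := by
  -- a state consists of the number of pairs chosen so far, the code of their functionals, the
  -- end of the support and the last pair
  obtain ⟨σ, h0, hσ⟩ := exists_chain (α := ℕ × ℕ × ℕ × (ℕ →₀ ℝ) × (ℕ →₀ ℚ))
    (P := fun s s' => (s'.1 = s.1 + 1 ∧ s'.2.1 = Nat.pair s.2.1 (enc s'.2.2.2.2 + 1) + 1) ∧
      s.2.2.1 ≤ s'.2.2.1 ∧ SuppIn s.2.2.1 s'.2.2.1 s'.2.2.2.1 ∧ s'.2.2.2.1 ∈ V s.1 ∧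
      IsExact 20 (2 * s.2.1) s'.2.2.2.1 ∧ Nrm (some (2 * s.2.1)) s'.2.2.2.2 ∧
      cut s.2.2.1 s'.2.2.1 s'.2.2.2.2 = s'.2.2.2.2 ∧ act s'.2.2.2.2 s'.2.2.2.1 = 1) (fun s => by
    obtain ⟨x, f, M', h⟩ := (hV s.1).exists_exact_pair s.2.1 s.2.2.1
    exact ⟨(s.1 + 1, Nat.pair s.2.1 (enc f + 1) + 1, M', x, f), ⟨rfl, rfl⟩, h⟩)
    (0, Nat.pair q 0 + 1, 0, 0, 0)
  have hcount : ∀ k, (σ k).1 = k := fun k => by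
    induction k with
    | zero => simp [h0]
    | succ k ih => rw [(hσ k).1.1, ih]
  have hcode : ∀ k, code q (fun k => (σ (k + 1)).2.2.2.2) k = (σ k).2.1 := fun k => by
    induction k with
    | zero => simp [h0, code]
    | succ k ih => rw [(hσ k).1.2, ← ih, code]
  refine ⟨fun k => (σ k).2.2.1, fun k => (σ (k + 1)).2.2.2.1, fun k => (σ (k + 1)).2.2.2.2,
    ⟨monotone_nat_of_le_succ fun k => (hσ k).2.1, fun k => (hσ k).2.2.1, fun k => ?_, fun k => ?_,
      fun k => (hσ k).2.2.2.2.2.2.1, fun k => (hσ k).2.2.2.2.2.2.2⟩, fun k => ?_⟩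
  · rw [hcode]
    exact (hσ k).2.2.2.2.1
  · rw [hcode]
    exact (hσ k).2.2.2.2.2.1
  · have := (hσ k).2.2.2.1
    rwa [hcount] at this

namespace IsDependent

variable {q : ℕ} {r : ℕ → ℕ} {x : ℕ → ℕ →₀ ℝ} {f : ℕ → ℕ →₀ ℚ}

theorem isBlock_smul (h : IsDependent q r x f) (c : ℕ → ℝ) (N : ℕ) :
    IsBlock N r fun k => c k • x k :=
  ⟨h.mono, fun k _ => (h.supp k).smul _⟩

theorem isBlock (h : IsDependent q r x f) (N : ℕ) : IsBlock N r x :=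
  ⟨h.mono, fun k _ => h.supp k⟩

theorem succ_le_index (q : ℕ) (f : ℕ → ℕ →₀ ℚ) (k : ℕ) : 2 * q + 1 + 1 ≤ 2 * code q f k := by
  have := lt_code q f k
  omega

theorem isRIS (h : IsDependent q r x f) {c : ℕ → ℝ} (hc : ∀ k, |c k| ≤ 1) (N : ℕ) :
    IsRIS 20 (1 / mm (2 * q + 1 + 1)) N r (fun k => c k • x k)
      (fun k => 2 * code q f k) fun k => 2 * code q f k :=
  { toIsBlock := h.isBlock_smul c N
    bd := fun k _ => ((h.exact k).smul (hc k)).bd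
    low := fun k _ => ((h.exact k).smul (hc k)).low
    high := fun k _ i hi g hg => (((h.exact k).smul (hc k)).high i hi g hg).trans <| by
      rw [div_eq_mul_one_div]
      exact mul_le_mul_of_nonneg_left (one_div_le_one_div_of_le (mm_pos _)
        (mm_mono' (succ_le_index q f k))) (by norm_num)
    lt := fun k k' hk _ => Nat.mul_lt_mul_of_pos_left (code_strictMono q f hk) two_pos }

/-- The alternating sum of the values of the initial restrictions of the functionals of a
dependent sequence: the terms before the cut are `1`, those after it are `0`, and the one at the
cut is bounded. -/
theorem abs_alternating_sum_le (h : IsDependent q r x f) (b t : ℕ) :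
    |∑ l ∈ Finset.range t, (-1 : ℝ) ^ l * act (cut 0 b (f l)) (x l)| ≤ 21 := by
  have halt : ∀ t : ℕ, |∑ l ∈ Finset.range t, (-1 : ℝ) ^ l| ≤ 1 := fun t => by
    rw [neg_one_geom_sum]
    split_ifs <;> simp
  have hblock := h.isBlock
  suffices (r t ≤ b → ∑ l ∈ Finset.range t, (-1 : ℝ) ^ l * act (cut 0 b (f l)) (x l) =
      ∑ l ∈ Finset.range t, (-1 : ℝ) ^ l) ∧
      |∑ l ∈ Finset.range t, (-1 : ℝ) ^ l * act (cut 0 b (f l)) (x l)| ≤ 21 from this.2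
  induction t with
  | zero => simp
  | succ t ih =>
    rw [Finset.sum_range_succ, Finset.sum_range_succ]
    have hrt := h.mono (Nat.le_succ t)
    simp only [Nat.succ_eq_add_one] at hrt
    rcases le_or_gt (r (t + 1)) b with hb | hb
    · have h1 : act (cut 0 b (f t)) (x t) = 1 := by
        rw [← h.act_eq t]
        refine act_congr fun n hn => ?_
        have := h.supp t n hn
        rw [cut_apply, if_pos (by omega)]
      have h2 : ∑ l ∈ Finset.range t, (-1 : ℝ) ^ l * act (cut 0 b (f l)) (x l) +
          (-1 : ℝ) ^ t * act (cut 0 b (f t)) (x t) = ∑ l ∈ Finset.range t, (-1 : ℝ) ^ l +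
          (-1 : ℝ) ^ t := by rw [h1, mul_one, ih.1 (hrt.trans hb)]
      refine ⟨fun _ => h2, ?_⟩
      rw [h2, ← Finset.sum_range_succ]
      exact (halt _).trans (by norm_num)
    · refine ⟨fun hb' => absurd hb' (not_le.2 hb), ?_⟩
      rcases le_or_gt (r t) b with hb' | hb'
      · rw [ih.1 hb']
        refine (abs_add_le _ _).trans ?_
        rw [abs_mul, abs_pow, abs_neg, abs_one, one_pow, one_mul]
        linarith [halt t, (h.exact t).bd _ _ ((h.nrm t).cut 0 b)]
      · rw [(hblock (t + 1)).act_cut_eq_zero (Nat.lt_succ_self t) (Or.inl hb'.le), mul_zero,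
          add_zero]
        exact ih.2

/-- Special functionals are small on alternating sums of a dependent sequence: before the point
where the special sequence departs from the dependent one the signs cancel, and from there on
the indices differ because the coding is injective. -/
theorem abs_act_special_le (h : IsDependent q r x f) {s : ℕ →₀ ℚ} (hs : Nrm (some (2 * q + 1)) s)
    (a b : ℕ) : |act (cut a b s)
      (∑ k ∈ Finset.range (nn (2 * q + 1)), (-1 : ℝ) ^ k • x k)| ≤ 20 * 7 := by
  obtain ⟨J, hJ⟩ : ∃ J, J = 2 * q + 1 := ⟨_, rfl⟩
  have hn0 : (0 : ℝ) < nn J := by exact_mod_cast one_le_nn J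
  set N := nn J with hN
  rw [← hJ] at hs
  rw [← hJ, ← hN]
  set Y := ∑ k ∈ Finset.range N, (-1 : ℝ) ^ k • x k with hY
  have hR := h.isRIS (c := fun k => (-1 : ℝ) ^ k) (fun k => by simp) N
  suffices key : ∀ (d : ℕ) (_ : d ≤ N) (g : ℕ → ℕ →₀ ℚ)
      (_ : ∀ l < d, Nrm (some (2 * code q g l)) (g l)) (a b : ℕ),
      |act (cut a b (∑ l ∈ Finset.range d, g l)) Y| ≤ 20 * 7 by
    obtain ⟨o, ho⟩ : ∃ o, o = some J := ⟨_, rfl⟩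
    rw [← ho] at hs
    cases hs with
    | unit => simp at ho
    | free p =>
      simp only [Option.some.injEq] at ho
      omega
    | special q' d hd t ht a' b' g c hc hcut hg =>
      simp only [Option.some.injEq] at ho
      obtain rfl : q' = q := by omega
      rw [cut_smul, cut_smul, cut_cut, act_smul, act_smul, abs_mul, abs_mul]
      have h1 := key d (by rw [hN, ← ho]; exact hd) g hg (max a a') (min b b')
      have h2 : |((1 / mm (2 * q' + 1) : ℚ) : ℝ)| ≤ 1 := by
        push_cast
        rw [abs_of_nonneg (by positivity), div_le_one (mm_pos _)]
        linarith [two_le_mm' (2 * q' + 1)]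
      have h3 : |(t : ℝ)| ≤ 1 := by exact_mod_cast ht
      exact (mul_le_of_le_one_left (by positivity) h2).trans
        ((mul_le_of_le_one_left (abs_nonneg _) h3).trans h1)
  intro d hd g hg a b
  -- `t` is the point of departure
  obtain ⟨t, htd, hlt, ht⟩ : ∃ t ≤ d, (∀ l < t, g l = f l) ∧ (t = d ∨ g t ≠ f t) := by
    classical
    have hex : ∃ t, t = d ∨ g t ≠ f t := ⟨d, Or.inl rfl⟩
    refine ⟨Nat.find hex, Nat.find_min' hex (Or.inl rfl), fun l hl => ?_, Nat.find_spec hex⟩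
    have := Nat.find_min hex hl
    push Not at this
    exact this.2
  rw [cut_sum, act_sum, ← Finset.sum_range_add_sum_Ico _ htd]
  have hdiag : ∀ (c l : ℕ), l < N → act (cut 0 c (f l)) Y =
      (-1 : ℝ) ^ l * act (cut 0 c (f l)) (x l) := fun c l hl => by
    rw [hY, map_sum, Finset.sum_eq_single l]
    · rw [map_smul, smul_eq_mul]
    · intro k hk hkl
      rw [← h.cut_eq l, cut_cut]
      refine hR.act_cut_eq_zero (Finset.mem_range.1 hk) ?_ _
      rcases lt_or_gt_of_ne hkl with hlt | hlt
      · exact Or.inr ((h.mono hlt).trans (le_max_right _ _))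
      · exact Or.inl ((min_le_right _ _).trans (h.mono hlt))
    · exact fun hl' => absurd (Finset.mem_range.2 hl) hl'
  have h1 : |∑ l ∈ Finset.range t, act (cut a b (g l)) Y| ≤ 42 := by
    have : ∑ l ∈ Finset.range t, act (cut a b (g l)) Y =
        ∑ l ∈ Finset.range t, (-1 : ℝ) ^ l * act (cut 0 b (f l)) (x l) -
          ∑ l ∈ Finset.range t, (-1 : ℝ) ^ l * act (cut 0 (min a b) (f l)) (x l) := by
      rw [← Finset.sum_sub_distrib]
      refine Finset.sum_congr rfl fun l hl => ?_
      have hl' := Finset.mem_range.1 hl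
      rw [← hdiag _ _ (by omega), ← hdiag _ _ (by omega), hlt l hl', eq_sub_iff_add_eq]
      have : cut 0 b (f l) = ∑ i ∈ Finset.range 2, if i = 0 then cut a b (f l) else
          cut 0 (min a b) (f l) := by
        ext n
        simp only [Finset.sum_range_succ, Finset.sum_range_zero, zero_add, if_true, one_ne_zero,
          if_false, Finsupp.add_apply, cut_apply]
        split_ifs <;> first | omega | simp
      rw [this, act_sum]
      simp [Finset.sum_range_succ]
    rw [this]
    refine (abs_sub _ _).trans ?_
    linarith [h.abs_alternating_sum_le b t, h.abs_alternating_sum_le (min a b) t]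
  have hpair : ∀ l ∈ Finset.Ico t d, ∀ k ∈ Finset.range N,
      |act (cut a b (g l)) ((-1 : ℝ) ^ k • x k)| ≤
        20 / (N : ℝ) ^ 2 + if l = t then (if k = t then 20 else 0) else 0 := by
    intro l hl k hk
    have hl' := Finset.mem_Ico.1 hl
    have hk' := Finset.mem_range.1 hk
    have hpos : (0 : ℝ) ≤ 20 / (N : ℝ) ^ 2 := by positivity
    by_cases hlk : l = t ∧ k = t
    · rw [if_pos hlk.1, if_pos hlk.2]
      linarith [hR.bd k hk' _ _ ((hg l hl'.2).cut a b)]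
    · have hif : (if l = t then (if k = t then (20 : ℝ) else 0) else 0) = 0 := by
        rw [ite_eq_right_iff]
        exact fun h1 => if_neg fun h2 => hlk ⟨h1, h2⟩
      rw [hif, add_zero]
      have hJ1 : (mm (J + 1) : ℝ) = (N : ℝ) ^ 2 := by
        rw [mm_succ]
        push_cast
        rfl
      have hsmall : ∀ i, J + 1 ≤ i → (20 : ℝ) / mm i ≤ 20 / (N : ℝ) ^ 2 := fun i hi => by
        rw [← hJ1]
        exact div_le_div_of_nonneg_left (by norm_num) (mm_pos _) (mm_mono' hi)
      have hne : code q g l ≠ code q f k := fun heq => by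
        obtain ⟨rfl, hpre⟩ := code_injective heq
        rcases lt_or_eq_of_le hl'.1 with hlt' | rfl
        · rcases ht with ht | ht
          · omega
          · exact ht (hpre t hlt')
        · exact hlk ⟨rfl, rfl⟩
      rcases lt_or_gt_of_ne hne with hlt' | hlt'
      · refine (hR.low k hk' (2 * code q g l) (by omega) _ ((hg l hl'.2).cut a b)).trans ?_
        exact hsmall _ (by rw [hJ]; exact succ_le_index q g l)
      · refine (((h.exact k).smul (by simp)).high (2 * code q g l) (by omega) _
          ((hg l hl'.2).cut a b)).trans ?_
        exact hsmall _ (by rw [hJ]; exact succ_le_index q f k)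
  have h2 : |∑ l ∈ Finset.Ico t d, act (cut a b (g l)) Y| ≤ 40 := by
    calc _ ≤ ∑ l ∈ Finset.Ico t d, ∑ k ∈ Finset.range N,
          |act (cut a b (g l)) ((-1 : ℝ) ^ k • x k)| := by
          refine (Finset.abs_sum_le_sum_abs _ _).trans (Finset.sum_le_sum fun l _ => ?_)
          rw [hY, map_sum]
          exact Finset.abs_sum_le_sum_abs _ _
      _ ≤ ∑ l ∈ Finset.Ico t d, ∑ k ∈ Finset.range N,
          (20 / (N : ℝ) ^ 2 + if l = t then (if k = t then 20 else 0) else 0) :=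
          Finset.sum_le_sum fun l hl => Finset.sum_le_sum fun k hk => hpair l hl k hk
      _ ≤ N * (N * (20 / (N : ℝ) ^ 2)) + 20 := by
          simp only [Finset.sum_add_distrib, Finset.sum_const, Finset.card_range, nsmul_eq_mul,
            Nat.card_Ico]
          refine add_le_add ?_ ?_
          · refine mul_le_mul_of_nonneg_right ?_ (by positivity)
            exact_mod_cast (Nat.sub_le d t).trans hd
          · calc _ ≤ ∑ l ∈ Finset.Ico t d, if l = t then (20 : ℝ) else 0 := by
                  refine Finset.sum_le_sum fun l _ => ?_
                  split_ifs
                  · rw [Finset.sum_ite_eq']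
                    split_ifs <;> norm_num
                  · simp
              _ ≤ 20 := by
                  rw [Finset.sum_ite_eq']
                  split_ifs <;> norm_num
      _ = 40 := by
          field_simp
          norm_num
  refine (abs_add_le _ _).trans ?_
  linarith

end IsDependent

/-- The heart of the construction: in any two spaces with tails there are vectors whose difference
is much smaller than their sum. -/
theorem exists_act_add_gt_bd_sub {V W : Submodule ℝ (ℕ →₀ ℝ)} (hV : HasTails V) (hW : HasTails W)
    (D : ℝ) : ∃ x ∈ V, ∃ y ∈ W, ∃ R : ℝ, Bd (x - y) R ∧
      ∃ o f, Nrm o f ∧ D * R < act f (x + y) := by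
  obtain ⟨q, hq⟩ := exists_nat_gt (80 * D)
  obtain ⟨r, x, f, h, hx⟩ := exists_isDependent
    (V := fun k => if Even k then V else W) (fun k => by
      split_ifs <;> assumption) q
  set J := 2 * q + 1 with hJ
  set N := nn J with hN
  have hm := mm_pos J
  have hm2 := two_le_mm' J
  have hN0 : (0 : ℝ) < N := by exact_mod_cast one_le_nn J
  have hDm : 80 * D < mm J := hq.trans_le (by
    have := lt_mm J
    exact_mod_cast (by omega : q ≤ mm J))
  have hR := h.isRIS (c := fun k => (-1 : ℝ) ^ k) (fun k => by simp) N
  have hsucc := one_div_mm_succ_le J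
  have hpow := half_pow_sq_mm_le J
  have hNm : (N : ℝ) = 10 * (mm J : ℝ) ^ (mm J ^ 2 + 1) * (mm J : ℝ) ^ 2 := nn_cast_eq J
  have hup : Bd (∑ k ∈ Finset.range N, (-1 : ℝ) ^ k • x k) (80 * N / (mm J : ℝ) ^ 2) := by
    intro o g hg
    obtain ⟨t, ht⟩ := exists_cut_eq_self g
    rw [← ht 0]
    have hsq : 1 / (mm J : ℝ) ^ 2 ≤ 1 := by
      rw [div_le_one (by positivity)]
      nlinarith
    refine (hR.abs_act_le (δ := 0) (c₀ := 7) (by norm_num) (by positivity) (hsucc.trans hsq) le_rfl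
      (by norm_num) (j := J) (fun k _ => IsDependent.succ_le_index q f k) (fun s hs a b => by
        rw [zero_mul, add_zero]
        exact h.abs_act_special_le hs a b) (Q := mm J) (by have := two_le_mm J; omega)
        (fun i hi => nn_le_mm hi) (mm J ^ 2) hg _ _).trans ?_
    have hst : (starts N r 0 (t + 0) : ℝ) ≤ N := Nat.cast_le.2 (starts_le _ _ _ _)
    have e1 : 20 * ((1 / 2) ^ (mm J ^ 2) + 0 + 1 / (mm (2 * q + 1 + 1) : ℝ) + 1 / mm (J + 1)) *
        starts N r 0 (t + 0) ≤ 20 * (3 * (1 / (mm J : ℝ) ^ 2)) * N := by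
      refine mul_le_mul (mul_le_mul_of_nonneg_left ?_ (by norm_num)) hst (by positivity)
        (by positivity)
      rw [← hJ]
      linarith
    have e2 : 20 * ((3 + 7) * (mm J : ℝ) ^ (mm J ^ 2)) ≤ 20 * (N / (mm J : ℝ) ^ 2) := by
      refine mul_le_mul_of_nonneg_left ?_ (by norm_num)
      rw [hNm, mul_div_assoc, div_self (by positivity), mul_one, pow_succ (mm J : ℝ) (mm J ^ 2)]
      have : 0 < (mm J : ℝ) ^ (mm J ^ 2) := by positivity
      nlinarith
    have e3 : 80 * N / (mm J : ℝ) ^ 2 = 20 * (N / (mm J : ℝ) ^ 2) +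
      20 * (3 * (1 / (mm J : ℝ) ^ 2)) * N := by ring
    rw [e3]
    exact add_le_add e2 e1
  refine ⟨∑ k ∈ (Finset.range N).filter Even, x k, V.sum_mem fun k hk => ?_,
    ∑ k ∈ (Finset.range N).filter fun k => ¬ Even k, x k, W.sum_mem fun k hk => ?_,
    80 * N / (mm J : ℝ) ^ 2, ?_, some J, _, .special q N le_rfl 1 (by simp) 0
      ((exists_cut_eq_self (∑ l ∈ Finset.range N, f l)).choose + 0) f r h.mono
      (fun l _ => h.cut_eq l) (fun l _ => h.nrm l), ?_⟩
  · have := hx k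
    rwa [if_pos (Finset.mem_filter.1 hk).2] at this
  · have := hx k
    rwa [if_neg (Finset.mem_filter.1 hk).2] at this
  · convert hup using 1
    rw [← Finset.sum_filter_add_sum_filter_not (Finset.range N) Even fun k => (-1 : ℝ) ^ k • x k,
      sub_eq_add_neg, ← Finset.sum_neg_distrib]
    congr 1
    · refine Finset.sum_congr rfl fun k hk => ?_
      rw [(Finset.mem_filter.1 hk).2.neg_one_pow, one_smul]
    · refine Finset.sum_congr rfl fun k hk => ?_
      rw [(Nat.not_even_iff_odd.1 (Finset.mem_filter.1 hk).2).neg_one_pow, neg_one_smul]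
  · rw [Finset.sum_filter_add_sum_filter_not, (exists_cut_eq_self _).choose_spec 0, one_smul,
      act_smul]
    have hd : act (∑ l ∈ Finset.range N, f l) (∑ k ∈ Finset.range N, x k) = N := by
      have := (h.isBlock N).act_sum_cut f
      simp only [h.cut_eq, h.act_eq] at this
      simpa using this
    rw [hd]
    push_cast
    rw [← hJ]
    calc D * (80 * N / (mm J : ℝ) ^ 2) = 80 * D * (N / (mm J : ℝ) ^ 2) := by ring
      _ < mm J * (N / (mm J : ℝ) ^ 2) := mul_lt_mul_of_pos_right hDm (by positivity)
      _ = 1 / mm J * N := by field_simp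

end MixedTsirelson

/-! ### Infinite dimensional subspaces -/

theorem not_finiteDimensional_inf_ker {E F : Type*} [AddCommGroup E] [Module ℝ E] [AddCommGroup F]
    [Module ℝ F] {Z : Submodule ℝ E} (hZ : ¬ FiniteDimensional ℝ Z) (φ : E →ₗ[ℝ] F)
    (hφ : FiniteDimensional ℝ (Z.map φ)) : ¬ FiniteDimensional ℝ (Z ⊓ φ.ker : Submodule ℝ E) := by
  intro h
  rw [← Submodule.fg_iff_finiteDimensional] at h hφ hZ
  exact hZ (Submodule.fg_of_fg_map_of_fg_inf_ker φ hφ h)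

theorem not_finiteDimensional_inf {E : Type*} [AddCommGroup E] [Module ℝ E] {Z G F : Submodule ℝ E}
    (hZ : ¬ FiniteDimensional ℝ Z) [FiniteDimensional ℝ G] (h : Z ≤ F ⊔ G) :
    ¬ FiniteDimensional ℝ (Z ⊓ F : Submodule ℝ E) := by
  have := not_finiteDimensional_inf_ker hZ F.mkQ ?_
  · rwa [Submodule.ker_mkQ] at this
  · have h1 : Z.map F.mkQ ≤ G.map F.mkQ := by
      refine (Submodule.map_mono h).trans ?_
      rw [Submodule.map_sup, Submodule.mkQ_map_self, bot_sup_eq]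
    exact Submodule.finiteDimensional_of_le h1

theorem not_finiteDimensional_mono {E : Type*} [AddCommGroup E] [Module ℝ E] {Y Z : Submodule ℝ E}
    (hY : ¬ FiniteDimensional ℝ Y) (h : Y ≤ Z) : ¬ FiniteDimensional ℝ Z := fun _ =>
  hY (Submodule.finiteDimensional_of_le h)

theorem not_finiteDimensional_map {E F : Type*} [AddCommGroup E] [Module ℝ E] [AddCommGroup F]
    [Module ℝ F] {Z : Submodule ℝ E} (hZ : ¬ FiniteDimensional ℝ Z) (φ : E →ₗ[ℝ] F)
    (hφ : ∀ z ∈ Z, φ z = 0 → z = 0) : ¬ FiniteDimensional ℝ (Z.map φ) := by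
  intro h
  refine not_finiteDimensional_inf_ker hZ φ h ?_
  have : Z ⊓ φ.ker = ⊥ := (Submodule.eq_bot_iff _).2 fun z hz => hφ z hz.1 hz.2
  rw [this]
  infer_instance

theorem not_finiteDimensional_span {E : Type*} [AddCommGroup E] [Module ℝ E] {ι : Type*}
    [Infinite ι] {z : ι → E} (h : LinearIndependent ℝ z) :
    ¬ FiniteDimensional ℝ (Submodule.span ℝ (Set.range z)) := by
  intro hf
  have := (linearIndependent_span h).finite
  exact not_finite ι

theorem exists_mem_ne_zero {E : Type*} [AddCommGroup E] [Module ℝ E] {Z : Submodule ℝ E}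
    (hZ : ¬ FiniteDimensional ℝ Z) : ∃ z ∈ Z, z ≠ 0 := by
  refine (Submodule.ne_bot_iff Z).1 ?_
  rintro rfl
  exact hZ inferInstance

theorem exists_linearCombination_eq_sum_range {E : Type*} [AddCommGroup E] [Module ℝ E] (z : ℕ → E)
    (l : ℕ →₀ ℝ) : ∃ n, (∀ k, l k ≠ 0 → k < n) ∧
      Finsupp.linearCombination ℝ z l = ∑ i ∈ Finset.range n, l i • z i := by
  have hlt : ∀ k, l k ≠ 0 → k < l.support.sup id + 1 := fun k hk => by
    have := Finset.le_sup (f := id) (Finsupp.mem_support_iff.2 hk)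
    simp only [id] at this
    omega
  refine ⟨l.support.sup id + 1, hlt, ?_⟩
  rw [Finsupp.linearCombination_apply]
  exact Finsupp.sum_of_support_subset _ (fun k hk => Finset.mem_range.2
    (hlt k (Finsupp.mem_support_iff.1 hk))) _ fun _ _ => zero_smul _ _

/-- Vectors whose coefficients are controlled by the norm of their combinations are linearly
independent. -/
theorem linearIndependent_of_abs_le {E : Type*} [NormedAddCommGroup E] [NormedSpace ℝ E] {z : ℕ → E}
    {c : ℕ → ℝ} (h : ∀ (l : ℕ →₀ ℝ) k, |l k| ≤ c k * ‖Finsupp.linearCombination ℝ z l‖) :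
    LinearIndependent ℝ z := by
  rw [linearIndependent_iff]
  intro l hl
  ext k
  have h1 := h l k
  rw [hl, norm_zero, mul_zero] at h1
  exact abs_nonpos_iff.1 h1

/-! ### A quantitative form of hereditary indecomposability -/

/-- The quantitative form of hereditary indecomposability, for subspaces that need not be closed:
any two infinite dimensional subspaces are at angle zero. -/
def IsHISub {E : Type*} [NormedAddCommGroup E] [NormedSpace ℝ E] (Z : Submodule ℝ E) : Prop :=
  ¬ FiniteDimensional ℝ Z ∧ ∀ Y W : Submodule ℝ E, Y ≤ Z → W ≤ Z → ¬ FiniteDimensional ℝ Y →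
    ¬ FiniteDimensional ℝ W → ∀ C : ℝ, ∃ y ∈ Y, ∃ w ∈ W, C * ‖y + w‖ < ‖y‖

section

variable {E F : Type*} [NormedAddCommGroup E] [NormedSpace ℝ E] [NormedAddCommGroup F]
  [NormedSpace ℝ F]

theorem IsHISub.mono {Y Z : Submodule ℝ E} (h : IsHISub Z) (hYZ : Y ≤ Z)
    (hY : ¬ FiniteDimensional ℝ Y) : IsHISub Y :=
  ⟨hY, fun V W hV hW => h.2 V W (hV.trans hYZ) (hW.trans hYZ)⟩

theorem IsHISub.map {Z : Submodule ℝ E} (h : IsHISub Z) (T : E →ₗ[ℝ] F) {c C : ℝ} (hc : 0 < c)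
    (hlow : ∀ z ∈ Z, c * ‖z‖ ≤ ‖T z‖) (hup : ∀ z ∈ Z, ‖T z‖ ≤ C * ‖z‖) : IsHISub (Z.map T) := by
  have hinj : ∀ z ∈ Z, T z = 0 → z = 0 := fun z hz h0 => by
    have h1 := hlow z hz
    rw [h0, norm_zero] at h1
    exact norm_eq_zero.1 (le_antisymm (by nlinarith) (norm_nonneg z))
  have hpre : ∀ Y ≤ Z.map T, ¬ FiniteDimensional ℝ Y →
      ¬ FiniteDimensional ℝ (Z ⊓ Y.comap T : Submodule ℝ E) := by
    intro Y hY hYinf hfd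
    refine hYinf ?_
    have h1 : (Z ⊓ Y.comap T).map T = Y := by
      refine le_antisymm (Submodule.map_le_iff_le_comap.2 inf_le_right) fun y hy => ?_
      obtain ⟨z, hz, rfl⟩ := hY hy
      exact ⟨z, ⟨hz, hy⟩, rfl⟩
    rw [← h1]
    infer_instance
  refine ⟨not_finiteDimensional_map h.1 T hinj, fun Y W hY hW hYinf hWinf D => ?_⟩
  obtain ⟨y, hy, w, hw, hlt⟩ := h.2 _ _ inf_le_left inf_le_left (hpre Y hY hYinf) (hpre W hW hWinf)
    (|D| * C / c)
  refine ⟨T y, hy.2, T w, hw.2, ?_⟩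
  rw [← map_add]
  calc D * ‖T (y + w)‖ ≤ |D| * ‖T (y + w)‖ :=
        mul_le_mul_of_nonneg_right (le_abs_self D) (norm_nonneg _)
    _ ≤ |D| * (C * ‖y + w‖) :=
        mul_le_mul_of_nonneg_left (hup _ (Z.add_mem hy.1 hw.1)) (abs_nonneg D)
    _ = c * (|D| * C / c * ‖y + w‖) := by field_simp
    _ < c * ‖y‖ := mul_lt_mul_of_pos_left hlt hc
    _ ≤ ‖T y‖ := hlow y hy.1

theorem IsHISub.of_map {Z : Submodule ℝ E} (T : E →ₗᵢ[ℝ] F) (h : IsHISub (Z.map T.toLinearMap)) :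
    IsHISub Z := by
  refine ⟨fun hfd => h.1 inferInstance, fun Y W hY hW hYinf hWinf C => ?_⟩
  have hmap : ∀ V : Submodule ℝ E, ¬ FiniteDimensional ℝ V →
      ¬ FiniteDimensional ℝ (V.map T.toLinearMap) := fun V hV =>
    not_finiteDimensional_map hV _ fun z _ hz => (T.map_eq_iff.1 (by simpa using hz))
  obtain ⟨_, ⟨y, hy, rfl⟩, _, ⟨w, hw, rfl⟩, hlt⟩ := h.2 _ _ (Submodule.map_mono hY)
    (Submodule.map_mono hW) (hmap Y hYinf) (hmap W hWinf) C
  refine ⟨y, hy, w, hw, ?_⟩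
  rw [← map_add] at hlt
  exact (T.norm_map (y + w)).symm ▸ (T.norm_map y) ▸ hlt

/-- Two infinite dimensional subspaces at a positive angle have closures whose direct sum is
closed. -/
theorem exists_isDecomposable [CompleteSpace E] {Y W : Submodule ℝ E}
    (hY : ¬ FiniteDimensional ℝ Y) (hW : ¬ FiniteDimensional ℝ W) {C : ℝ}
    (h : ∀ y ∈ Y, ∀ w ∈ W, ‖y‖ ≤ C * ‖y + w‖) :
    ∃ V : Submodule ℝ E, IsClosed (V : Set E) ∧ IsDecomposable V := by
  have hcl : ∀ y ∈ Y.topologicalClosure, ∀ w ∈ W.topologicalClosure, ‖y‖ ≤ C * ‖y + w‖ := by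
    intro y hy w hw
    have hclosed : IsClosed {p : E × E | ‖p.1‖ ≤ C * ‖p.1 + p.2‖} :=
      isClosed_le (by fun_prop) (by fun_prop)
    have hsub : closure ((Y : Set E) ×ˢ (W : Set E)) ⊆ {p : E × E | ‖p.1‖ ≤ C * ‖p.1 + p.2‖} :=
      closure_minimal (fun p hp => h p.1 hp.1 p.2 hp.2) hclosed
    rw [closure_prod_eq] at hsub
    exact hsub (Set.mk_mem_prod hy hw)
  set Y' := Y.topologicalClosure
  set W' := W.topologicalClosure
  have hYc : IsClosed (Y' : Set E) := Y.isClosed_topologicalClosure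
  have hWc : IsClosed (W' : Set E) := W.isClosed_topologicalClosure
  have : CompleteSpace Y' := hYc.completeSpace_coe
  have : CompleteSpace W' := hWc.completeSpace_coe
  refine ⟨Y' ⊔ W', ?_, Y', W', hYc, hWc, not_finiteDimensional_mono hY Y.le_topologicalClosure,
    not_finiteDimensional_mono hW W.le_topologicalClosure, ?_, rfl⟩
  · let T : (Y' × W') →L[ℝ] E := Y'.subtypeL.coprod W'.subtypeL
    have hT : ∀ p : Y' × W', T p = (p.1 : E) + p.2 := fun p => rfl
    have hanti : AntilipschitzWith (Real.toNNReal (|C| + 1)) T := by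
      refine T.antilipschitz_of_bound fun p => ?_
      rw [Real.coe_toNNReal _ (by positivity), hT, Prod.norm_def]
      have h1 := hcl p.1 p.1.2 p.2 p.2.2
      have h2 : C * ‖(p.1 : E) + p.2‖ ≤ |C| * ‖(p.1 : E) + p.2‖ :=
        mul_le_mul_of_nonneg_right (le_abs_self C) (norm_nonneg _)
      have h3 : ‖(p.2 : E)‖ ≤ ‖(p.1 : E) + p.2‖ + ‖(p.1 : E)‖ := by
        have := norm_sub_le ((p.1 : E) + p.2) p.1
        rwa [add_sub_cancel_left] at this
      refine max_le ?_ ?_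
      · rw [Submodule.coe_norm]
        nlinarith [norm_nonneg ((p.1 : E) + p.2)]
      · rw [Submodule.coe_norm]
        nlinarith [norm_nonneg ((p.1 : E) + p.2)]
    have hran := hanti.isClosed_range T.uniformContinuous
    convert hran using 1
    ext x
    rw [SetLike.mem_coe, Submodule.mem_sup]
    constructor
    · rintro ⟨y, hy, w, hw, rfl⟩
      exact ⟨(⟨y, hy⟩, ⟨w, hw⟩), rfl⟩
    · rintro ⟨p, rfl⟩
      exact ⟨p.1, p.1.2, p.2, p.2.2, rfl⟩
  · refine (Submodule.eq_bot_iff _).2 fun x hx => ?_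
    have := hcl x hx.1 (-x) (W'.neg_mem hx.2)
    rw [add_neg_cancel, norm_zero, mul_zero] at this
    exact norm_le_zero_iff.1 this

theorem isHISub_top_of_isHereditarilyIndecomposable [CompleteSpace E]
    (h : IsHereditarilyIndecomposable E) : IsHISub (⊤ : Submodule ℝ E) := by
  refine ⟨fun hfd => h.1 ?_, fun Y W _ _ hY hW C => ?_⟩
  · exact Module.Finite.equiv (Submodule.topEquiv (R := ℝ) (M := E))
  · by_contra hcon
    push Not at hcon
    obtain ⟨V, hV, hdec⟩ := exists_isDecomposable hY hW hcon
    exact h.2 V hV hdec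

theorem IsHISub.isHereditarilyIndecomposable [CompleteSpace E] (h : IsHISub (⊤ : Submodule ℝ E)) :
    IsHereditarilyIndecomposable E := by
  refine ⟨fun hfd => h.1 inferInstance, ?_⟩
  rintro V hV ⟨Y, W, hY, hW, hYinf, hWinf, hinf, rfl⟩
  have : CompleteSpace Y := hY.completeSpace_coe
  have : CompleteSpace W := hW.completeSpace_coe
  have : CompleteSpace (Y ⊔ W : Submodule ℝ E) := hV.completeSpace_coe
  let T : (Y × W) →L[ℝ] (Y ⊔ W : Submodule ℝ E) := (Y.subtypeL.coprod W.subtypeL).codRestrict _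
    fun p => Submodule.add_mem_sup p.1.2 p.2.2
  have hT : ∀ p : Y × W, (T p : E) = (p.1 : E) + p.2 := fun p => rfl
  obtain ⟨C, -, hC⟩ := T.exists_preimage_norm_le fun x => by
    obtain ⟨y, hy, w, hw, hyw⟩ := Submodule.mem_sup.1 x.2
    exact ⟨(⟨y, hy⟩, ⟨w, hw⟩), Subtype.ext hyw⟩
  obtain ⟨y, hy, w, hw, hlt⟩ := h.2 Y W le_top le_top hYinf hWinf C
  obtain ⟨p, hp, hle⟩ := hC ⟨y + w, Submodule.add_mem_sup hy hw⟩
  have heq : (p.1 : E) + p.2 = y + w := by rw [← hT, hp]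
  have h0 : (p.1 : E) - y ∈ Y ⊓ W := by
    refine ⟨Y.sub_mem p.1.2 hy, ?_⟩
    have : (p.1 : E) - y = w - p.2 := by
      rw [sub_eq_sub_iff_add_eq_add, heq, add_comm]
    rw [SetLike.mem_coe, this]
    exact W.sub_mem hw p.2.2
  rw [hinf, Submodule.mem_bot, sub_eq_zero] at h0
  have h1 : ‖y‖ ≤ ‖p‖ := by
    rw [← h0]
    exact norm_fst_le p
  exact absurd hlt (not_lt.2 (h1.trans hle))

theorem isHereditarilyIndecomposable_iff [CompleteSpace E] {Z : Submodule ℝ E}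
    (hZ : IsClosed (Z : Set E)) : IsHereditarilyIndecomposable Z ↔ IsHISub Z := by
  have : CompleteSpace Z := hZ.completeSpace_coe
  constructor
  · intro h
    have := (isHISub_top_of_isHereditarilyIndecomposable h).map Z.subtype one_pos (C := 1)
      (fun z _ => by simp) (fun z _ => by simp)
    rwa [Submodule.map_top, Submodule.range_subtype] at this
  · intro h
    refine IsHISub.isHereditarilyIndecomposable (IsHISub.of_map Z.subtypeₗᵢ ?_)
    rw [Submodule.map_top]
    convert h
    exact Submodule.range_subtype Z

/-! ### Strictly singular operators -/

/-- An operator that is not bounded below on any infinite dimensional subspace of `W` has small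
norm on some infinite dimensional subspace. The subspace is spanned by unit vectors `z k` with
functionals `φ k` of norm one such that `φ i (z k)` vanishes for `i < k`, so the `k`-th coefficient
of a vector is at most `2 ^ k` times its norm. -/
theorem exists_small_subspace {W : Submodule ℝ E} (hW : ¬ FiniteDimensional ℝ W) (Q : E →L[ℝ] F)
    (hQ : ∀ W' ≤ W, ¬ FiniteDimensional ℝ W' → ∀ c > 0, ∃ z ∈ W', ‖Q z‖ < c * ‖z‖)
    {ε : ℝ} (hε : 0 < ε) :
    ∃ W' ≤ W, ¬ FiniteDimensional ℝ W' ∧ ∀ z ∈ W', ‖Q z‖ ≤ ε * ‖z‖ := by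
  obtain ⟨σ, h0, hσ⟩ := MixedTsirelson.exists_chain
    (α := ℕ × {V : Submodule ℝ E // V ≤ W ∧ ¬ FiniteDimensional ℝ V} × E × (E →L[ℝ] ℝ))
    (P := fun s s' => s'.1 = s.1 + 1 ∧ s'.2.2.1 ∈ s.2.1.1 ∧ ‖Q s'.2.2.1‖ ≤ ε / 2 * (1 / 4) ^ s.1 ∧
      ‖s'.2.2.2‖ = 1 ∧ s'.2.2.2 s'.2.2.1 = 1 ∧ ‖s'.2.2.1‖ ≤ 1 ∧
      s'.2.1.1 ≤ s.2.1.1 ⊓ (s'.2.2.2 : E →ₗ[ℝ] ℝ).ker) (fun s => by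
    obtain ⟨z, hz, hlt⟩ := hQ s.2.1.1 s.2.1.2.1 s.2.1.2.2 (ε / 2 * (1 / 4) ^ s.1) (by positivity)
    have hz0 : ‖z‖ ≠ 0 := fun h0 => by
      rw [h0, mul_zero] at hlt
      exact absurd hlt (not_lt.2 (norm_nonneg _))
    have hzpos : 0 < ‖z‖ := lt_of_le_of_ne (norm_nonneg z) hz0.symm
    obtain ⟨φ, hφ, hφz⟩ := exists_dual_vector ℝ z hz0
    refine ⟨(s.1 + 1, ⟨s.2.1.1 ⊓ (φ : E →ₗ[ℝ] ℝ).ker, inf_le_left.trans s.2.1.2.1,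
      not_finiteDimensional_inf_ker s.2.1.2.2 _ inferInstance⟩, ‖z‖⁻¹ • z, φ), rfl,
      Submodule.smul_mem _ _ hz, ?_, hφ, ?_, ?_, le_rfl⟩
    · rw [map_smul, norm_smul, norm_inv, norm_norm, inv_mul_le_iff₀ hzpos, mul_comm]
      exact hlt.le
    · simp [hφz, hz0]
    · simp [norm_smul, hz0]) (0, ⟨W, le_rfl, hW⟩, 0, 0)
  have hcount : ∀ k, (σ k).1 = k := fun k => by
    induction k with
    | zero => simp [h0]
    | succ k ih => rw [(hσ k).1, ih]
  set z : ℕ → E := fun k => (σ (k + 1)).2.2.1 with hz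
  set φ : ℕ → E →L[ℝ] ℝ := fun k => (σ (k + 1)).2.2.2 with hφ
  set V : ℕ → Submodule ℝ E := fun k => (σ k).2.1.1 with hV
  have hanti : Antitone V := antitone_nat_of_succ_le fun k => (hσ k).2.2.2.2.2.2.trans inf_le_left
  have hφz : ∀ i k, i < k → φ i (z k) = 0 := fun i k hik => by
    have h1 : z k ∈ V (i + 1) := hanti hik (hσ k).2.1
    exact ((hσ i).2.2.2.2.2.2 h1).2
  have hφz1 : ∀ k, φ k (z k) = 1 := fun k => (hσ k).2.2.2.2.1
  have hφn : ∀ k x, |φ k x| ≤ ‖x‖ := fun k x => by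
    have := (φ k).le_opNorm x
    rwa [(hσ k).2.2.2.1, one_mul, Real.norm_eq_abs] at this
  have hQz : ∀ k, ‖Q (z k)‖ ≤ ε / 2 * (1 / 4) ^ k := fun k => by
    have := (hσ k).2.2.1
    rwa [hcount] at this
  have hzn : ∀ k, ‖z k‖ ≤ 1 := fun k => (hσ k).2.2.2.2.2.1
  have coef : ∀ (a : ℕ → ℝ) (n k : ℕ), k ≤ n →
      ‖∑ i ∈ Finset.Ico k n, a i • z i‖ ≤ 2 ^ k * ‖∑ i ∈ Finset.range n, a i • z i‖ ∧
      (k < n → |a k| ≤ 2 ^ k * ‖∑ i ∈ Finset.range n, a i • z i‖) := by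
    intro a n k hk
    have hstep : ∀ k < n, φ k (∑ i ∈ Finset.Ico k n, a i • z i) = a k := fun k hkn => by
      rw [map_sum, Finset.sum_eq_sum_Ico_succ_bot hkn, map_smul, hφz1, Finset.sum_eq_zero]
      · simp
      · intro i hi
        rw [map_smul, hφz k i (Finset.mem_Ico.1 hi).1, smul_zero]
    have hcoef : ∀ k < n, |a k| ≤ ‖∑ i ∈ Finset.Ico k n, a i • z i‖ := fun k hkn => by
      conv_lhs => rw [← hstep k hkn]
      exact hφn _ _
    have hmain : ‖∑ i ∈ Finset.Ico k n, a i • z i‖ ≤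
        2 ^ k * ‖∑ i ∈ Finset.range n, a i • z i‖ := by
      induction k with
      | zero => simp
      | succ k ih =>
        have h1 := ih (by omega)
        have h2 := hcoef k (by omega)
        rw [Finset.sum_eq_sum_Ico_succ_bot (by omega : k < n)] at h1 h2
        have h3 := norm_sub_le (a k • z k + ∑ i ∈ Finset.Ico (k + 1) n, a i • z i) (a k • z k)
        rw [add_sub_cancel_left] at h3
        have h4 : ‖a k • z k‖ ≤ |a k| := by
          rw [norm_smul, Real.norm_eq_abs]
          exact mul_le_of_le_one_right (abs_nonneg _) (hzn k)
        rw [pow_succ]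
        linarith
    exact ⟨hmain, fun hkn => (hcoef k hkn).trans hmain⟩
  refine ⟨Submodule.span ℝ (Set.range z), ?_, not_finiteDimensional_span ?_, fun x hx => ?_⟩
  · rw [Submodule.span_le]
    rintro _ ⟨k, rfl⟩
    exact (σ k).2.1.2.1 (hσ k).2.1
  · refine linearIndependent_of_abs_le (c := fun k => 2 ^ k) fun l k => ?_
    obtain ⟨n, hn, heq⟩ := exists_linearCombination_eq_sum_range z l
    by_cases hk : l k = 0
    · rw [hk, abs_zero]
      positivity
    · rw [heq]
      exact (coef l n k (hn k hk).le).2 (hn k hk)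
  · obtain ⟨l, rfl⟩ := (Finsupp.mem_span_range_iff_exists_finsupp).1 hx
    obtain ⟨n, -, heq⟩ := exists_linearCombination_eq_sum_range z l
    rw [← Finsupp.linearCombination_apply, heq, map_sum]
    set x := ∑ i ∈ Finset.range n, l i • z i with hx
    calc ‖∑ i ∈ Finset.range n, Q (l i • z i)‖
        ≤ ∑ i ∈ Finset.range n, ‖Q (l i • z i)‖ := norm_sum_le _ _
      _ ≤ ∑ i ∈ Finset.range n, ε / 2 * ‖x‖ * (1 / 2) ^ i := by
          refine Finset.sum_le_sum fun i hi => ?_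
          have hi' := Finset.mem_range.1 hi
          rw [map_smul, norm_smul, Real.norm_eq_abs]
          calc |l i| * ‖Q (z i)‖ ≤ 2 ^ i * ‖x‖ * (ε / 2 * (1 / 4) ^ i) :=
                mul_le_mul ((coef l n i hi'.le).2 hi') (hQz i) (norm_nonneg _) (by positivity)
            _ = ε / 2 * ‖x‖ * (1 / 2) ^ i := by
                rw [show (1 / 4 : ℝ) = 1 / 2 * (1 / 2) by norm_num, mul_pow]
                have : (2 : ℝ) ^ i * (1 / 2) ^ i = 1 := by
                  rw [← mul_pow]
                  norm_num
                linear_combination (ε / 2 * ‖x‖ * (1 / 2) ^ i) * this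
      _ = ε / 2 * ‖x‖ * ∑ i ∈ Finset.range n, (1 / 2 : ℝ) ^ i := by rw [Finset.mul_sum]
      _ ≤ ε / 2 * ‖x‖ * 2 :=
          mul_le_mul_of_nonneg_left (sum_geometric_two_le n) (by positivity)
      _ = ε * ‖x‖ := by ring

end

/-! ### Hereditary indecomposability of the mixed Tsirelson space -/

namespace MixedTsirelson

variable {E : Type*} [NormedAddCommGroup E] [NormedSpace ℝ E]

/-- The norm of finite combinations of the vectors `e n` is the supremum over the norming
functionals. -/
structure IsNormedBy (e : ℕ → E) : Prop where
  bd : ∀ x, Bd x ‖Finsupp.linearCombination ℝ e x‖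
  le : ∀ x r, Bd x r → ‖Finsupp.linearCombination ℝ e x‖ ≤ r

namespace IsNormedBy

variable {e : ℕ → E}

theorem linearIndependent (h : IsNormedBy e) : LinearIndependent ℝ e :=
  linearIndependent_of_abs_le (c := fun _ => 1) fun l k => by
    rw [one_mul]
    exact (h.bd l).abs_apply_le k

/-- Every infinite dimensional subspace of the closed span contains, up to a small perturbation,
normalized vectors supported arbitrarily far out. -/
theorem exists_near (h : IsNormedBy e) {Y : Submodule ℝ E}
    (hYe : Y ≤ (Submodule.span ℝ (Set.range e)).topologicalClosure)
    (hY : ¬ FiniteDimensional ℝ Y) (M : ℕ) {ε : ℝ} (hε : 0 < ε) :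
    ∃ u : ℕ →₀ ℝ, ∃ y ∈ Y, u ≠ 0 ∧ (∀ n, u n ≠ 0 → M ≤ n) ∧
      (∃ o f, Nrm o f ∧ 1 / 2 < act f u) ∧ ‖Finsupp.linearCombination ℝ e u - y‖ ≤ ε := by
  set X := (Submodule.span ℝ (e '' Set.Ici M)).topologicalClosure with hX
  set G := Submodule.span ℝ (e '' Set.Iio M) with hG
  have hfd : FiniteDimensional ℝ G :=
    FiniteDimensional.span_of_finite ℝ ((Set.finite_Iio M).image e)
  have hle : Y ≤ X ⊔ G := by
    refine hYe.trans (Submodule.topologicalClosure_minimal _ ?_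
      (Submodule.isClosed_sup_finiteDimensional X G (Submodule.isClosed_topologicalClosure _)))
    rw [Submodule.span_le]
    rintro _ ⟨n, rfl⟩
    rcases lt_or_ge n M with hn | hn
    · exact Submodule.mem_sup_right (Submodule.subset_span ⟨n, hn, rfl⟩)
    · exact Submodule.mem_sup_left
        (Submodule.le_topologicalClosure _ (Submodule.subset_span ⟨n, hn, rfl⟩))
  obtain ⟨y, ⟨hyY, hyX⟩, hy0⟩ := exists_mem_ne_zero (not_finiteDimensional_inf hY hle)
  have hyn : 0 < ‖y‖ := norm_pos_iff.2 hy0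
  set η := min (1 / 2) (ε / 2) with hη
  have hη0 : 0 < η := by positivity
  obtain ⟨v, hv, hdist⟩ := Metric.mem_closure_iff.1 hyX (η * ‖y‖) (by positivity)
  rw [dist_eq_norm'] at hdist
  obtain ⟨x, hx, rfl⟩ := (Finsupp.mem_span_image_iff_linearCombination ℝ).1 hv
  have hη1 : η * ‖y‖ ≤ 1 / 2 * ‖y‖ := mul_le_mul_of_nonneg_right (min_le_left _ _) hyn.le
  have hη2 : η * ‖y‖ ≤ ε / 2 * ‖y‖ := mul_le_mul_of_nonneg_right (min_le_right _ _) hyn.le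
  have hyv : ‖y‖ ≤ 2 * ‖Finsupp.linearCombination ℝ e x‖ := by
    have := norm_sub_le (Finsupp.linearCombination ℝ e x) (Finsupp.linearCombination ℝ e x - y)
    rw [sub_sub_cancel] at this
    linarith
  have hx0 : x ≠ 0 := by
    rintro rfl
    rw [map_zero, norm_zero, mul_zero] at hyv
    linarith
  obtain ⟨t, ht, hbd, hf⟩ := exists_smul_bd hx0
  refine ⟨t • x, t • y, Y.smul_mem t hyY, smul_ne_zero ht.ne' hx0, fun n hn => ?_, hf, ?_⟩
  · have hn' : x n ≠ 0 := fun h0 => hn (by simp [h0])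
    exact hx (Finsupp.mem_support_iff.2 hn')
  · have h1 := h.le _ _ hbd
    rw [map_smul, norm_smul, Real.norm_of_nonneg ht.le] at h1
    rw [map_smul, ← smul_sub, norm_smul, Real.norm_of_nonneg ht.le]
    have h2 : t * ‖Finsupp.linearCombination ℝ e x - y‖ ≤
        t * (ε / 2 * (2 * ‖Finsupp.linearCombination ℝ e x‖)) := by
      refine mul_le_mul_of_nonneg_left ?_ ht.le
      have := mul_le_mul_of_nonneg_left hyv (half_pos hε).le
      linarith
    have h3 := mul_le_mul_of_nonneg_left h1 hε.le
    linarith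

/-- Every infinite dimensional subspace `Y` of the closed span is, up to a small perturbation,
a space of finitely supported vectors with tails. -/
theorem exists_hasTails (h : IsNormedBy e) {Y : Submodule ℝ E}
    (hYe : Y ≤ (Submodule.span ℝ (Set.range e)).topologicalClosure)
    (hY : ¬ FiniteDimensional ℝ Y) {δ : ℝ} (hδ : 0 < δ) :
    ∃ V : Submodule ℝ (ℕ →₀ ℝ), HasTails V ∧ ∀ x ∈ V, ∃ y ∈ Y,
      ‖Finsupp.linearCombination ℝ e x - y‖ ≤ δ * ‖Finsupp.linearCombination ℝ e x‖ := by
  obtain ⟨σ, h0, hσ⟩ := exists_chain (α := ℕ × ℕ × (ℕ →₀ ℝ) × E)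
    (P := fun s s' => s'.1 = s.1 + 1 ∧ s.2.1 ≤ s'.2.1 ∧ SuppIn s.2.1 s'.2.1 s'.2.2.1 ∧
      s'.2.2.2 ∈ Y ∧ s'.2.2.1 ≠ 0 ∧ (∃ o f, Nrm o f ∧ 1 / 2 < act f s'.2.2.1) ∧
      ‖Finsupp.linearCombination ℝ e s'.2.2.1 - s'.2.2.2‖ ≤ δ / 4 * (1 / 2) ^ s.1) (fun s => by
    obtain ⟨u, y, hy, hu0, hu, hf, hle⟩ := h.exists_near hYe hY s.2.1
      (ε := δ / 4 * (1 / 2) ^ s.1) (by positivity)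
    obtain ⟨M', hM', hs⟩ := exists_suppIn hu
    exact ⟨(s.1 + 1, M', u, y), rfl, hM', hs, hy, hu0, hf, hle⟩) (0, 0, 0, 0)
  have hcount : ∀ k, (σ k).1 = k := fun k => by
    induction k with
    | zero => simp [h0]
    | succ k ih => rw [(hσ k).1, ih]
  set r : ℕ → ℕ := fun k => (σ k).2.1 with hr
  set u : ℕ → ℕ →₀ ℝ := fun k => (σ (k + 1)).2.2.1 with hu
  set y : ℕ → E := fun k => (σ (k + 1)).2.2.2 with hy
  have hstrict : StrictMono r := strictMono_nat_of_lt_succ fun k => by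
    obtain ⟨n, hn⟩ := Finsupp.ne_iff.1 (hσ k).2.2.2.2.1
    have := (hσ k).2.2.1 n hn
    exact this.1.trans_lt this.2
  have hle : ∀ k, ‖Finsupp.linearCombination ℝ e (u k) - y k‖ ≤ δ / 4 * (1 / 2) ^ k := fun k => by
    have := (hσ k).2.2.2.2.2.2
    rwa [hcount] at this
  refine ⟨Submodule.span ℝ (Set.range u), fun M => ⟨u M, Submodule.subset_span ⟨M, rfl⟩,
    (hσ M).2.2.2.2.1, fun n hn => hstrict.le_apply.trans ((hσ M).2.2.1 n hn).1⟩, fun x hx => ?_⟩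
  obtain ⟨l, rfl⟩ := Finsupp.mem_span_range_iff_exists_finsupp.1 hx
  rw [← Finsupp.linearCombination_apply]
  obtain ⟨N, -, heq⟩ := exists_linearCombination_eq_sum_range u l
  rw [heq]
  set x := ∑ i ∈ Finset.range N, l i • u i with hx
  have hblock : IsBlock N r fun i => l i • u i :=
    ⟨hstrict.monotone, fun k _ => SuppIn.smul (hσ k).2.2.1 _⟩
  have hcoef : ∀ k < N, |l k| ≤ 2 * ‖Finsupp.linearCombination ℝ e x‖ := by
    intro k hk
    obtain ⟨o, f, hf, hlt⟩ := (hσ k).2.2.2.2.2.1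
    have h1 : act (cut (r k) (r (k + 1)) f) x = l k * act f (u k) := by
      rw [hx, map_sum, Finset.sum_eq_single k]
      · rw [map_smul, smul_eq_mul, act_cut_of_suppIn (hσ k).2.2.1]
      · intro i hi hik
        refine hblock.act_cut_eq_zero (Finset.mem_range.1 hi) ?_ _
        rcases lt_or_gt_of_ne hik with hlt | hlt
        · exact Or.inr (hstrict.monotone hlt)
        · exact Or.inl (hstrict.monotone hlt)
      · exact fun h => absurd (Finset.mem_range.2 hk) h
    have h2 := h.bd x _ _ (hf.cut (r k) (r (k + 1)))
    have h3 : 1 / 2 < act f (u k) := hlt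
    rw [h1, abs_mul, abs_of_pos (by linarith : 0 < act f (u k))] at h2
    nlinarith [abs_nonneg (l k)]
  refine ⟨∑ i ∈ Finset.range N, l i • y i, Y.sum_mem fun i _ => Y.smul_mem _ (hσ i).2.2.2.1, ?_⟩
  set B := ‖Finsupp.linearCombination ℝ e x‖ with hB
  rw [hx, map_sum, ← Finset.sum_sub_distrib]
  calc _ ≤ ∑ i ∈ Finset.range N, ‖Finsupp.linearCombination ℝ e (l i • u i) - l i • y i‖ :=
        norm_sum_le _ _
    _ ≤ ∑ i ∈ Finset.range N, δ / 2 * B * (1 / 2) ^ i := by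
        refine Finset.sum_le_sum fun i hi => ?_
        rw [map_smul, ← smul_sub, norm_smul, Real.norm_eq_abs]
        calc _ ≤ 2 * B * (δ / 4 * (1 / 2) ^ i) :=
              mul_le_mul (hcoef i (Finset.mem_range.1 hi)) (hle i) (norm_nonneg _) (by positivity)
          _ = _ := by ring
    _ = δ / 2 * B * ∑ i ∈ Finset.range N, (1 / 2 : ℝ) ^ i := by rw [Finset.mul_sum]
    _ ≤ δ / 2 * B * 2 := mul_le_mul_of_nonneg_left (sum_geometric_two_le N) (by positivity)
    _ = δ * B := by ring

/-- The completion of the finitely supported vectors is hereditarily indecomposable. -/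
theorem isHISub (h : IsNormedBy e) :
    IsHISub (Submodule.span ℝ (Set.range e)).topologicalClosure := by
  refine ⟨not_finiteDimensional_mono (not_finiteDimensional_span h.linearIndependent)
    (Submodule.le_topologicalClosure _), fun Y W hY hW hYinf hWinf C => ?_⟩
  set c := max C 1 with hc
  have hc1 : 1 ≤ c := le_max_right _ _
  have hδ : 0 < 1 / (16 * c) := by positivity
  obtain ⟨V₁, hV₁, hnear₁⟩ := h.exists_hasTails hY hYinf hδ
  obtain ⟨V₂, hV₂, hnear₂⟩ := h.exists_hasTails hW hWinf hδ
  obtain ⟨x₁, hx₁, x₂, hx₂, R, hR, o, f, hf, hlt⟩ := exists_act_add_gt_bd_sub hV₁ hV₂ (16 * c)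
  obtain ⟨y, hy, hdy⟩ := hnear₁ x₁ hx₁
  obtain ⟨w, hw, hdw⟩ := hnear₂ (-x₂) (V₂.neg_mem hx₂)
  refine ⟨y, hy, w, hw, ?_⟩
  have hb := h.le _ _ hR
  have ha := hlt.trans_le ((le_abs_self _).trans (h.bd _ _ _ hf))
  rw [map_sub] at hb
  rw [map_add] at ha
  rw [map_neg, norm_neg] at hdw
  set p := Finsupp.linearCombination ℝ e x₁
  set q := Finsupp.linearCombination ℝ e x₂
  set A := ‖p + q‖
  set B := ‖p - q‖
  have hR0 : 0 ≤ R := hR.nonneg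
  have hA : 0 < A := lt_of_le_of_lt (by positivity) ha
  have h1 : 2 * ‖p‖ ≤ A + B := by
    have := norm_add_le (p + q) (p - q)
    rwa [add_add_sub_cancel, ← two_smul ℝ p, norm_smul, Real.norm_two] at this
  have h2 : 2 * ‖q‖ ≤ A + B := by
    have := norm_sub_le (p + q) (p - q)
    rwa [add_sub_sub_cancel, ← two_smul ℝ q, norm_smul, Real.norm_two] at this
  have h3 : A - B ≤ 2 * ‖p‖ := by
    have := norm_sub_le (p + p) (p - q)
    rw [show p + p - (p - q) = p + q by abel, ← two_smul ℝ p, norm_smul, Real.norm_two] at this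
    linarith
  have h4 : ‖p‖ ≤ ‖y‖ + ‖p - y‖ := by
    have := norm_add_le y (p - y)
    rwa [add_sub_cancel] at this
  have h5 : ‖y + w‖ ≤ B + ‖p - y‖ + ‖-q - w‖ := by
    have e1 := norm_sub_le (p - q - (p - y)) (-q - w)
    have e2 := norm_sub_le (p - q) (p - y)
    rw [show p - q - (p - y) - (-q - w) = y + w by abel] at e1
    linarith
  have hcB : 16 * (c * B) ≤ A := by nlinarith
  have hBA : 16 * B ≤ A := by nlinarith [norm_nonneg (p - q)]
  have hd1 : c * ‖p - y‖ ≤ ‖p‖ / 16 := by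
    have := mul_le_mul_of_nonneg_left hdy (by linarith : 0 ≤ c)
    calc _ ≤ _ := this
      _ = ‖p‖ / 16 := by field_simp
  have hd2 : c * ‖-q - w‖ ≤ ‖q‖ / 16 := by
    have := mul_le_mul_of_nonneg_left hdw (by linarith : 0 ≤ c)
    calc _ ≤ _ := this
      _ = ‖q‖ / 16 := by field_simp
  have hd3 : ‖p - y‖ ≤ c * ‖p - y‖ := le_mul_of_one_le_left (norm_nonneg _) hc1
  have h6 : c * ‖y + w‖ ≤ c * B + c * ‖p - y‖ + c * ‖-q - w‖ := by
    have := mul_le_mul_of_nonneg_left h5 (by linarith : 0 ≤ c)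
    linarith
  have h7 : C * ‖y + w‖ ≤ c * ‖y + w‖ :=
    mul_le_mul_of_nonneg_right (le_max_left _ _) (norm_nonneg _)
  linarith

end IsNormedBy

end MixedTsirelson

/-! ### Gliding humps -/

open BoundedContinuousFunction in
/-- A sequence of unit vectors in a space of bounded functions, with pointwise disjoint essential
supports, is equivalent to the basis of `c₀`, so its span is not hereditarily indecomposable. -/
theorem not_isHISub_of_almost_disjoint {I : Type*} [TopologicalSpace I] {Z : Submodule ℝ (I →ᵇ ℝ)}
    {z : ℕ → I →ᵇ ℝ} (hz : ∀ k, z k ∈ Z) (hz1 : ∀ k, ‖z k‖ = 1)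
    (h : ∀ i k l, k < l → |z k i| ≤ 1 / 16 * (1 / 2) ^ k ∨ |z l i| ≤ 1 / 16 * (1 / 2) ^ l) :
    ¬ IsHISub Z := by
  have hle1 : ∀ k i, |z k i| ≤ 1 := fun k i => by
    rw [← hz1 k]
    exact (z k).norm_coe_le_norm i
  have hall : ∀ i, ∃ k₀, ∀ k, k ≠ k₀ → |z k i| ≤ 1 / 16 * (1 / 2) ^ k := fun i => by
    by_cases hex : ∃ k₀, 1 / 16 * (1 / 2) ^ k₀ < |z k₀ i|
    · obtain ⟨k₀, hk₀⟩ := hex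
      refine ⟨k₀, fun k hk => ?_⟩
      rcases lt_or_gt_of_ne hk with hlt | hlt
      · exact (h i k k₀ hlt).resolve_right (not_le.2 hk₀)
      · exact (h i k₀ k hlt).resolve_left (not_le.2 hk₀)
    · push Not at hex
      exact ⟨0, fun k _ => hex k⟩
  have hpt : ∀ (l : ℕ →₀ ℝ) i, ∃ n, (∀ k, l k ≠ 0 → k < n) ∧
      Finsupp.linearCombination ℝ z l i = ∑ k ∈ Finset.range n, l k * z k i := fun l i => by
    obtain ⟨n, hn, heq⟩ := exists_linearCombination_eq_sum_range z l
    refine ⟨n, hn, ?_⟩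
    rw [heq, BoundedContinuousFunction.sum_apply]
    simp
  -- off one index `k₀`, the contributions of the other vectors add up to little
  have hrest : ∀ (l : ℕ →₀ ℝ) (M : ℝ), (∀ k, |l k| ≤ M) → ∀ i n k₀,
      (∀ k, k ≠ k₀ → |z k i| ≤ 1 / 16 * (1 / 2) ^ k) →
      ∑ k ∈ (Finset.range n).erase k₀, |l k * z k i| ≤ M / 8 := by
    intro l M hM i n k₀ hk₀
    have hM0 : 0 ≤ M := (abs_nonneg _).trans (hM 0)
    calc _ ≤ ∑ k ∈ (Finset.range n).erase k₀, M / 16 * (1 / 2) ^ k := by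
          refine Finset.sum_le_sum fun k hk => ?_
          rw [abs_mul]
          calc _ ≤ M * (1 / 16 * (1 / 2) ^ k) :=
                mul_le_mul (hM k) (hk₀ k (Finset.ne_of_mem_erase hk)) (abs_nonneg _) hM0
            _ = _ := by ring
      _ ≤ ∑ k ∈ Finset.range n, M / 16 * (1 / 2) ^ k :=
          Finset.sum_le_sum_of_subset_of_nonneg (Finset.erase_subset _ _)
            fun _ _ _ => by positivity
      _ = M / 16 * ∑ k ∈ Finset.range n, (1 / 2 : ℝ) ^ k := by rw [Finset.mul_sum]
      _ ≤ M / 16 * 2 := mul_le_mul_of_nonneg_left (sum_geometric_two_le n) (by positivity)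
      _ = M / 8 := by ring
  have hupper : ∀ (l : ℕ →₀ ℝ) (M : ℝ), (∀ k, |l k| ≤ M) →
      ‖Finsupp.linearCombination ℝ z l‖ ≤ 2 * M := by
    intro l M hM
    have hM0 : 0 ≤ M := (abs_nonneg _).trans (hM 0)
    refine (BoundedContinuousFunction.norm_le (by positivity)).2 fun i => ?_
    obtain ⟨k₀, hk₀⟩ := hall i
    obtain ⟨n, -, heq⟩ := hpt l i
    rw [heq, Real.norm_eq_abs]
    refine (Finset.abs_sum_le_sum_abs _ _).trans ?_
    have h1 := hrest l M hM i n k₀ hk₀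
    have h2 : |l k₀ * z k₀ i| ≤ M := by
      rw [abs_mul]
      exact (mul_le_of_le_one_right (abs_nonneg _) (hle1 _ _)).trans (hM k₀)
    by_cases hmem : k₀ ∈ Finset.range n
    · rw [← Finset.add_sum_erase _ _ hmem]
      linarith
    · rw [Finset.erase_eq_of_notMem hmem] at h1
      linarith
  have hlower : ∀ (l : ℕ →₀ ℝ) k, |l k| ≤ 2 * ‖Finsupp.linearCombination ℝ z l‖ := by
    intro l k
    rcases eq_or_ne l 0 with rfl | hl
    · simp
    obtain ⟨m, hm, hmax⟩ := l.support.exists_max_image (fun k => |l k|)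
      (Finsupp.support_nonempty_iff.2 hl)
    have hM : ∀ k, |l k| ≤ |l m| := fun k => by
      by_cases hk : l k = 0
      · rw [hk, abs_zero]
        exact abs_nonneg _
      · exact hmax k (Finsupp.mem_support_iff.2 hk)
    refine (hM k).trans ?_
    obtain ⟨i, hi⟩ : ∃ i, 3 / 4 < |z m i| := by
      by_contra hcon
      push Not at hcon
      have := (BoundedContinuousFunction.norm_le (f := z m) (by norm_num : (0 : ℝ) ≤ 3 / 4)).2 hcon
      rw [hz1] at this
      norm_num at this
    have hbig : 1 / 16 * (1 / 2) ^ m < |z m i| := by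
      have : (1 / 2 : ℝ) ^ m ≤ 1 := pow_le_one₀ (by norm_num) (by norm_num)
      linarith
    have hoff : ∀ k, k ≠ m → |z k i| ≤ 1 / 16 * (1 / 2) ^ k := fun k hk => by
      rcases lt_or_gt_of_ne hk with hlt | hlt
      · exact (h i k m hlt).resolve_right (not_le.2 hbig)
      · exact (h i m k hlt).resolve_left (not_le.2 hbig)
    obtain ⟨n, hn, heq⟩ := hpt l i
    have hmem : m ∈ Finset.range n := Finset.mem_range.2 (hn m (Finsupp.mem_support_iff.1 hm))
    have h1 := hrest l |l m| hM i n m hoff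
    have h2 := (Finset.abs_sum_le_sum_abs _ _).trans h1
    have h3 : |Finsupp.linearCombination ℝ z l i| ≤ ‖Finsupp.linearCombination ℝ z l‖ :=
      (Finsupp.linearCombination ℝ z l : I →ᵇ ℝ).norm_coe_le_norm i
    rw [heq, ← Finset.add_sum_erase _ _ hmem] at h3
    have h4 : |l m * z m i| ≤ |l m * z m i + ∑ k ∈ (Finset.range n).erase m, l k * z k i| +
        |∑ k ∈ (Finset.range n).erase m, l k * z k i| := by
      have := abs_sub (l m * z m i + ∑ k ∈ (Finset.range n).erase m, l k * z k i)
        (∑ k ∈ (Finset.range n).erase m, l k * z k i)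
      rwa [add_sub_cancel_right] at this
    rw [abs_mul] at h4
    have h5 : |l m| * (3 / 4) ≤ |l m| * |z m i| := mul_le_mul_of_nonneg_left hi.le (abs_nonneg _)
    linarith [abs_nonneg (l m)]
  have hind : LinearIndependent ℝ z := linearIndependent_of_abs_le hlower
  intro hHI
  set S : Set ℕ := {k | Even k}
  have hsub : ∀ A : Set ℕ, Submodule.span ℝ (z '' A) ≤ Z := fun A => by
    rw [Submodule.span_le]
    rintro _ ⟨k, -, rfl⟩
    exact hz k
  have hinf : ∀ A : Set ℕ, A.Infinite → ¬ FiniteDimensional ℝ (Submodule.span ℝ (z '' A)) := by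
    intro A hA
    have := hA.to_subtype
    have h1 := not_finiteDimensional_span (hind.comp (Subtype.val : A → ℕ) Subtype.val_injective)
    rwa [Set.range_comp, Subtype.range_coe] at h1
  have hS : S.Infinite := Set.infinite_of_injective_forall_mem (f := fun n : ℕ => 2 * n)
    (fun a b hab => by simpa using hab) fun n => even_two_mul n
  have hS' : Sᶜ.Infinite := Set.infinite_of_injective_forall_mem (f := fun n : ℕ => 2 * n + 1)
    (fun a b hab => by simpa using hab) fun n => by simp [S]
  obtain ⟨y, hy, w, hw, hlt⟩ := hHI.2 _ _ (hsub S) (hsub Sᶜ) (hinf S hS) (hinf _ hS') 4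
  obtain ⟨l₁, hl₁, rfl⟩ := (Finsupp.mem_span_image_iff_linearCombination ℝ).1 hy
  obtain ⟨l₂, hl₂, rfl⟩ := (Finsupp.mem_span_image_iff_linearCombination ℝ).1 hw
  rw [← map_add] at hlt
  refine absurd hlt (not_lt.2 ?_)
  have := hupper l₁ (2 * ‖Finsupp.linearCombination ℝ z (l₁ + l₂)‖) fun k => ?_
  · linarith
  · by_cases hk : k ∈ S
    · have h0 : l₂ k = 0 := by
        by_contra hne
        exact hl₂ (Finsupp.mem_support_iff.2 hne) hk
      have := hlower (l₁ + l₂) k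
      rwa [Finsupp.add_apply, h0, add_zero] at this
    · have h0 : l₁ k = 0 := by
        by_contra hne
        exact hk (hl₁ (Finsupp.mem_support_iff.2 hne))
      rw [h0, abs_zero]
      positivity

open BoundedContinuousFunction in
/-- A space of bounded functions whose members are small off the sets `A N`, and which contains
unit vectors that are small on any of these sets, is not hereditarily indecomposable. -/
theorem not_isHISub_of_gliding_hump {I : Type*} [TopologicalSpace I] {Z : Submodule ℝ (I →ᵇ ℝ)}
    {A : ℕ → Set I} (hA : Monotone A) (htail : ∀ z ∈ Z, ∀ ε > 0, ∃ N, ∀ i ∉ A N, |z i| ≤ ε)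
    (hsmall : ∀ N, ∀ ε > 0, ∃ z ∈ Z, ‖z‖ = 1 ∧ ∀ i ∈ A N, |z i| ≤ ε) : ¬ IsHISub Z := by
  obtain ⟨σ, h0, hσ⟩ := MixedTsirelson.exists_chain (α := ℕ × ℕ × (I →ᵇ ℝ))
    (P := fun s s' => s'.1 = s.1 + 1 ∧ s.2.1 ≤ s'.2.1 ∧ s'.2.2 ∈ Z ∧ ‖s'.2.2‖ = 1 ∧
      (∀ i ∈ A s.2.1, |s'.2.2 i| ≤ 1 / 16 * (1 / 2) ^ s.1) ∧
      ∀ i ∉ A s'.2.1, |s'.2.2 i| ≤ 1 / 16 * (1 / 2) ^ s.1) (fun s => by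
    obtain ⟨z, hz, hz1, hzA⟩ := hsmall s.2.1 (1 / 16 * (1 / 2) ^ s.1) (by positivity)
    obtain ⟨N, hN⟩ := htail z hz (1 / 16 * (1 / 2) ^ s.1) (by positivity)
    exact ⟨(s.1 + 1, max s.2.1 N, z), rfl, le_max_left _ _, hz, hz1, hzA,
      fun i hi => hN i fun h => hi (hA (le_max_right _ _) h)⟩) (0, 0, 0)
  have hcount : ∀ k, (σ k).1 = k := fun k => by
    induction k with
    | zero => simp [h0]
    | succ k ih => rw [(hσ k).1, ih]
  have hmono : Monotone fun k => (σ k).2.1 := monotone_nat_of_le_succ fun k => (hσ k).2.1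
  refine not_isHISub_of_almost_disjoint (z := fun k => (σ (k + 1)).2.2) (fun k => (hσ k).2.2.1)
    (fun k => (hσ k).2.2.2.1) fun i k l hkl => ?_
  by_cases hi : i ∈ A (σ (k + 1)).2.1
  · have := (hσ l).2.2.2.2.1 i (hA (hmono hkl) hi)
    rw [hcount] at this
    exact Or.inr this
  · have := (hσ k).2.2.2.2.2 i hi
    rw [hcount] at this
    exact Or.inl this

/-! ### The tree space -/

namespace MixedTsirelson

open BoundedContinuousFunction

/-- The points at which the members of the tree space are evaluated: a branch of the tree of finite
sequences of natural numbers, together with a norming functional. -/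
structure Point where
  /-- the branch -/
  branch : ℕ → ℕ
  /-- the functional -/
  functional : ℕ →₀ ℚ
  exists_nrm : ∃ o, Nrm o functional

instance : TopologicalSpace Point := ⊥

instance : DiscreteTopology Point := ⟨rfl⟩

open Classical in
/-- The basis vector of the node `s`: on the branches through `s` it is the basis vector of the
mixed Tsirelson space whose index is the length of `s`. Nodes are lists as in `PiNat.res`, so the
last entry of a finite sequence comes first and initial segments are suffixes. -/
noncomputable def nodeVec (s : List ℕ) : Point →ᵇ ℝ :=
  ofNormedAddCommGroupDiscrete
    (fun p => if PiNat.res p.branch s.length = s then (p.functional s.length : ℝ) else 0) 1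
    (fun p => by
      split_ifs
      · obtain ⟨o, ho⟩ := p.exists_nrm
        rw [Real.norm_eq_abs]
        exact_mod_cast ho.abs_apply_le_one _
      · simp)

open Classical in
theorem nodeVec_apply (s : List ℕ) (p : Point) :
    nodeVec s p = if PiNat.res p.branch s.length = s then (p.functional s.length : ℝ) else 0 := rfl

open Classical in
/-- The indicator function of the set of branches through the node `s`. -/
noncomputable def nodeInd (s : List ℕ) : Point →ᵇ ℝ :=
  ofNormedAddCommGroupDiscrete
    (fun p => if PiNat.res p.branch s.length = s then 1 else 0) 1
    (fun p => by split_ifs <;> simp)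

/-- The restriction to the branches through the node `s`. -/
noncomputable def nodeProj (s : List ℕ) : (Point →ᵇ ℝ) →L[ℝ] (Point →ᵇ ℝ) :=
  ContinuousLinearMap.mul ℝ (Point →ᵇ ℝ) (nodeInd s)

open Classical in
theorem nodeProj_apply (s : List ℕ) (g : Point →ᵇ ℝ) (p : Point) :
    nodeProj s g p = if PiNat.res p.branch s.length = s then g p else 0 := by
  change (if PiNat.res p.branch s.length = s then (1 : ℝ) else 0) * g p = _
  split_ifs <;> simp

theorem norm_nodeProj_le (s : List ℕ) (g : Point →ᵇ ℝ) : ‖nodeProj s g‖ ≤ 1 * ‖g‖ := by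
  rw [one_mul]
  refine (BoundedContinuousFunction.norm_le (norm_nonneg _)).2 fun p => ?_
  rw [nodeProj_apply]
  split_ifs
  · exact g.norm_coe_le_norm p
  · simp

theorem res_suffix_res (σ : ℕ → ℕ) {m n : ℕ} (h : m ≤ n) : PiNat.res σ m <:+ PiNat.res σ n := by
  induction n, h using Nat.le_induction with
  | base => exact List.suffix_rfl
  | succ n _ ih => exact ih.trans (List.suffix_cons _ _)

theorem res_eq_of_suffix {σ : ℕ → ℕ} {s t : List ℕ} (h : s <:+ t)
    (ht : PiNat.res σ t.length = t) : PiNat.res σ s.length = s := by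
  have h1 := res_suffix_res σ h.length_le
  rw [ht] at h1
  exact (List.suffix_of_suffix_length_le h1 h (by simp)).eq_of_length (by simp)

/-- Along a branch, the basis vectors of the nodes span the mixed Tsirelson space. -/
theorem isNormedBy_branch (σ : ℕ → ℕ) : IsNormedBy fun n => nodeVec (PiNat.res σ n) := by
  have key : ∀ (x : ℕ →₀ ℝ) (p : Point) (g : ℕ →₀ ℚ),
      (∀ n, nodeVec (PiNat.res σ n) p = (g n : ℝ)) →
      Finsupp.linearCombination ℝ (fun n => nodeVec (PiNat.res σ n)) x p = act g x := by
    intro x p g h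
    rw [Finsupp.linearCombination_apply, act_apply, Finsupp.sum, Finsupp.sum,
      BoundedContinuousFunction.sum_apply]
    exact Finset.sum_congr rfl fun n _ => by simp [h]
  refine ⟨fun x o f hf => ?_, fun x r hx => ?_⟩
  · rw [← key x ⟨σ, f, o, hf⟩ f fun n => by simp [nodeVec_apply]]
    exact BoundedContinuousFunction.norm_coe_le_norm
      (Finsupp.linearCombination ℝ (fun n => nodeVec (PiNat.res σ n)) x) _
  · refine (BoundedContinuousFunction.norm_le hx.nonneg).2 fun p => ?_
    obtain ⟨o, ho⟩ := p.exists_nrm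
    -- the branches agree up to some height, so that the functional is cut at this height
    obtain ⟨b, hb⟩ : ∃ b, ∀ n, PiNat.res p.branch n = PiNat.res σ n ∧ p.functional n ≠ 0 ↔
        n < b ∧ p.functional n ≠ 0 := by
      classical
      by_cases hex : ∃ b, PiNat.res p.branch b ≠ PiNat.res σ b
      · refine ⟨Nat.find hex, fun n => and_congr_left fun _ => ⟨fun h => ?_, fun h => ?_⟩⟩
        · by_contra hn
          refine Nat.find_spec hex (PiNat.res_eq_res.2 fun m hm => ?_)
          exact PiNat.res_eq_res.1 h (hm.trans_le (not_lt.1 hn))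
        · by_contra hn
          exact Nat.find_min hex h hn
      · push Not at hex
        obtain ⟨b, hb⟩ := exists_cut_eq_self p.functional
        refine ⟨b, fun n => and_congr_left fun hn => ⟨fun _ => ?_, fun _ => hex n⟩⟩
        by_contra hlt
        refine hn ?_
        rw [← hb 0, cut_apply, if_neg (by omega)]
    rw [key x p (cut 0 b p.functional) fun n => ?_]
    · exact hx o _ (ho.cut 0 b)
    · rw [nodeVec_apply, PiNat.res_length, cut_apply]
      have := hb n
      by_cases h0 : p.functional n = 0
      · simp [h0]
      · simp only [h0, ne_eq, not_false_eq_true, and_true] at this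
        simp only [this, Nat.zero_le, true_and]
        split_ifs <;> simp

/-- The closed span of the basis vectors of the nodes of `T` that extend `s`. -/
noncomputable def treeSpace (T : Set (List ℕ)) (s : List ℕ) : Submodule ℝ (Point →ᵇ ℝ) :=
  (Submodule.span ℝ (nodeVec '' {t | t ∈ T ∧ s <:+ t})).topologicalClosure

theorem isClosed_treeSpace (T : Set (List ℕ)) (s : List ℕ) :
    IsClosed (treeSpace T s : Set (Point →ᵇ ℝ)) := Submodule.isClosed_topologicalClosure _

theorem nodeVec_mem_treeSpace {T : Set (List ℕ)} {s t : List ℕ} (ht : t ∈ T) (h : s <:+ t) :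
    nodeVec t ∈ treeSpace T s :=
  Submodule.le_topologicalClosure _ (Submodule.subset_span ⟨t, ⟨ht, h⟩, rfl⟩)

theorem treeSpace_eq_bot {T : Set (List ℕ)} {s : List ℕ} (h : ∀ t ∈ T, ¬ s <:+ t) :
    treeSpace T s = ⊥ := by
  have : {t | t ∈ T ∧ s <:+ t} = ∅ := Set.eq_empty_of_forall_notMem fun t ht => h t ht.1 ht.2
  rw [treeSpace, this, Set.image_empty, Submodule.span_empty]
  exact IsClosed.submodule_topologicalClosure_eq isClosed_singleton

/-- The closed span of the basis vectors of the nodes of `T` that properly extend `s`. -/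
noncomputable def properTreeSpace (T : Set (List ℕ)) (s : List ℕ) : Submodule ℝ (Point →ᵇ ℝ) :=
  (Submodule.span ℝ (nodeVec '' {t | t ∈ T ∧ s <:+ t ∧ t ≠ s})).topologicalClosure

theorem treeSpace_le (T : Set (List ℕ)) (s : List ℕ) :
    treeSpace T s ≤ properTreeSpace T s ⊔ Submodule.span ℝ {nodeVec s} := by
  refine Submodule.topologicalClosure_minimal _ ?_
    (Submodule.isClosed_sup_finiteDimensional _ _ (Submodule.isClosed_topologicalClosure _))
  rw [Submodule.span_le]
  rintro _ ⟨t, ⟨ht, hst⟩, rfl⟩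
  by_cases h : t = s
  · subst h
    exact Submodule.mem_sup_right (Submodule.subset_span rfl)
  · exact Submodule.mem_sup_left
      (Submodule.le_topologicalClosure _ (Submodule.subset_span ⟨t, ⟨ht, hst, h⟩, rfl⟩))

theorem succ_length_le {s t : List ℕ} (hst : s <:+ t) (hne : t ≠ s) : s.length + 1 ≤ t.length := by
  have := hst.length_le
  by_contra hcon
  exact hne (hst.eq_of_length (by omega)).symm

theorem nodeProj_mem_treeSpace {T : Set (List ℕ)} {s : List ℕ} (n : ℕ) {g : Point →ᵇ ℝ}
    (hg : g ∈ properTreeSpace T s) : nodeProj (n :: s) g ∈ treeSpace T (n :: s) := by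
  suffices properTreeSpace T s ≤
      (treeSpace T (n :: s)).comap (nodeProj (n :: s) : (Point →ᵇ ℝ) →ₗ[ℝ] (Point →ᵇ ℝ)) from
    this hg
  refine Submodule.topologicalClosure_minimal _ ?_
    ((isClosed_treeSpace T (n :: s)).preimage (nodeProj (n :: s)).continuous)
  rw [Submodule.span_le]
  rintro _ ⟨t, ⟨ht, hst, hne⟩, rfl⟩
  change nodeProj (n :: s) (nodeVec t) ∈ treeSpace T (n :: s)
  by_cases hns : (n :: s) <:+ t
  · convert nodeVec_mem_treeSpace ht hns using 1
    ext p
    rw [nodeProj_apply, nodeVec_apply]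
    by_cases hp : PiNat.res p.branch t.length = t
    · rw [if_pos (res_eq_of_suffix hns hp)]
    · rw [if_neg hp, ite_self]
  · convert (treeSpace T (n :: s)).zero_mem using 1
    ext p
    rw [nodeProj_apply, nodeVec_apply]
    split_ifs with h1 h2
    · refine absurd ?_ hns
      have h3 := res_suffix_res p.branch (succ_length_le hst hne)
      rwa [h2, ← List.length_cons (a := n), h1] at h3
    · rfl
    · rfl

/-- The branches through one of the first `N` children of `s`. -/
def firstChildren (s : List ℕ) (N : ℕ) : Set Point :=
  {p | ∃ n < N, PiNat.res p.branch (n :: s).length = n :: s}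

theorem exists_forall_notMem_firstChildren {T : Set (List ℕ)} {s : List ℕ} {g : Point →ᵇ ℝ}
    (hg : g ∈ properTreeSpace T s) {ε : ℝ} (hε : 0 < ε) :
    ∃ N, ∀ p ∉ firstChildren s N, |g p| ≤ ε := by
  have hmono : ∀ {N N' : ℕ}, N ≤ N' → firstChildren s N ⊆ firstChildren s N' :=
    fun {N N'} h p ⟨n, hn, hp⟩ => ⟨n, hn.trans_le h, hp⟩
  obtain ⟨g', hg', hdist⟩ := Metric.mem_closure_iff.1 hg ε hε
  have : ∃ N, ∀ p ∉ firstChildren s N, g' p = 0 := by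
    refine Submodule.span_induction ?_ ⟨0, fun _ _ => rfl⟩ ?_ ?_ hg'
    · rintro _ ⟨t, ⟨-, hst, hne⟩, rfl⟩
      refine ⟨t.sum + 1, fun p hp => ?_⟩
      rw [nodeVec_apply, if_neg fun hpt => hp ?_]
      have h1 := res_suffix_res p.branch (succ_length_le hst hne)
      rw [hpt, PiNat.res_succ, res_eq_of_suffix hst hpt] at h1
      refine ⟨p.branch s.length, Nat.lt_succ_of_le
        (List.le_sum_of_mem (h1.subset List.mem_cons_self)), ?_⟩
      rw [List.length_cons, PiNat.res_succ, res_eq_of_suffix hst hpt]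
    · rintro x y - - ⟨N, hN⟩ ⟨N', hN'⟩
      refine ⟨max N N', fun p hp => ?_⟩
      rw [BoundedContinuousFunction.add_apply, hN p fun h => hp (hmono (le_max_left _ _) h),
        hN' p fun h => hp (hmono (le_max_right _ _) h), add_zero]
    · rintro c x - ⟨N, hN⟩
      exact ⟨N, fun p hp => by simp [hN p hp]⟩
  obtain ⟨N, hN⟩ := this
  refine ⟨N, fun p hp => ?_⟩
  have h1 := (g - g').norm_coe_le_norm p
  rw [BoundedContinuousFunction.sub_apply, hN p hp, sub_zero, Real.norm_eq_abs,
    ← dist_eq_norm] at h1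
  exact h1.trans hdist.le

/-- If the space above a node contains a hereditarily indecomposable space, so does the space above
one of its children: otherwise the restrictions to the children are strictly singular, and there is
a gliding hump. -/
theorem exists_child {T : Set (List ℕ)} {s : List ℕ}
    (h : ∃ Z ≤ treeSpace T s, IsHISub Z) : ∃ n, ∃ Z ≤ treeSpace T (n :: s), IsHISub Z := by
  obtain ⟨Z₀, hZ₀, hHI₀⟩ := h
  have hinf := not_finiteDimensional_inf hHI₀.1 (hZ₀.trans (treeSpace_le T s))
  set Z := Z₀ ⊓ properTreeSpace T s with hZdef
  have hHI : IsHISub Z := hHI₀.mono inf_le_left hinf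
  by_contra hcon
  have hsing : ∀ n, ∀ W ≤ Z, ¬ FiniteDimensional ℝ W → ∀ c > 0,
      ∃ z ∈ W, ‖nodeProj (n :: s) z‖ < c * ‖z‖ := by
    intro n W hW hWinf c hc
    by_contra hbelow
    push Not at hbelow
    refine hcon ⟨n, W.map (nodeProj (n :: s) : (Point →ᵇ ℝ) →ₗ[ℝ] (Point →ᵇ ℝ)), ?_,
      (hHI.mono hW hWinf).map _ hc hbelow fun z _ => norm_nodeProj_le _ z⟩
    rintro _ ⟨z, hz, rfl⟩
    exact nodeProj_mem_treeSpace n (hW hz).2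
  have hsmall : ∀ ε > 0, ∀ N, ∃ W ≤ Z, ¬ FiniteDimensional ℝ W ∧
      ∀ n < N, ∀ z ∈ W, ‖nodeProj (n :: s) z‖ ≤ ε * ‖z‖ := by
    intro ε hε N
    induction N with
    | zero => exact ⟨Z, le_rfl, hHI.1, by simp⟩
    | succ N ih =>
      obtain ⟨W, hW, hWinf, hsm⟩ := ih
      obtain ⟨W', hW', hWinf', hsm'⟩ := exists_small_subspace hWinf (nodeProj (N :: s))
        (fun V hV => hsing N V (hV.trans hW)) hε
      refine ⟨W', hW'.trans hW, hWinf', fun n hn z hz => ?_⟩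
      rcases Nat.lt_succ_iff_lt_or_eq.1 hn with hn | rfl
      · exact hsm n hn z (hW' hz)
      · exact hsm' z hz
  refine not_isHISub_of_gliding_hump (A := firstChildren s) (Z := Z)
    (fun N N' hN p ⟨n, hn, hp⟩ => ⟨n, hn.trans_le hN, hp⟩)
    (fun z hz ε hε => exists_forall_notMem_firstChildren hz.2 hε) (fun N ε hε => ?_) hHI
  obtain ⟨W, hW, hWinf, hsm⟩ := hsmall ε hε N
  obtain ⟨z, hz, hz0⟩ := exists_mem_ne_zero hWinf
  have hn0 : ‖z‖ ≠ 0 := norm_ne_zero_iff.2 hz0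
  refine ⟨‖z‖⁻¹ • z, hW (W.smul_mem _ hz), by simp [norm_smul, hn0], ?_⟩
  rintro p ⟨n, hn, hp⟩
  have h1 := hsm n hn _ (W.smul_mem ‖z‖⁻¹ hz)
  have h2 := (nodeProj (n :: s) (‖z‖⁻¹ • z)).norm_coe_le_norm p
  rw [nodeProj_apply, if_pos hp, Real.norm_eq_abs] at h2
  rw [norm_smul, norm_inv, norm_norm, inv_mul_cancel₀ hn0, mul_one] at h1
  exact h2.trans h1

/-- If the tree space of `T` contains a hereditarily indecomposable space, then `T` has an infinite
branch. -/
theorem exists_branch {T : Set (List ℕ)} (hT : ∀ n s, n :: s ∈ T → s ∈ T)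
    (h : ∃ Z ≤ treeSpace T [], IsHISub Z) : ∃ σ : ℕ → ℕ, ∀ n, PiNat.res σ n ∈ T := by
  obtain ⟨τ, h0, hτ⟩ := exists_chain (α := {s // ∃ Z ≤ treeSpace T s, IsHISub Z})
    (P := fun s s' => ∃ n, s'.1 = n :: s.1) (fun s => by
    obtain ⟨n, hn⟩ := exists_child s.2
    exact ⟨⟨n :: s.1, hn⟩, n, rfl⟩) ⟨[], h⟩
  choose σ hσ using hτ
  have hres : ∀ n, PiNat.res σ n = (τ n).1 := fun n => by
    induction n with
    | zero => simp [h0]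
    | succ n ih => rw [hσ, PiNat.res_succ, ih]
  refine ⟨σ, fun n => ?_⟩
  rw [hres]
  obtain ⟨Z, hZ, hHI⟩ := (τ n).2
  obtain ⟨t, ht, hsuf⟩ : ∃ t ∈ T, (τ n).1 <:+ t := by
    by_contra hcon
    push Not at hcon
    rw [treeSpace_eq_bot hcon, le_bot_iff] at hZ
    subst hZ
    exact hHI.1 inferInstance
  obtain ⟨l, rfl⟩ := hsuf
  induction l with
  | nil => exact ht
  | cons a l ih => exact ih (hT a _ ht)

end MixedTsirelson

/-! ### The embedding into the continuous functions on the Cantor space -/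

/-- The Banach–Mazur theorem: a separable normed space is isometric to a space of continuous
functions on the Cantor space, since the latter maps onto the unit ball of the dual space with its
weak-* topology. -/
theorem exists_linearIsometry_cantor (E : Type*) [NormedAddCommGroup E] [NormedSpace ℝ E]
    [SeparableSpace E] : Nonempty (E →ₗᵢ[ℝ] C(ℕ → Bool, ℝ)) := by
  set K : Set (WeakDual ℝ E) := WeakDual.toStrongDual ⁻¹' Metric.closedBall 0 1 with hK
  have hcomp : IsCompact K := WeakDual.isCompact_closedBall 0 1
  have : CompactSpace K := isCompact_iff_compactSpace.1 hcomp
  have hmet : MetrizableSpace K := WeakDual.metrizable_of_isCompact ℝ E K hcomp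
  let : MetricSpace K := metrizableSpaceMetric K
  have : Nonempty K := ⟨⟨0, by simp [hK]⟩⟩
  obtain ⟨p, hp, hsurj⟩ := exists_nat_bool_continuous_surjective_of_compact K
  have hbound : ∀ (x : E) (t : ℕ → Bool), |(p t : WeakDual ℝ E) x| ≤ ‖x‖ := fun x t => by
    have h1 : ‖WeakDual.toStrongDual (p t : WeakDual ℝ E)‖ ≤ 1 :=
      mem_closedBall_zero_iff.1 (p t).2
    have h2 := (WeakDual.toStrongDual (p t : WeakDual ℝ E)).le_opNorm x
    exact h2.trans (mul_le_of_le_one_left (norm_nonneg x) h1)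
  refine ⟨⟨{ toFun := fun x => ⟨fun t => (p t : WeakDual ℝ E) x,
                (WeakDual.eval_continuous x).comp (continuous_subtype_val.comp hp)⟩
             map_add' := fun x y => by
                ext t
                exact map_add (p t : WeakDual ℝ E) x y
             map_smul' := fun c x => by
                ext t
                exact map_smul (p t : WeakDual ℝ E) c x }, fun x => ?_⟩⟩
  refine le_antisymm ((ContinuousMap.norm_le _ (norm_nonneg x)).2 fun t => hbound x t) ?_
  by_cases hx : ‖x‖ = 0
  · rw [hx]
    exact norm_nonneg _
  obtain ⟨φ, hφ, hφx⟩ := exists_dual_vector ℝ x hx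
  obtain ⟨t, ht⟩ := hsurj ⟨StrongDual.toWeakDual φ, by simp [hK, hφ]⟩
  have h1 := ContinuousMap.norm_coe_le_norm (⟨fun t => (p t : WeakDual ℝ E) x,
    (WeakDual.eval_continuous x).comp (continuous_subtype_val.comp hp)⟩ : C(ℕ → Bool, ℝ)) t
  have h2 : (p t : WeakDual ℝ E) x = ‖x‖ := by
    rw [ht]
    exact hφx
  rw [ContinuousMap.coe_mk, h2, norm_norm] at h1
  exact h1

namespace MixedTsirelson

instance : SeparableSpace (treeSpace univ []) := by
  have h : IsSeparable (treeSpace univ [] : Set (BoundedContinuousFunction Point ℝ)) :=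
    (((Set.to_countable _).image nodeVec).isSeparable.span
      (R := ℝ)).closure
  exact h.separableSpace

/-- An isometric embedding of the space of the full tree into `C(Δ)`. -/
noncomputable def treeEmb : treeSpace univ [] →ₗᵢ[ℝ] C(ℕ → Bool, ℝ) :=
  (exists_linearIsometry_cantor (treeSpace univ [])).some

/-- The basis vector of the node `s` as an element of the space of the full tree. -/
noncomputable def node (s : List ℕ) : treeSpace univ [] :=
  ⟨nodeVec s, nodeVec_mem_treeSpace (mem_univ s) List.nil_suffix⟩

/-- The space of the tree `T` as a closed subspace of `C(Δ)`. -/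
noncomputable def treeCode (T : Set (List ℕ)) : SB where
  toSubmodule := (Submodule.span ℝ ((fun s => treeEmb (node s)) '' T)).topologicalClosure
  isClosed' := Submodule.isClosed_topologicalClosure _

theorem treeEmb_node_mem {T : Set (List ℕ)} {s : List ℕ} (hs : s ∈ T) :
    treeEmb (node s) ∈ (treeCode T).toSubmodule :=
  Submodule.le_topologicalClosure _ (Submodule.subset_span ⟨s, hs, rfl⟩)

theorem treeCode_le (T : Set (List ℕ)) : (treeCode T).toSubmodule ≤
    ((treeSpace T []).comap (treeSpace univ []).subtype).map treeEmb.toLinearMap := by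
  have hcomplete : CompleteSpace (treeSpace univ []) :=
    (isClosed_treeSpace univ []).completeSpace_coe
  refine Submodule.topologicalClosure_minimal _ ?_ ?_
  · rw [Submodule.span_le]
    rintro _ ⟨s, hs, rfl⟩
    exact ⟨node s, nodeVec_mem_treeSpace hs List.nil_suffix, rfl⟩
  · exact treeEmb.isometry.isClosedEmbedding.isClosedMap _
      ((isClosed_treeSpace T []).preimage continuous_subtype_val)

theorem IsNormedBy.map {E F : Type*} [NormedAddCommGroup E] [NormedSpace ℝ E]
    [NormedAddCommGroup F] [NormedSpace ℝ F] {e : ℕ → E} (J : E →ₗᵢ[ℝ] F) :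
    IsNormedBy (fun n => J (e n)) ↔ IsNormedBy e := by
  have h : ∀ x, ‖Finsupp.linearCombination ℝ (fun n => J (e n)) x‖ =
      ‖Finsupp.linearCombination ℝ e x‖ := fun x => by
    rw [← J.norm_map]
    congr 1
    exact (Finsupp.apply_linearCombination ℝ J.toLinearMap e x).symm
  refine ⟨fun ⟨h1, h2⟩ => ⟨fun x => ?_, fun x r hx => ?_⟩,
    fun ⟨h1, h2⟩ => ⟨fun x => ?_, fun x r hx => ?_⟩⟩
  · rw [← h]
    exact h1 x
  · rw [← h]
    exact h2 x r hx
  · rw [h]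
    exact h1 x
  · rw [h]
    exact h2 x r hx

theorem isNormedBy_treeEmb (σ : ℕ → ℕ) : IsNormedBy fun n => treeEmb (node (PiNat.res σ n)) :=
  (IsNormedBy.map (e := fun n => node (PiNat.res σ n)) treeEmb).2
    ((IsNormedBy.map (treeSpace univ []).subtypeₗᵢ).1 (isNormedBy_branch σ))

theorem exists_isHISub_le_of_linearlyEmbeds {X E : Type*} [NormedAddCommGroup X] [NormedSpace ℝ X]
    [CompleteSpace X] [NormedAddCommGroup E] [NormedSpace ℝ E] {Y : Submodule ℝ E}
    (hX : IsHereditarilyIndecomposable X) (h : LinearlyEmbeds X Y) : ∃ Z ≤ Y, IsHISub Z := by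
  obtain ⟨R, hR⟩ := h
  obtain ⟨K, hK⟩ := ContinuousLinearMap.antilipschitz_of_isEmbedding R hR
  refine ⟨(⊤ : Submodule ℝ X).map (Y.subtype ∘ₗ R.toLinearMap), ?_,
    (isHISub_top_of_isHereditarilyIndecomposable hX).map _ (c := ((K : ℝ) + 1)⁻¹) (C := ‖R‖)
      (by positivity) (fun z _ => ?_) fun z _ => R.le_opNorm z⟩
  · rintro _ ⟨z, -, rfl⟩
    exact (R z).2
  · rw [inv_mul_le_iff₀ (by positivity)]
    have h3 : ‖z‖ ≤ K * ‖R z‖ := hK.le_mul_norm (map_zero R) z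
    change ‖z‖ ≤ (K + 1) * ‖R z‖
    linarith [norm_nonneg (R z)]

/-- The space of a tree contains a hereditarily indecomposable space if and only if the tree has an
infinite branch. -/
theorem treeCode_mem_containing_iff {T : Set (List ℕ)} (hT : ∀ n s, n :: s ∈ T → s ∈ T) :
    treeCode T ∈ containing HI ↔ ∃ σ : ℕ → ℕ, ∀ n, PiNat.res σ n ∈ T := by
  constructor
  · rintro ⟨Z, hZ, R, hR⟩
    refine exists_branch hT ?_
    have : CompleteSpace Z.toSubmodule := Z.isClosed.completeSpace_coe
    obtain ⟨P, hPT, hP⟩ := exists_isHISub_le_of_linearlyEmbeds (X := Z.toSubmodule) hZ ⟨R, hR⟩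
    have hle := hPT.trans (treeCode_le T)
    set G := P.comap treeEmb.toLinearMap with hG
    have hmapG : G.map treeEmb.toLinearMap = P :=
      Submodule.map_comap_eq_self (hle.trans (LinearMap.map_le_range))
    have h3 : IsHISub G := IsHISub.of_map (E := treeSpace univ []) (F := C(ℕ → Bool, ℝ)) treeEmb
      (by rwa [hmapG])
    refine ⟨G.map (treeSpace univ []).subtype, ?_,
      h3.map _ one_pos (C := 1) (fun z _ => by simp) fun z _ => by simp⟩
    rintro _ ⟨g, hg, rfl⟩
    obtain ⟨g', hg', heq⟩ := hle hg
    have : g' = g := treeEmb.isometry.injective heq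
    exact this ▸ hg'
  · rintro ⟨σ, hσ⟩
    set P := Submodule.span ℝ (Set.range fun n => treeEmb (node (PiNat.res σ n))) with hP
    have hle : P.topologicalClosure ≤ (treeCode T).toSubmodule := by
      refine Submodule.topologicalClosure_minimal _ ?_ (treeCode T).isClosed
      rw [hP, Submodule.span_le]
      rintro _ ⟨n, rfl⟩
      exact treeEmb_node_mem (hσ n)
    refine ⟨⟨P.topologicalClosure, P.isClosed_topologicalClosure⟩, ?_,
      ⟨⟨Submodule.inclusion hle, continuous_inclusion hle⟩, ?_⟩⟩
    · exact (isHereditarilyIndecomposable_iff P.isClosed_topologicalClosure).2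
        (isNormedBy_treeEmb σ).isHISub
    · exact Topology.IsEmbedding.inclusion hle

end MixedTsirelson

/-! ### The Borel reduction -/

/-- An analytic set is the result of the Souslin operation applied to closed sets that decrease
along the tree. -/
theorem exists_closed_scheme {Y : Type*} [TopologicalSpace Y] [PolishSpace Y] {B : Set Y}
    (hB : AnalyticSet B) : ∃ D : List ℕ → Set Y, (∀ s, IsClosed (D s)) ∧
      (∀ n s, D (n :: s) ⊆ D s) ∧ ∀ x, x ∈ B ↔ ∃ σ : ℕ → ℕ, ∀ n, x ∈ D (PiNat.res σ n) := by
  rw [AnalyticSet] at hB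
  rcases hB with rfl | ⟨f, hf, rfl⟩
  · exact ⟨fun _ => ∅, fun _ => isClosed_empty, fun _ _ => le_rfl, fun x => by simp⟩
  refine ⟨fun s => closure (f '' {τ | PiNat.res τ s.length = s}), fun s => isClosed_closure,
    fun n s => closure_mono (image_mono fun τ hτ =>
      MixedTsirelson.res_eq_of_suffix (List.suffix_cons n s) hτ), fun x => ⟨?_, ?_⟩⟩
  · rintro ⟨σ, rfl⟩
    exact ⟨σ, fun n => subset_closure ⟨σ, by simp, rfl⟩⟩
  · rintro ⟨σ, hσ⟩
    refine ⟨σ, ?_⟩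
    by_contra hne
    obtain ⟨U, V, hU, hV, hfU, hxV, hdisj⟩ := t2_separation hne
    have hnhds : f ⁻¹' U ∈ nhds σ := hf.continuousAt (hU.mem_nhds hfU)
    obtain ⟨_, ⟨⟨τ, n, rfl⟩, hmem, hsub⟩⟩ := (PiNat.isTopologicalBasis_cylinders
      (E := fun _ : ℕ => ℕ)).mem_nhds_iff.1 hnhds
    obtain ⟨_, hy, τ', hτ', rfl⟩ := mem_closure_iff.1 (hσ n) V hV hxV
    refine Set.disjoint_left.1 hdisj (hsub ?_) hy
    rw [PiNat.cylinder_eq_res] at hmem ⊢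
    simp only [PiNat.res_length, Set.mem_ofPred_eq] at hτ' hmem ⊢
    rw [hτ', hmem]

/-- The code of the space of a tree depends measurably on the tree. -/
theorem MixedTsirelson.measurable_treeCode {S : Type*} [MeasurableSpace S] {T : S → Set (List ℕ)}
    (hT : ∀ s, MeasurableSet {x | s ∈ T x}) : Measurable fun x => treeCode (T x) := by
  refine measurable_generateFrom ?_
  rintro _ ⟨U, hU, rfl⟩
  set w : List ℕ → C(ℕ → Bool, ℝ) := fun s => treeEmb (node s) with hw
  have heq : (fun x => treeCode (T x)) ⁻¹' {Y : SB | ((Y : Set C(ℕ → Bool, ℝ)) ∩ U).Nonempty} =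
      ⋃ A ∈ {A : Finset (List ℕ) |
        ((Submodule.span ℝ (w '' (A : Set (List ℕ))) : Set C(ℕ → Bool, ℝ)) ∩ U).Nonempty},
        ⋂ s ∈ A, {x | s ∈ T x} := by
    ext x
    simp only [Set.mem_preimage, Set.mem_ofPred_eq, Set.mem_iUnion, Set.mem_iInter, exists_prop]
    change (closure (Submodule.span ℝ (w '' T x) : Set C(ℕ → Bool, ℝ)) ∩ U).Nonempty ↔ _
    rw [closure_inter_open_nonempty_iff hU]
    constructor
    · rintro ⟨g, hg, hgU⟩
      obtain ⟨l, hl, rfl⟩ := (Finsupp.mem_span_image_iff_linearCombination ℝ).1 hg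
      exact ⟨l.support, ⟨_, (Finsupp.mem_span_image_iff_linearCombination ℝ).2
        ⟨l, (Finsupp.mem_supported ℝ l).2 le_rfl, rfl⟩, hgU⟩, fun s hs => hl hs⟩
    · rintro ⟨A, ⟨g, hg, hgU⟩, hA⟩
      exact ⟨g, Submodule.span_mono (image_mono hA) hg, hgU⟩
  rw [heq]
  exact MeasurableSet.biUnion (Set.to_countable _) fun A _ =>
    MeasurableSet.biInter (Set.to_countable _) fun s _ => hT s

theorem corollary5p1 : IsSigma11Hard.{0, v} (containing HI) := by
  intro Y _ _ B hB
  obtain ⟨τ, hpolish, hborel, hana⟩ := hB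
  obtain ⟨D, hclosed, hmono, hmem⟩ := exists_closed_scheme hana
  refine ⟨fun x => MixedTsirelson.treeCode {s | x ∈ D s},
    MixedTsirelson.measurable_treeCode fun s => (hclosed s).measurableSet, ?_⟩
  ext x
  rw [hmem x]
  exact MixedTsirelson.treeCode_mem_containing_iff fun n s h => hmono n s h
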